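/- Let $(X,Y)$ be a random couple in $\mathbb R^d\times\mathbb R$ with law $P$, $\mathbb E\|X\|^2<\infty$ and $\mathbb E Y^2<\infty$. Put $$R(\theta)=\mathbb E\big[(Y-\langle\theta,X\rangle)^2\big],\qquad N(\theta,\xi)=\mathbb E\big[(\xi Y-\langle\theta,X\rangle)^2\big],\qquad \theta\in\mathbb R^d,\ \xi\in\mathbb R,$$ let $\theta_*\in\arg\min_{\theta} R(\theta)$, and $$\kappa_1(P)=\sup\big\{\mathbb E\langle\theta,X\rangle^4:\theta\in\mathbb R^d,\ \mathbb E\langle\theta,X\rangle^2\le 1\big\},\qquad \kappa_2(P)=\frac{\mathbb E[(Y-\langle\theta_*,X\rangle)^4]}{\mathbb E[(Y-\langle\theta_*,X\rangle)^2]^2}$$ (with $\kappa_2(P)=0$ if $R(\theta_*)=0$). For $\epsilon>0$, $n\in\mathbb N$ and constants $\kappa_1,\kappa_2\ge 0$ with $\kappa=(\sqrt{\kappa_1}+\sqrt{\kappa_2})^2>1$, put $$\mu=\sqrt{\frac{2(\kappa-1)\big[\log(\epsilon^{-1})+0.73(d+1)\big]}{n}}+6.81\,\sqrt{\kappa}\,\sqrt{\frac{2(d+1)}{n}},\qquad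 \delta=\frac{2\mu}{1-4\mu},$$ $$T=\Big[20\sqrt{\kappa(d+1)}+\Big(\frac52+\frac1{2(\kappa-1)}\Big)\sqrt{2(\kappa-1)\big[\log(\epsilon^{-1})+0.73(d+1)\big]}\Big]^2 .$$ (a) Assume that $n>T$ and $0<\delta<1$ (that is, $\mu<1/6$). There is a quadratic estimator $\breve N$, that is, a measurable map from samples $(x_i,y_i)_{1\le i\le n}$ to quadratic forms $\breve N(\theta,\xi)$ on $\mathbb R^{d}\times\mathbb R$, depending on $d,n,\epsilon,\kappa_1,\kappa_2$ but not on $P$, such that for every law $P$ as above with $\kappa_1(P)\le\kappa_1$ and $\kappa_2(P)\le\kappa_2$, if the sample consists of $n$ independent copies of $(X,Y)$, then with probability at least $1-2\epsilon$ both of the following hold: $$|\breve N(\theta,\xi)-N(\theta,\xi)|\le\delta\,N(\theta,\xi)\quad\text{for all }(\theta,\xi)\in\mathbb R^d\times\mathbb R,$$ $$R(\hat\theta)-R(\theta_*)\le\frac{\delta^2}{(1-\delta)^2}\,R(\theta_*)\quad\text{for every }\hat\theta\in\arg\min_{\theta\in\mathbb R^d}\breve N(\theta,1).$$ (b) There is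 a numerical constant $C$ such that, for $d\ge1$, $0<\epsilon\le1$ and $0<\delta<1$, $$\delta^2\le C\,\frac{(\kappa_1+\kappa_2)\,(d+\log\epsilon^{-1})}{n}.$$ (c) For every $\kappa_0>1$ there is a constant $C$, depending only on $\kappa_0$, such that $T\le C(\kappa_1+\kappa_2)(d+\log\epsilon^{-1})$ whenever $d\ge1$, $0<\epsilon\le1$ and $\kappa\ge\kappa_0$. -/

import Mathlib

open MeasureTheory
open scoped ENNReal

namespace RobustLS

noncomputable section

/-- The space `ℝ^d × ℝ` in which the couple `(X, Y)` takes its values; it is also the space of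
parameters `(θ, ξ)` of the quadratic form `N`. -/
abbrev Couple (d : ℕ) : Type := EuclideanSpace ℝ (Fin d) × ℝ

/-- The quadratic risk `R(θ) = E[(Y - ⟨θ, X⟩)²]` when `(X, Y)` has law `P`. -/
def risk {d : ℕ} (P : Measure (Couple d)) (θ : EuclideanSpace ℝ (Fin d)) : ℝ :=
  ∫ z, (z.2 - inner ℝ θ z.1) ^ 2 ∂P

/-- The quadratic form `N(θ, ξ) = E[(ξ Y - ⟨θ, X⟩)²]`. -/
def energy {d : ℕ} (P : Measure (Couple d)) (θ : EuclideanSpace ℝ (Fin d)) (ξ : ℝ) : ℝ :=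
  ∫ z, (ξ * z.2 - inner ℝ θ z.1) ^ 2 ∂P

/-- `κ₁ = sup { E[⟨θ, X⟩⁴] : E[⟨θ, X⟩²] ≤ 1 }`, with values in `[0, ∞]`. -/
def kurtosisDesign {d : ℕ} (P : Measure (Couple d)) : ℝ≥0∞ :=
  ⨆ (θ : EuclideanSpace ℝ (Fin d))
    (_ : ∫⁻ z, ENNReal.ofReal (inner ℝ θ z.1 ^ 2) ∂P ≤ 1),
    ∫⁻ z, ENNReal.ofReal (inner ℝ θ z.1 ^ 4) ∂P

open Classical in
/-- `κ₂ = E[(Y - ⟨θ, X⟩)⁴] / E[(Y - ⟨θ, X⟩)²]²` if `E[(Y - ⟨θ, X⟩)²] > 0`, and `κ₂ = 0` otherwise,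
with values in `[0, ∞]`; it is used at a minimizer `θ` of the risk. -/
def kurtosisNoise {d : ℕ} (P : Measure (Couple d)) (θ : EuclideanSpace ℝ (Fin d)) : ℝ≥0∞ :=
  if 0 < risk P θ then
    (∫⁻ z, ENNReal.ofReal ((z.2 - inner ℝ θ z.1) ^ 4) ∂P) / ENNReal.ofReal (risk P θ ^ 2)
  else 0

/-- `κ = (√κ₁ + √κ₂)²`. -/
def kurt (κ₁ κ₂ : ℝ) : ℝ := (√κ₁ + √κ₂) ^ 2

/-- The bound `μ`. -/
def mu (d n : ℕ) (ε κ₁ κ₂ : ℝ) : ℝ :=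
  √(2 * (kurt κ₁ κ₂ - 1) * (Real.log ε⁻¹ + 0.73 * ((d : ℝ) + 1)) / n)
    + 6.81 * (√κ₁ + √κ₂) * √(2 * ((d : ℝ) + 1) / n)

/-- `δ = 2μ / (1 - 4μ)`. -/
def delta (d n : ℕ) (ε κ₁ κ₂ : ℝ) : ℝ :=
  2 * mu d n ε κ₁ κ₂ / (1 - 4 * mu d n ε κ₁ κ₂)

/-- The lower bound required of the sample size. -/
def threshold (d : ℕ) (ε κ₁ κ₂ : ℝ) : ℝ :=
  (20 * (√κ₁ + √κ₂) * √((d : ℝ) + 1)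
    + (5 / 2 + 1 / (2 * (kurt κ₁ κ₂ - 1)))
      * √(2 * (kurt κ₁ κ₂ - 1) * (Real.log ε⁻¹ + 0.73 * ((d : ℝ) + 1)))) ^ 2

end

end RobustLS

/-! Write N(v) for the second moment of the residual ξY − ⟨θ, X⟩ at v = (θ, ξ). That residual is ξ(Y
− ⟨θ_*, X⟩) − ⟨θ − ξθ_*, X⟩, a sum of two orthogonal terms whose kurtoses are bounded by κ₂ and κ₁,
so two applications of Cauchy–Schwarz bound its kurtosis by κ, uniformly in v
(`kurtosisBound_resid`). What remains is to estimate a quadratic form, up to a relative error, from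
heavy-tailed data.

Up to scaling v, it suffices to compare N(v) with 1, and this is done by the sign of ∑ ψ(l(⟨v, zᵢ⟩²
− 1)), where ⟨v, zᵢ⟩ is the residual at the i-th observation and ψ = `influence` is bounded,
nondecreasing and satisfies exp ψ(t) ≤ 1 + t + t²/2; its exponential moments thus require fourth
moments of the data only. To treat all v on one event, whiten the residuals (`exists_whitening`) and
perturb the parameter u by a Gaussian vector of scale r. The second derivative of `truncLog` is at
least −1/2, so ψ is dominated by the Gaussian average of `pertLog`, at the cost of a quarter of a
variance (`influence_le_integral_pertLog`). Translated Gaussians have relative entropy ‖u‖²/(2r²)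
with respect to the centred one, and a PAC-Bayesian inequality gives the uniform bound
(`exists_measurableSet_sum_influence_le`). With l and r tuned, the sum is negative wherever N = 1 −
ρ, and its analogue with the opposite argument is negative wherever N = 1 + ρ, where ρ = μ/(1 − 2μ).

The estimator is any quadratic form compatible with these signs. Up to a small relative error, N
itself is one on the good event. Since ψ(t) + ψ(−t) ≥ 0, the two sums cannot both be negative, and
this forces every compatible form to be within a factor close to (1 + ρ)/(1 − ρ) of N
(`quadEstimator_bounds`). Candidates are forms with rational matrices in the observed residuals;
they are countably many, so the first compatible one is a measurable choice.

The excess risk is of order δ² rather than δ because the estimated form is compared with N at two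
opposite points of the line through θ_* and its minimizer, which isolates the linear term
(`risk_sub_le`). -/

namespace RobustLS

noncomputable section

/-! ### The truncated logarithm and the influence function -/

/-- The quadratic approximation `1 + t + t² / 2` of the exponential function. -/
def quadExp (t : ℝ) : ℝ := 1 + t + t ^ 2 / 2

lemma half_le_quadExp (t : ℝ) : 1 / 2 ≤ quadExp t := by
  unfold quadExp; nlinarith [sq_nonneg (t + 1)]

lemma quadExp_pos (t : ℝ) : 0 < quadExp t := by linarith [half_le_quadExp t]

lemma quadExp_le_quadExp {s t : ℝ} (hs : -1 ≤ s) (hst : s ≤ t) : quadExp s ≤ quadExp t := by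
  unfold quadExp; nlinarith

/-- The derivative of `log (1 + t + t² / 2)`. -/
def logQuadSlope (t : ℝ) : ℝ := (1 + t) / quadExp t

lemma hasDerivAt_log_quadExp (t : ℝ) :
    HasDerivAt (fun t => Real.log (quadExp t)) (logQuadSlope t) t := by
  have h : HasDerivAt quadExp (1 + t) t := by
    have := ((hasDerivAt_id t).const_add 1).add (((hasDerivAt_id t).pow 2).div_const 2)
    convert! this using 1
    simp
  exact h.log (quadExp_pos t).ne'

/-- This says that the second derivative of log(1 + t + t²/2) is at least −1/2. With p = 1 + a and q
= 1 + t, it reduces to pq − 1 ≤ (p² + 1)(q² + 1)/4, and the difference is a quarter of (pq − 1)² +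
(p − q)² + 4. -/
lemma logQuadSlope_add_monotone : Monotone fun t => logQuadSlope t + t / 2 := by
  intro a t hat
  have hp := quadExp_pos a
  have hq := quadExp_pos t
  have key : logQuadSlope a - logQuadSlope t
      = (t - a) * ((1 + a) * (1 + t) - 1) / (2 * (quadExp a * quadExp t)) := by
    unfold logQuadSlope
    rw [div_sub_div _ _ hp.ne' hq.ne', div_eq_div_iff (by positivity) (by positivity)]
    unfold quadExp; ring
  have : logQuadSlope a - logQuadSlope t ≤ (t - a) / 2 := by
    rw [key, div_le_div_iff₀ (by positivity) (by norm_num)]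
    have h : (1 + a) * (1 + t) - 1 ≤ quadExp a * quadExp t := by
      unfold quadExp
      nlinarith [sq_nonneg ((1 + a) * (1 + t) - 1), sq_nonneg (a - t)]
    nlinarith [mul_le_mul_of_nonneg_left h (sub_nonneg.2 hat)]
  change logQuadSlope a + a / 2 ≤ logQuadSlope t + t / 2
  linarith

lemma log_quadExp_tangent (a t : ℝ) :
    Real.log (quadExp a) + logQuadSlope a * (t - a) - (t - a) ^ 2 / 4 ≤ Real.log (quadExp t) := by
  have hd : ∀ x, HasDerivAt (fun t => Real.log (quadExp t) + t ^ 2 / 4)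
      (logQuadSlope x + x / 2) x := fun x => by
    convert! (hasDerivAt_log_quadExp x).add (((hasDerivAt_id x).pow 2).div_const 4) using 1
    simp; ring
  have hconv : ConvexOn ℝ Set.univ fun t => Real.log (quadExp t) + t ^ 2 / 4 := by
    refine Monotone.convexOn_univ_of_deriv (fun x => (hd x).differentiableAt) ?_
    have : deriv (fun t => Real.log (quadExp t) + t ^ 2 / 4) = fun t => logQuadSlope t + t / 2 :=
      funext fun x => (hd x).deriv
    rw [this]
    exact logQuadSlope_add_monotone
  rcases lt_trichotomy a t with h | rfl | h
  · have := hconv.le_slope_of_hasDerivAt (Set.mem_univ a) (Set.mem_univ t) h (hd a)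
    rw [slope_def_field, le_div_iff₀ (by linarith)] at this
    nlinarith
  · simp
  · have := hconv.slope_le_of_hasDerivAt (Set.mem_univ t) (Set.mem_univ a) h (hd a)
    rw [slope_def_field, div_le_iff₀ (by linarith)] at this
    nlinarith

lemma log_quadExp_neg_one : Real.log (quadExp (-1)) = -Real.log 2 := by
  rw [← Real.log_inv]; norm_num [quadExp]

lemma logQuadSlope_half : logQuadSlope (1 / 2) = 12 / 13 := by
  norm_num [logQuadSlope, quadExp]

/-- A bounded nondecreasing function below `log (1 + t + t² / 2)`, equal to it on `[-1, 1/2]`,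
whose second derivative is at least `-1/2`. -/
def truncLog (t : ℝ) : ℝ :=
  Real.log (quadExp (max (-1) (min t (1 / 2))))
    + (12 / 13 * min (max (t - 1 / 2) 0) (24 / 13) - min (max (t - 1 / 2) 0) (24 / 13) ^ 2 / 4)

lemma truncLog_of_le {t : ℝ} (h : t ≤ -1) : truncLog t = -Real.log 2 := by
  rw [truncLog, min_eq_left (by linarith : t ≤ 1 / 2), max_eq_left h,
    max_eq_right (by linarith : t - 1 / 2 ≤ 0), min_eq_left (by norm_num), log_quadExp_neg_one]
  ring

lemma truncLog_of_mem {t : ℝ} (h : -1 ≤ t) (h' : t ≤ 1 / 2) :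
    truncLog t = Real.log (quadExp t) := by
  rw [truncLog, min_eq_left h', max_eq_right h,
    max_eq_right (by linarith : t - 1 / 2 ≤ 0), min_eq_left (by norm_num)]
  ring

/-- The slope of log(1 + t + t²/2) at 1/2 is 12/13. The parabola of second derivative −1/2 with this
initial slope peaks 24/13 further on, where it is continued by a constant, so that the three pieces
join with equal slopes. -/
lemma truncLog_of_mem' {t : ℝ} (h : 1 / 2 ≤ t) (h' : t - 1 / 2 ≤ 24 / 13) :
    truncLog t = Real.log (quadExp (1 / 2)) + (12 / 13 * (t - 1 / 2) - (t - 1 / 2) ^ 2 / 4) := by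
  rw [truncLog, min_eq_right h, max_eq_right (by norm_num), max_eq_left (by linarith),
    min_eq_left h']

lemma truncLog_of_ge {t : ℝ} (h : 24 / 13 ≤ t - 1 / 2) :
    truncLog t = Real.log (quadExp (1 / 2)) + 144 / 169 := by
  rw [truncLog, min_eq_right (by linarith), max_eq_right (by norm_num), max_eq_left (by linarith),
    min_eq_right h]
  ring

lemma truncLog_cases (t : ℝ) :
    (t ≤ -1 ∧ truncLog t = -Real.log 2) ∨
    (-1 ≤ t ∧ t ≤ 1 / 2 ∧ truncLog t = Real.log (quadExp t)) ∨
    (1 / 2 ≤ t ∧ t - 1 / 2 ≤ 24 / 13 ∧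
      truncLog t = Real.log (quadExp (1 / 2)) + (12 / 13 * (t - 1 / 2) - (t - 1 / 2) ^ 2 / 4)) ∨
    (24 / 13 ≤ t - 1 / 2 ∧ truncLog t = Real.log (quadExp (1 / 2)) + 144 / 169) := by
  rcases le_total t (-1) with h | h
  · exact Or.inl ⟨h, truncLog_of_le h⟩
  rcases le_total t (1 / 2) with h1 | h1
  · exact Or.inr (Or.inl ⟨h, h1, truncLog_of_mem h h1⟩)
  rcases le_total (t - 1 / 2) (24 / 13) with h2 | h2
  · exact Or.inr (Or.inr (Or.inl ⟨h1, h2, truncLog_of_mem' h1 h2⟩))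
  · exact Or.inr (Or.inr (Or.inr ⟨h2, truncLog_of_ge h2⟩))

@[fun_prop]
lemma continuous_truncLog : Continuous truncLog := by
  unfold truncLog
  refine Continuous.add (Continuous.log ?_ fun t => (quadExp_pos _).ne') (by fun_prop)
  unfold quadExp
  fun_prop

lemma truncLog_monotone : Monotone truncLog := by
  intro s t hst
  unfold truncLog
  refine add_le_add (Real.log_le_log (quadExp_pos _) (quadExp_le_quadExp (le_max_left _ _) ?_)) ?_
  · exact max_le_max le_rfl (min_le_min hst le_rfl)
  · have h1 : min (max (s - 1 / 2) 0) (24 / 13) ≤ min (max (t - 1 / 2) 0) (24 / 13) :=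
      min_le_min (max_le_max (by linarith) le_rfl) le_rfl
    have h2 : min (max (t - 1 / 2) 0) (24 / 13) ≤ 24 / 13 := min_le_right _ _
    nlinarith

lemma neg_log_two_le_truncLog (t : ℝ) : -Real.log 2 ≤ truncLog t := by
  rcases le_total t (-1) with h | h
  · exact (truncLog_of_le h).ge
  · rw [← truncLog_of_le le_rfl]; exact truncLog_monotone h

lemma truncLog_le (t : ℝ) : truncLog t ≤ Real.log (quadExp (1 / 2)) + 144 / 169 := by
  rw [← truncLog_of_ge (t := max t (1 / 2 + 24 / 13)) (by linarith [le_max_right t (1 / 2 + 24 / 13)])]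
  exact truncLog_monotone (le_max_left _ _)

lemma exp_truncLog_le_four (t : ℝ) : Real.exp (truncLog t) ≤ 4 := by
  have h := Real.exp_le_exp.2 (truncLog_le t)
  rw [Real.exp_add, Real.exp_log (quadExp_pos _)] at h
  -- Here 144/169 is 16 times 9/169, and exp(x) ≤ 1/(1 − x) at x = 9/169 is sharp enough. The
  -- product of 2.41 with 13/8, the value of `quadExp` at 1/2, is below 4.
  have h2 : Real.exp (144 / 169) ≤ 2.41 := by
    have h3 : Real.exp (9 / 169 : ℝ) ≤ 169 / 160 := by
      have h4 := Real.add_one_le_exp (-(9 / 169) : ℝ)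
      rw [Real.exp_neg] at h4
      have h5 := inv_anti₀ (by norm_num) h4
      rw [inv_inv] at h5
      refine h5.trans ?_
      norm_num
    calc Real.exp (144 / 169 : ℝ) = Real.exp (9 / 169 : ℝ) ^ 16 := by
          rw [← Real.exp_nat_mul]; norm_num
      _ ≤ (169 / 160) ^ 16 := by gcongr
      _ ≤ 2.41 := by norm_num
  have h5 : quadExp (1 / 2) = 13 / 8 := by norm_num [quadExp]
  rw [h5] at h
  nlinarith

/-- Beyond 1/2 the parabola is the lower tangent parabola of `log_quadExp_tangent` at 1/2; past its
peak the truncation is constant while the logarithm still increases. -/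
lemma truncLog_le_log_quadExp (t : ℝ) : truncLog t ≤ Real.log (quadExp t) := by
  rcases truncLog_cases t with ⟨h, e⟩ | ⟨h, h', e⟩ | ⟨h, h', e⟩ | ⟨h, e⟩ <;> rw [e]
  · rw [← log_quadExp_neg_one]
    exact Real.log_le_log (quadExp_pos _) (by
      have := half_le_quadExp t
      norm_num [quadExp] at this ⊢; linarith)
  · have := log_quadExp_tangent (1 / 2) t
    rw [logQuadSlope_half] at this
    linarith
  · have := log_quadExp_tangent (1 / 2) (1 / 2 + 24 / 13)
    rw [logQuadSlope_half] at this
    have h2 := Real.log_le_log (quadExp_pos _)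
      (quadExp_le_quadExp (by norm_num) (by linarith : 1 / 2 + 24 / 13 ≤ t))
    linarith

lemma exp_truncLog_le_quadExp (t : ℝ) : Real.exp (truncLog t) ≤ quadExp t := by
  rw [← Real.le_log_iff_exp_le (quadExp_pos t)]
  exact truncLog_le_log_quadExp t

/-- Adding t²/4 to `truncLog` makes it convex, since its pieces have second derivative at least −1/2
and join with equal slopes. Averaged over a random t of mean a, the inequality loses only a quarter
of the variance. -/
lemma truncLog_tangent (a : ℝ) :
    ∃ c : ℝ, ∀ t, truncLog a + c * (t - a) - (t - a) ^ 2 / 4 ≤ truncLog t := by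
  -- To the left of −1 the right-hand side is constant while the left-hand side is nondecreasing in
  -- t (c ≥ 0 and t ≤ a), so the case t = −1 settles all smaller t.
  have reduce : ∀ c : ℝ, -1 ≤ a → 0 ≤ c →
      (∀ t, -1 ≤ t → truncLog a + c * (t - a) - (t - a) ^ 2 / 4 ≤ truncLog t) →
      ∃ c : ℝ, ∀ t, truncLog a + c * (t - a) - (t - a) ^ 2 / 4 ≤ truncLog t := by
    intro c ha hc h
    refine ⟨c, fun t => ?_⟩
    rcases le_total (-1) t with ht | ht
    · exact h t ht
    · have h1 := h (-1) le_rfl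
      rw [truncLog_of_le le_rfl] at h1
      rw [truncLog_of_le ht]
      nlinarith
  have tan := fun t => log_quadExp_tangent (1 / 2) t
  simp only [logQuadSlope_half] at tan
  rcases truncLog_cases a with ⟨ha, e⟩ | ⟨ha, ha', e⟩ | ⟨ha, ha', e⟩ | ⟨ha, e⟩
  · refine ⟨0, fun t => ?_⟩
    rw [e]
    nlinarith [neg_log_two_le_truncLog t]
  · have hs : 0 ≤ logQuadSlope a := div_nonneg (by linarith) (quadExp_pos a).le
    have hmono := logQuadSlope_add_monotone ha'
    simp only [logQuadSlope_half] at hmono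
    refine reduce (logQuadSlope a) ha hs fun t ht => ?_
    rw [e]
    rcases truncLog_cases t with ⟨h, e'⟩ | ⟨h, h', e'⟩ | ⟨h, h', e'⟩ | ⟨h, e'⟩
    · obtain rfl : t = -1 := le_antisymm h ht
      rw [e', ← log_quadExp_neg_one]
      exact log_quadExp_tangent a _
    · rw [e']; exact log_quadExp_tangent a t
    · have := log_quadExp_tangent a (1 / 2)
      rw [e']
      nlinarith [mul_le_mul_of_nonneg_right hmono (by linarith : (0 : ℝ) ≤ t - 1 / 2)]
    · have := log_quadExp_tangent a (1 / 2)
      rw [e']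
      nlinarith [mul_le_mul_of_nonneg_right hmono (by linarith : (0 : ℝ) ≤ t - 1 / 2),
        sq_nonneg (t - 1 / 2 - 24 / 13)]
  · refine reduce (12 / 13 - (a - 1 / 2) / 2) (by linarith) (by linarith) fun t ht => ?_
    rw [e]
    rcases truncLog_cases t with ⟨h, e'⟩ | ⟨h, h', e'⟩ | ⟨h, h', e'⟩ | ⟨h, e'⟩ <;> rw [e']
    · obtain rfl : t = -1 := le_antisymm h ht
      rw [← log_quadExp_neg_one]
      nlinarith [tan (-1)]
    · nlinarith [tan t]
    · nlinarith
    · nlinarith [sq_nonneg (t - 1 / 2 - 24 / 13)]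
  · refine reduce 0 (by linarith) le_rfl fun t ht => ?_
    rw [e]
    rcases truncLog_cases t with ⟨h, e'⟩ | ⟨h, h', e'⟩ | ⟨h, h', e'⟩ | ⟨h, e'⟩ <;> rw [e']
    · obtain rfl : t = -1 := le_antisymm h ht
      rw [← log_quadExp_neg_one]
      nlinarith [tan (-1)]
    · nlinarith [tan t]
    · nlinarith
    · nlinarith [sq_nonneg (t - a)]

/-- The influence function of the estimator. -/
def influence (t : ℝ) : ℝ := min (truncLog t) (Real.log 2)

@[fun_prop]
lemma continuous_influence : Continuous influence := by
  unfold influence; fun_prop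

lemma influence_monotone : Monotone influence :=
  fun _ _ h => min_le_min (truncLog_monotone h) le_rfl

lemma influence_le_truncLog (t : ℝ) : influence t ≤ truncLog t := min_le_left _ _

lemma influence_le_log_two (t : ℝ) : influence t ≤ Real.log 2 := min_le_right _ _

/-- This replaces oddness: the sums of the influence function and of its reflection cannot both be
negative. The cap log 2 matches the lower bound −log 2, which settles the values of t where the cap
is active. -/
lemma influence_add_neg_nonneg (t : ℝ) : 0 ≤ influence t + influence (-t) := by
  wlog ht : 0 ≤ t generalizing t with H
  · have := H (-t) (by linarith)
    rw [neg_neg] at this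
    linarith
  have hl : 0 < Real.log 2 := Real.log_pos (by norm_num)
  have bound : ∀ s : ℝ, s ≤ 1 / 2 → truncLog s ≤ Real.log 2 := fun s hs => by
    refine (truncLog_monotone hs).trans ?_
    rw [truncLog_of_mem (by norm_num) le_rfl]
    exact Real.log_le_log (quadExp_pos _) (by norm_num [quadExp])
  have hneg : influence (-t) = truncLog (-t) := min_eq_left (bound _ (by linarith))
  rw [hneg]
  have hlow := neg_log_two_le_truncLog (-t)
  rcases le_total (truncLog t) (Real.log 2) with h2 | h2
  swap
  · rw [influence, min_eq_right h2]; linarith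
  rw [influence, min_eq_left h2]
  have mid : ∀ t : ℝ, 1 / 2 ≤ t → t ≤ 1 → 0 ≤ truncLog t + truncLog (-t) := by
    intro t h1 h3
    rw [truncLog_of_mem' h1 (by linarith), truncLog_of_mem (by linarith) (by linarith)]
    set y := quadExp (1 / 2) * quadExp (-t) with hy
    have hypos : 0 < y := mul_pos (quadExp_pos _) (quadExp_pos _)
    have hlog : Real.log (quadExp (1 / 2)) + Real.log (quadExp (-t)) = Real.log y :=
      (Real.log_mul (quadExp_pos _).ne' (quadExp_pos _).ne').symm
    -- The bound log y ≥ 1 − 1/y turns the claim on [1/2, 1] into a polynomial inequality in r = t −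
    -- 1/2.
    have h4 := Real.one_sub_inv_le_log_of_pos hypos
    have h5 : 1 - y⁻¹ + (12 / 13 * (t - 1 / 2) - (t - 1 / 2) ^ 2 / 4) ≥ 0 := by
      have h6 : 1 ≤ y * (1 + (12 / 13 * (t - 1 / 2) - (t - 1 / 2) ^ 2 / 4)) := by
        have : y = 13 / 8 * (1 - t + t ^ 2 / 2) := by rw [hy]; unfold quadExp; ring
        rw [this]
        obtain ⟨r, rfl⟩ : ∃ r, t = 1 / 2 + r := ⟨t - 1 / 2, by ring⟩
        have hr : 0 ≤ r := by linarith
        have hr' : r ≤ 1 / 2 := by linarith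
        nlinarith [mul_nonneg hr (sub_nonneg.2 hr'), mul_nonneg hr (mul_nonneg hr hr),
          sq_nonneg r, sq_nonneg (r * (r - 1)), mul_nonneg (mul_nonneg hr hr) (sub_nonneg.2 hr'), sq_nonneg (r - 1/8)]
      have h7 := (inv_le_iff_one_le_mul₀' hypos).2 h6
      linarith
    linarith
  rcases le_total t (1 / 2) with h1 | h1
  · rw [truncLog_of_mem (by linarith) h1, truncLog_of_mem (by linarith) (by linarith),
      ← Real.log_mul (quadExp_pos _).ne' (quadExp_pos _).ne']
    -- The product of `quadExp t` and `quadExp (-t)` is 1 + t⁴/4.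
    refine Real.log_nonneg ?_
    unfold quadExp
    nlinarith [sq_nonneg (t ^ 2)]
  rcases le_total t 1 with h3 | h3
  · exact mid t h1 h3
  · have h4 := mid 1 (by norm_num) le_rfl
    rw [truncLog_of_le le_rfl] at h4
    rw [truncLog_of_le (by linarith : -t ≤ -1)]
    have := truncLog_monotone h3
    linarith

lemma influence_nonneg {t : ℝ} (ht : 0 ≤ t) : 0 ≤ influence t := by
  have h1 := influence_add_neg_nonneg t
  have h2 := influence_monotone (by linarith : -t ≤ t)
  linarith

end

end RobustLS

/-! ### Gaussian measures: translations and moments -/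

namespace RobustLS

noncomputable section

open ProbabilityTheory

lemma lintegral_pi_prod {ι : Type*} [Fintype ι] {α : ι → Type*} [∀ i, MeasurableSpace (α i)]
    (μ : ∀ i, Measure (α i)) [∀ i, IsProbabilityMeasure (μ i)] {f : ∀ i, α i → ℝ≥0∞}
    (hf : ∀ i, Measurable (f i)) :
    ∫⁻ x, ∏ i, f i (x i) ∂Measure.pi μ = ∏ i, ∫⁻ x, f i x ∂μ i := by
  have h := lintegral_prod_eq_prod_lintegral_of_indepFun (μ := Measure.pi μ) Finset.univ
    (fun i x => f i (x i)) (iIndepFun_pi fun i => (hf i).aemeasurable)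
    fun i => (hf i).comp (measurable_pi_apply i)
  refine h.trans ?_
  refine Finset.prod_congr rfl fun i _ => ?_
  exact (measurePreserving_eval μ i).lintegral_comp (hf i)

lemma gaussianReal_eq_withDensity (w : ℝ) :
    gaussianReal w 1
      = (gaussianReal 0 1).withDensity fun x => ENNReal.ofReal (Real.exp (x * w - w ^ 2 / 2)) := by
  rw [gaussianReal_of_var_ne_zero _ one_ne_zero, gaussianReal_of_var_ne_zero _ one_ne_zero,
    ← withDensity_mul _ (measurable_gaussianPDF 0 1) (by fun_prop)]
  congr 1
  ext x
  rw [Pi.mul_apply, gaussianPDF, gaussianPDF, ← ENNReal.ofReal_mul (gaussianPDFReal_nonneg _ _ _),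
    gaussianPDFReal, gaussianPDFReal, mul_assoc _ (Real.exp _) (Real.exp _), ← Real.exp_add]
  congr 3
  simp only [NNReal.coe_one]
  ring

lemma pi_gaussianReal_map_add {ι : Type*} [Fintype ι] (w : ι → ℝ) :
    (Measure.pi fun _ : ι => gaussianReal 0 1).map (· + w)
      = (Measure.pi fun _ : ι => gaussianReal 0 1).withDensity
          fun x => ∏ i, ENNReal.ofReal (Real.exp (x i * w i - w i ^ 2 / 2)) := by
  have h1 : (Measure.pi fun _ : ι => gaussianReal 0 1).map (· + w)
      = Measure.pi fun i => gaussianReal (w i) 1 := by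
    have h2 : ∀ i, (gaussianReal 0 1).map (· + w i) = gaussianReal (w i) 1 := fun i => by
      rw [gaussianReal_map_add_const, zero_add]
    have : ∀ i, SigmaFinite ((gaussianReal 0 1).map (· + w i)) := fun i => by
      rw [h2]; infer_instance
    have := Measure.pi_map_pi (μ := fun _ : ι => gaussianReal 0 1) (f := fun i x => x + w i)
      fun i => by fun_prop
    simp only [h2] at this
    exact this
  rw [h1]
  refine (Measure.pi_eq fun s hs => ?_)
  rw [withDensity_apply _ (MeasurableSet.univ_pi hs), ← lintegral_indicator (MeasurableSet.univ_pi hs)]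
  have : ∀ x : ι → ℝ, (Set.univ.pi s).indicator
      (fun x => ∏ i, ENNReal.ofReal (Real.exp (x i * w i - w i ^ 2 / 2))) x
      = ∏ i, (s i).indicator (fun y => ENNReal.ofReal (Real.exp (y * w i - w i ^ 2 / 2))) (x i) := by
    intro x
    by_cases hx : x ∈ Set.univ.pi s
    · rw [Set.indicator_of_mem hx]
      exact Finset.prod_congr rfl fun i _ =>
        (Set.indicator_of_mem (hx i trivial)
          (fun y => ENNReal.ofReal (Real.exp (y * w i - w i ^ 2 / 2)))).symm
    · rw [Set.indicator_of_notMem hx]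
      simp only [Set.mem_pi, Set.mem_univ, true_implies, not_forall] at hx
      obtain ⟨i, hi⟩ := hx
      exact (Finset.prod_eq_zero (Finset.mem_univ i) (Set.indicator_of_notMem hi _)).symm
  simp only [this]
  rw [lintegral_pi_prod (fun _ : ι => gaussianReal 0 1)
    (f := fun i => (s i).indicator fun y => ENNReal.ofReal (Real.exp (y * w i - w i ^ 2 / 2)))
    fun i => Measurable.indicator (by fun_prop) (hs i)]
  refine Finset.prod_congr rfl fun i _ => ?_
  rw [lintegral_indicator (hs i), gaussianReal_eq_withDensity (w i), withDensity_apply _ (hs i)]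

variable {E : Type*} [NormedAddCommGroup E] [InnerProductSpace ℝ E] [FiniteDimensional ℝ E]
  [MeasurableSpace E] [BorelSpace E]

/-- Change of variables for a translation of the standard Gaussian measure. -/
lemma lintegral_stdGaussian_add (w : E) {f : E → ℝ≥0∞} (hf : Measurable f) :
    ∫⁻ g, f (g + w) ∂stdGaussian E
      = ∫⁻ g, ENNReal.ofReal (Real.exp (inner ℝ g w - ‖w‖ ^ 2 / 2)) * f g ∂stdGaussian E := by
  set b := stdOrthonormalBasis ℝ E
  set c : Fin (Module.finrank ℝ E) → ℝ := fun i => inner ℝ (b i) w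
  have hw : ∑ i, c i • b i = w := by
    simpa using b.sum_repr' w
  have hm : Measurable fun x : Fin (Module.finrank ℝ E) → ℝ => ∑ i, x i • b i := by fun_prop
  have h1 : ∀ x : Fin (Module.finrank ℝ E) → ℝ,
      ∑ i, x i • b i + w = ∑ i, (x + c) i • b i := fun x => by
    conv_lhs => rw [← hw]
    simp [add_smul, Finset.sum_add_distrib]
  have h2 : ∀ x : Fin (Module.finrank ℝ E) → ℝ,
      inner ℝ (∑ i, x i • b i) w - ‖w‖ ^ 2 / 2 = ∑ i, (x i * c i - c i ^ 2 / 2) := fun x => by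
    rw [Finset.sum_sub_distrib, ← Finset.sum_div, ← b.sum_sq_inner_right w, sum_inner]
    simp [c, real_inner_smul_left]
  rw [stdGaussian, lintegral_map (by fun_prop) hm, lintegral_map (by fun_prop) hm]
  simp only [h1]
  have := lintegral_map (μ := Measure.pi fun _ : Fin (Module.finrank ℝ E) => gaussianReal 0 1)
    (f := fun x => f (∑ i, x i • b i)) (g := (· + c)) (hf.comp hm) (by fun_prop)
  rw [← this, pi_gaussianReal_map_add]
  refine (lintegral_withDensity_eq_lintegral_mul _ (by fun_prop) (hf.comp hm)).trans ?_
  refine lintegral_congr fun x => ?_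
  rw [Pi.mul_apply, h2, Real.exp_sum, ENNReal.ofReal_prod_of_nonneg fun i _ => (Real.exp_pos _).le]
  rfl

lemma map_inner_stdGaussian (x : E) :
    (stdGaussian E).map (fun g => inner ℝ g x) = gaussianReal 0 (‖x‖₊ ^ 2) := by
  have h := (IsGaussian.hasGaussianLaw_id (μ := stdGaussian E)).map_fun (innerSL ℝ x)
  have h2 := h.map_eq_gaussianReal
  have h3 : (fun ω : E => (innerSL ℝ x) (id ω)) = fun g => inner ℝ g x := by
    ext g; simp [real_inner_comm]
  have h4 : (fun g : E => inner ℝ g x) = innerSL ℝ x := by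
    ext g; simp [real_inner_comm]
  rw [h3] at h2
  rw [h2, h4]
  congr 1
  · exact integral_strongDual_stdGaussian (innerSL ℝ x)
  · rw [variance_dual_stdGaussian]
    ext
    simp

lemma integral_pow_four_gaussianReal (v : NNReal) : ∫ x, x ^ 4 ∂gaussianReal 0 v = 3 * v ^ 2 := by
  have h := iteratedDeriv_mgf_zero (X := id) (μ := gaussianReal 0 v)
    (by rw [integrableExpSet_id_gaussianReal]; simp) 4
  have e : ∫ x, x ^ 4 ∂gaussianReal 0 v = ∫ x, (id ^ 4) x ∂gaussianReal 0 v := rfl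
  rw [e, ← h, mgf_id_gaussianReal]
  have d : ∀ (P P' : ℝ → ℝ), (∀ t, HasDerivAt P (P' t) t) →
      deriv (fun t => P t * Real.exp (v * t ^ 2 / 2))
        = fun t => (P' t + P t * (v * t)) * Real.exp (v * t ^ 2 / 2) := by
    intro P P' hP
    ext t
    have h2 : HasDerivAt (fun t : ℝ => (v : ℝ) * t ^ 2 / 2) (v * t) t := by
      have := (((hasDerivAt_id t).pow 2).const_mul (v : ℝ)).div_const 2
      convert! this using 1
      simp; ring
    refine ((hP t).mul h2.exp).deriv.trans ?_
    ring
  have e0 : (fun t : ℝ => Real.exp (0 * t + v * t ^ 2 / 2))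
      = fun t => (fun _ => (1 : ℝ)) t * Real.exp (v * t ^ 2 / 2) := by
    ext t; simp
  rw [e0, iteratedDeriv_succ, iteratedDeriv_succ, iteratedDeriv_succ, iteratedDeriv_one,
    d _ (fun _ => 0) fun t => hasDerivAt_const _ _,
    d (fun t => 0 + 1 * (v * t)) (fun _ => v) fun t => by
      simpa using (hasDerivAt_id t).const_mul (v : ℝ),
    d (fun t => v + (0 + 1 * (v * t)) * (v * t)) (fun t => 2 * v ^ 2 * t) fun t => by
      have := (((hasDerivAt_id t).pow 2).const_mul ((v : ℝ) ^ 2)).const_add (v : ℝ)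
      convert! this using 1
      · ext s; simp; ring
      · simp; ring,
    d (fun t => 2 * v ^ 2 * t + (v + (0 + 1 * (v * t)) * (v * t)) * (v * t))
      (fun t => 3 * v ^ 2 + 3 * v ^ 3 * t ^ 2) fun t => by
      have := ((hasDerivAt_id t).const_mul (3 * (v : ℝ) ^ 2)).add
        (((hasDerivAt_id t).pow 3).const_mul ((v : ℝ) ^ 3))
      convert! this using 1
      · ext s; simp; ring
      · simp; ring]
  simp

lemma integral_pow_three_gaussianReal (v : NNReal) : ∫ x, x ^ 3 ∂gaussianReal 0 v = 0 := by
  have h : ∫ x, x ^ 3 ∂gaussianReal 0 v = ∫ x, (-x) ^ 3 ∂gaussianReal 0 v := by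
    have h1 := gaussianReal_map_neg (μ := 0) (v := v)
    rw [neg_zero] at h1
    conv_lhs => rw [← h1, integral_map (by fun_prop) (by fun_prop)]
  have h2 : ∫ x, (-x) ^ 3 ∂gaussianReal 0 v = -∫ x, x ^ 3 ∂gaussianReal 0 v := by
    rw [← integral_neg]
    congr 1; ext x; ring
  linarith

lemma integral_sq_gaussianReal (v : NNReal) : ∫ x, x ^ 2 ∂gaussianReal 0 v = v := by
  have h := variance_fun_id_gaussianReal (μ := 0) (v := v)
  rw [variance_of_integral_eq_zero (by fun_prop) integral_id_gaussianReal] at h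
  exact h

lemma integrable_pow_gaussianReal (v : NNReal) (k : ℕ) :
    Integrable (fun x => x ^ k) (gaussianReal 0 v) := by
  rcases Nat.eq_zero_or_pos k with rfl | hk
  · simp
  have h := (memLp_id_gaussianReal (μ := 0) (v := v) k).integrable_norm_pow hk.ne'
  refine h.mono' (by fun_prop) (Filter.Eventually.of_forall fun x => ?_)
  simp

variable (x : E)

lemma integral_inner_stdGaussian (f : ℝ → ℝ) (hf : Measurable f) :
    ∫ g, f (inner ℝ g x) ∂stdGaussian E
      = ∫ y, f y ∂gaussianReal 0 (‖x‖₊ ^ 2) := by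
  rw [← map_inner_stdGaussian x, integral_map (by fun_prop) hf.aestronglyMeasurable]

lemma integrable_inner_pow_stdGaussian (k : ℕ) :
    Integrable (fun g => inner ℝ g x ^ k) (stdGaussian E) := by
  have := integrable_pow_gaussianReal (‖x‖₊ ^ 2) k
  rw [← map_inner_stdGaussian x] at this
  exact this.comp_measurable (by fun_prop)

lemma integral_inner_stdGaussian_id : ∫ g, inner ℝ g x ∂stdGaussian E = 0 := by
  rw [integral_inner_stdGaussian x (fun y => y) (by fun_prop), integral_id_gaussianReal]

lemma integral_inner_sq_stdGaussian : ∫ g, inner ℝ g x ^ 2 ∂stdGaussian E = ‖x‖ ^ 2 := by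
  rw [integral_inner_stdGaussian x (fun y => y ^ 2) (by fun_prop), integral_sq_gaussianReal]; simp

lemma integral_inner_pow_three_stdGaussian : ∫ g, inner ℝ g x ^ 3 ∂stdGaussian E = 0 := by
  rw [integral_inner_stdGaussian x (fun y => y ^ 3) (by fun_prop), integral_pow_three_gaussianReal]

lemma integral_inner_pow_four_stdGaussian :
    ∫ g, inner ℝ g x ^ 4 ∂stdGaussian E = 3 * ‖x‖ ^ 4 := by
  rw [integral_inner_stdGaussian x (fun y => y ^ 4) (by fun_prop), integral_pow_four_gaussianReal]
  simp
  ring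

lemma integral_neg_stdGaussian (f : E → ℝ) :
    ∫ g, f (-g) ∂stdGaussian E = ∫ g, f g ∂stdGaussian E := by
  have h := stdGaussian_map (LinearIsometryEquiv.neg ℝ (E := E))
  conv_rhs => rw [← h]
  exact ((LinearIsometryEquiv.neg ℝ (E := E)).toHomeomorph.measurableEmbedding.integral_map f).symm

end

end RobustLS

/-! ### Gaussian smoothing of the influence function -/

namespace RobustLS

noncomputable section

open ProbabilityTheory

variable {E : Type*} [NormedAddCommGroup E] [InnerProductSpace ℝ E]

/-- The recentred argument of the influence function at a perturbed parameter `u`. -/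
def devArg (σ l r : ℝ) (u x : E) : ℝ := σ * l * (inner ℝ u x ^ 2 - r ^ 2 * ‖x‖ ^ 2 - 1)

/-- A quarter of the variance of `devArg` under a Gaussian perturbation of scale `r`. -/
def varArg (l r : ℝ) (u x : E) : ℝ :=
  l ^ 2 * (inner ℝ u x ^ 2 * (r ^ 2 * ‖x‖ ^ 2) + (r ^ 2 * ‖x‖ ^ 2) ^ 2 / 2)

/-- The function whose Gaussian smoothing dominates the influence function. -/
def pertLog (σ l r : ℝ) (u x : E) : ℝ :=
  truncLog (devArg σ l r u x) + 2 * min (Real.log 4) (varArg l r u x)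

/-- The polynomial bound of `exp (pertLog σ l r u x)`. -/
def pertBound (σ l r : ℝ) (u x : E) : ℝ :=
  quadExp (devArg σ l r u x) + 44 * varArg l r u x

lemma varArg_nonneg (l r : ℝ) (u x : E) : 0 ≤ varArg l r u x := by
  unfold varArg; positivity

lemma pertBound_nonneg (σ l r : ℝ) (u x : E) : 0 ≤ pertBound σ l r u x := by
  have := quadExp_pos (devArg σ l r u x)
  have := varArg_nonneg l r u x
  unfold pertBound; linarith

lemma log_four : Real.log 4 = 2 * Real.log 2 := by
  rw [show (4 : ℝ) = 2 ^ 2 by norm_num, Real.log_pow]; norm_num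

/-- By convexity, exp lies below its chord on [0, 2 log 4], where it goes from 1 to 16; the chord
gives the coefficient 15/log 4 < 11. -/
lemma exp_two_mul_min_le {w : ℝ} (hw : 0 ≤ w) :
    Real.exp (2 * min (Real.log 4) w) ≤ 1 + 11 * w := by
  set M := min (Real.log 4) w with hM
  have hl : 1.386 < Real.log 4 := by
    rw [log_four]; have := Real.log_two_gt_d9; linarith
  have hM0 : 0 ≤ M := le_min (by linarith) hw
  have hMw : M ≤ w := min_le_right _ _
  have hMl : M ≤ Real.log 4 := min_le_left _ _
  have h := convexOn_exp.2 (Set.mem_univ (0 : ℝ)) (Set.mem_univ (2 * Real.log 4))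
    (show 0 ≤ 1 - M / Real.log 4 by rw [sub_nonneg, div_le_one (by linarith)]; exact hMl)
    (show 0 ≤ M / Real.log 4 from div_nonneg hM0 (by linarith)) (by ring)
  have e1 : (1 - M / Real.log 4) • (0 : ℝ) + (M / Real.log 4) • (2 * Real.log 4) = 2 * M := by
    rw [smul_eq_mul, smul_eq_mul]; field_simp; ring
  have e2 : Real.exp (2 * Real.log 4) = 16 := by
    rw [two_mul, Real.exp_add, Real.exp_log (by norm_num)]; norm_num
  rw [e1, e2, Real.exp_zero, smul_eq_mul, smul_eq_mul] at h
  have h2 : M / Real.log 4 ≤ w / 1.386 := div_le_div₀ hw hMw (by norm_num) hl.le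
  have h3 : w / 1.386 * 15 ≤ 11 * w := by
    rw [div_mul_eq_mul_div, div_le_iff₀ (by norm_num)]; nlinarith
  linarith

/-- In the product (1 + 11w) exp(`truncLog`), the first term is bounded by `quadExp` and the second
by 4 · 11w, hence the 44. -/
lemma exp_pertLog_le (σ l r : ℝ) (u x : E) :
    Real.exp (pertLog σ l r u x) ≤ pertBound σ l r u x := by
  have h1 := exp_two_mul_min_le (varArg_nonneg l r u x)
  have h2 := exp_truncLog_le_quadExp (devArg σ l r u x)
  have h3 := exp_truncLog_le_four (devArg σ l r u x)
  have h4 := varArg_nonneg l r u x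
  unfold pertLog pertBound
  rw [Real.exp_add]
  have := Real.exp_pos (truncLog (devArg σ l r u x))
  nlinarith [mul_le_mul_of_nonneg_left h1 this.le, mul_le_mul_of_nonneg_right h3 h4]

lemma abs_pertLog_le (σ l r : ℝ) (u x : E) : |pertLog σ l r u x| ≤ 6 * Real.log 2 := by
  have h1 := neg_log_two_le_truncLog (devArg σ l r u x)
  have h2 : truncLog (devArg σ l r u x) ≤ Real.log 4 := by
    rw [Real.le_log_iff_exp_le (by norm_num)]; exact exp_truncLog_le_four _
  have h3 := min_le_left (Real.log 4) (varArg l r u x)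
  have hl : 0 < Real.log 2 := Real.log_pos (by norm_num)
  have h4 : 0 ≤ min (Real.log 4) (varArg l r u x) :=
    le_min (by rw [log_four]; linarith) (varArg_nonneg l r u x)
  rw [log_four] at h2 h3 h4
  unfold pertLog
  rw [log_four, abs_le]
  constructor <;> linarith

@[fun_prop]
lemma continuous_devArg (σ l r : ℝ) :
    Continuous fun q : E × E => devArg σ l r q.1 q.2 := by
  unfold devArg; fun_prop

@[fun_prop]
lemma continuous_varArg (l r : ℝ) :
    Continuous fun q : E × E => varArg l r q.1 q.2 := by
  unfold varArg; fun_prop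

lemma continuous_pertLog (σ l r : ℝ) :
    Continuous fun q : E × E => pertLog σ l r q.1 q.2 := by
  unfold pertLog; fun_prop

lemma inner_add_smul_left (u g x : E) (r : ℝ) :
    inner ℝ (u + r • g) x = inner ℝ u x + r * inner ℝ g x := by
  rw [inner_add_left, real_inner_smul_left]

variable [FiniteDimensional ℝ E] [MeasurableSpace E] [BorelSpace E]

lemma integrable_quartic_inner_stdGaussian (x : E) (a b c d e : ℝ) :
    Integrable (fun g => a + b * inner ℝ g x + c * inner ℝ g x ^ 2 + d * inner ℝ g x ^ 3
      + e * inner ℝ g x ^ 4) (stdGaussian E) := by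
  have h1 := integrable_inner_pow_stdGaussian x 1
  simp only [pow_one] at h1
  exact ((((integrable_const a).add (h1.const_mul b)).add
    ((integrable_inner_pow_stdGaussian x 2).const_mul c)).add
    ((integrable_inner_pow_stdGaussian x 3).const_mul d)).add
    ((integrable_inner_pow_stdGaussian x 4).const_mul e)

lemma integral_quartic_inner_stdGaussian (x : E) (a b c d e : ℝ) :
    ∫ g, (a + b * inner ℝ g x + c * inner ℝ g x ^ 2 + d * inner ℝ g x ^ 3
      + e * inner ℝ g x ^ 4) ∂stdGaussian E = a + c * ‖x‖ ^ 2 + 3 * e * ‖x‖ ^ 4 := by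
  have h1 := integrable_inner_pow_stdGaussian x 1
  simp only [pow_one] at h1
  have i1 := (integrable_const (μ := stdGaussian E) a).add (h1.const_mul b)
  have i2 := i1.add ((integrable_inner_pow_stdGaussian x 2).const_mul c)
  have i3 := i2.add ((integrable_inner_pow_stdGaussian x 3).const_mul d)
  have i4 := (integrable_inner_pow_stdGaussian x 4).const_mul e
  have e3 := integral_add i3 i4
  have e2 := integral_add i2 ((integrable_inner_pow_stdGaussian x 3).const_mul d)
  have e1 := integral_add i1 ((integrable_inner_pow_stdGaussian x 2).const_mul c)
  have e0 := integral_add (integrable_const (μ := stdGaussian E) a) (h1.const_mul b)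
  simp only [Pi.add_apply, integral_const_mul, integral_inner_stdGaussian_id,
    integral_inner_sq_stdGaussian, integral_inner_pow_three_stdGaussian,
    integral_inner_pow_four_stdGaussian, integral_const, probReal_univ, one_smul] at e0 e1 e2 e3
  rw [e3, e2, e1, e0]
  ring

lemma integrable_pertBound_stdGaussian (σ l r : ℝ) (u x : E) :
    Integrable (fun g => pertBound σ l r (u + r • g) x) (stdGaussian E) := by
  obtain ⟨a, b, c, d, e, h⟩ : ∃ a b c d e : ℝ, ∀ y : ℝ,
      quadExp (σ * l * ((inner ℝ u x + r * y) ^ 2 - r ^ 2 * ‖x‖ ^ 2 - 1))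
        + 44 * (l ^ 2 * ((inner ℝ u x + r * y) ^ 2 * (r ^ 2 * ‖x‖ ^ 2)
          + (r ^ 2 * ‖x‖ ^ 2) ^ 2 / 2)) = a + b * y + c * y ^ 2 + d * y ^ 3 + e * y ^ 4 := by
    set m := inner ℝ u x
    set s := r ^ 2 * ‖x‖ ^ 2
    refine ⟨1 + σ * l * (m ^ 2 - s - 1) + (σ * l) ^ 2 * (m ^ 2 - s - 1) ^ 2 / 2
        + 44 * (l ^ 2 * (m ^ 2 * s + s ^ 2 / 2)),
      2 * σ * l * m * r + (σ * l) ^ 2 * (m ^ 2 - s - 1) * 2 * m * r + 44 * (l ^ 2 * (2 * m * r * s)),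
      σ * l * r ^ 2 + (σ * l) ^ 2 / 2 * (2 * (m ^ 2 - s - 1) * r ^ 2 + 4 * m ^ 2 * r ^ 2)
        + 44 * (l ^ 2 * (r ^ 2 * s)),
      (σ * l) ^ 2 / 2 * (4 * m * r ^ 3), (σ * l) ^ 2 / 2 * r ^ 4, fun y => ?_⟩
    unfold quadExp
    ring
  simp only [pertBound, devArg, varArg, inner_add_smul_left, h]
  exact integrable_quartic_inner_stdGaussian x a b c d e

/-- With m = ⟨u, x⟩ and s = r²‖x‖², the perturbed `devArg` has mean σl(m² − 1) and variance l²(4m²s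
+ 2s²), half of which enters `quadExp`; the mean of the perturbed `varArg` is l²(m²s + 3s²/2). Hence
46 = 2 + 44 and 67 = 1 + 66. -/
lemma integral_pertBound_stdGaussian {σ : ℝ} (hσ : σ ^ 2 = 1) (l r : ℝ) (u x : E) :
    ∫ g, pertBound σ l r (u + r • g) x ∂stdGaussian E
      = 1 + σ * l * (inner ℝ u x ^ 2 - 1) + l ^ 2 / 2 * (inner ℝ u x ^ 2 - 1) ^ 2
        + 46 * l ^ 2 * (inner ℝ u x ^ 2 * (r ^ 2 * ‖x‖ ^ 2))
        + 67 * l ^ 2 * (r ^ 2 * ‖x‖ ^ 2) ^ 2 := by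
  set m := inner ℝ u x
  set s := r ^ 2 * ‖x‖ ^ 2 with hs
  have h : ∀ g : E, pertBound σ l r (u + r • g) x
      = (1 + σ * l * (m ^ 2 - s - 1) + (σ * l) ^ 2 * (m ^ 2 - s - 1) ^ 2 / 2
        + 44 * (l ^ 2 * (m ^ 2 * s + s ^ 2 / 2)))
      + (2 * σ * l * m * r + (σ * l) ^ 2 * (m ^ 2 - s - 1) * 2 * m * r
        + 44 * (l ^ 2 * (2 * m * r * s))) * inner ℝ g x
      + (σ * l * r ^ 2 + (σ * l) ^ 2 / 2 * (2 * (m ^ 2 - s - 1) * r ^ 2 + 4 * m ^ 2 * r ^ 2)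
        + 44 * (l ^ 2 * (r ^ 2 * s))) * inner ℝ g x ^ 2
      + ((σ * l) ^ 2 / 2 * (4 * m * r ^ 3)) * inner ℝ g x ^ 3
      + ((σ * l) ^ 2 / 2 * r ^ 4) * inner ℝ g x ^ 4 := fun g => by
    simp only [pertBound, devArg, varArg, inner_add_smul_left, quadExp]
    ring
  simp only [h]
  rw [integral_quartic_inner_stdGaussian, mul_pow, hσ, hs]
  ring

lemma integrable_pertLog_stdGaussian (σ l r : ℝ) (u x : E) :
    Integrable (fun g => pertLog σ l r (u + r • g) x) (stdGaussian E) :=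
  Integrable.of_bound ((continuous_pertLog σ l r).comp
    (by fun_prop : Continuous fun g : E => (u + r • g, x))).aestronglyMeasurable
    (6 * Real.log 2) (Filter.Eventually.of_forall fun g => abs_pertLog_le σ l r _ x)

/-- `varArg` increases with ⟨u, x⟩², and one of the perturbations by g and −g does not decrease this
square. The symmetry of the Gaussian law yields the factor 2, which is the one in `pertLog`. -/
lemma min_varArg_le_two_mul_integral (l r : ℝ) (u x : E) :
    min (Real.log 4) (varArg l r u x)
      ≤ ∫ g, 2 * min (Real.log 4) (varArg l r (u + r • g) x) ∂stdGaussian E := by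
  have hl : 0 < Real.log 4 := Real.log_pos (by norm_num)
  have hnn : ∀ v : E, 0 ≤ min (Real.log 4) (varArg l r v x) := fun v =>
    le_min hl.le (varArg_nonneg l r v x)
  have hint : ∀ ρ : ℝ, Integrable (fun g => min (Real.log 4) (varArg l r (u + ρ • g) x))
      (stdGaussian E) := fun ρ => by
    refine Integrable.of_bound (C := Real.log 4) (Continuous.aestronglyMeasurable ?_)
      (Filter.Eventually.of_forall fun g => ?_)
    · exact continuous_const.min ((continuous_varArg l r).comp
        (by fun_prop : Continuous fun g : E => (u + ρ • g, x)))
    · rw [Real.norm_of_nonneg (hnn _)]; exact min_le_left _ _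
  have hsymm : ∫ g, min (Real.log 4) (varArg l r (u + (-r) • g) x) ∂stdGaussian E
      = ∫ g, min (Real.log 4) (varArg l r (u + r • g) x) ∂stdGaussian E := by
    rw [← integral_neg_stdGaussian]
    simp
  have hpt : ∀ g : E, min (Real.log 4) (varArg l r u x)
      ≤ min (Real.log 4) (varArg l r (u + r • g) x)
        + min (Real.log 4) (varArg l r (u + (-r) • g) x) := fun g => by
    have h1 := hnn (u + r • g)
    have h2 := hnn (u + (-r) • g)
    have mono : ∀ v : E, inner ℝ u x ^ 2 ≤ inner ℝ v x ^ 2 →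
        min (Real.log 4) (varArg l r u x) ≤ min (Real.log 4) (varArg l r v x) := fun v hv => by
      refine min_le_min le_rfl ?_
      unfold varArg
      gcongr
    rcases le_total 0 (inner ℝ u x * (r * inner ℝ g x)) with h | h
    · have := mono (u + r • g) (by rw [inner_add_smul_left]; nlinarith [sq_nonneg (r * inner ℝ g x)])
      linarith
    · have := mono (u + (-r) • g)
        (by rw [inner_add_smul_left]; nlinarith [sq_nonneg (r * inner ℝ g x)])
      linarith
  calc min (Real.log 4) (varArg l r u x)
      = ∫ _, min (Real.log 4) (varArg l r u x) ∂stdGaussian E := by simp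
    _ ≤ ∫ g, (min (Real.log 4) (varArg l r (u + r • g) x)
        + min (Real.log 4) (varArg l r (u + (-r) • g) x)) ∂stdGaussian E :=
      integral_mono (integrable_const _) ((hint r).add (hint (-r))) hpt
    _ = _ := by
      rw [integral_add (hint r) (hint (-r)), hsymm, integral_const_mul]; ring

/-- The Gaussian mean of `truncLog` falls short of the influence function by at most log 4, from the
bounds ±log 2, and by at most `varArg`, from the curvature. The smaller of these two losses is what
the second term of `pertLog` compensates. -/
lemma influence_le_integral_pertLog {σ : ℝ} (hσ : σ ^ 2 = 1) (l r : ℝ) (u x : E) :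
    influence (σ * l * (inner ℝ u x ^ 2 - 1))
      ≤ ∫ g, pertLog σ l r (u + r • g) x ∂stdGaussian E := by
  set m := inner ℝ u x with hm
  set s := r ^ 2 * ‖x‖ ^ 2 with hs
  have hl4 := log_four
  have htrunc : Integrable (fun g => truncLog (devArg σ l r (u + r • g) x)) (stdGaussian E) := by
    refine Integrable.of_bound (C := Real.log 4) (Continuous.aestronglyMeasurable ?_)
      (Filter.Eventually.of_forall fun g => ?_)
    · exact continuous_truncLog.comp ((continuous_devArg σ l r).comp
        (by fun_prop : Continuous fun g : E => (u + r • g, x)))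
    · have h1 := neg_log_two_le_truncLog (devArg σ l r (u + r • g) x)
      have h2 : truncLog (devArg σ l r (u + r • g) x) ≤ Real.log 4 := by
        rw [Real.le_log_iff_exp_le (by norm_num)]; exact exp_truncLog_le_four _
      have : 0 < Real.log 2 := Real.log_pos (by norm_num)
      rw [Real.norm_eq_abs, abs_le]
      constructor <;> linarith
  have hmin : Integrable (fun g => 2 * min (Real.log 4) (varArg l r (u + r • g) x))
      (stdGaussian E) := by
    have := (integrable_pertLog_stdGaussian σ l r u x).sub htrunc
    refine this.congr (Filter.Eventually.of_forall fun g => ?_)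
    simp [pertLog]
  have hsplit : ∫ g, pertLog σ l r (u + r • g) x ∂stdGaussian E
      = ∫ g, truncLog (devArg σ l r (u + r • g) x) ∂stdGaussian E
        + ∫ g, 2 * min (Real.log 4) (varArg l r (u + r • g) x) ∂stdGaussian E :=
    integral_add htrunc hmin
  have hmv := min_varArg_le_two_mul_integral l r u x
  have h1 : influence (σ * l * (m ^ 2 - 1)) - Real.log 4
      ≤ ∫ g, truncLog (devArg σ l r (u + r • g) x) ∂stdGaussian E := by
    calc influence (σ * l * (m ^ 2 - 1)) - Real.log 4 ≤ -Real.log 2 := by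
          have := influence_le_log_two (σ * l * (m ^ 2 - 1)); linarith
      _ = ∫ _, -Real.log 2 ∂stdGaussian E := by simp
      _ ≤ _ := integral_mono (integrable_const _) htrunc fun g => neg_log_two_le_truncLog _
  have h2 : influence (σ * l * (m ^ 2 - 1)) - varArg l r u x
      ≤ ∫ g, truncLog (devArg σ l r (u + r • g) x) ∂stdGaussian E := by
    obtain ⟨c, hc⟩ := truncLog_tangent (σ * l * (m ^ 2 - 1))
    set T := truncLog (σ * l * (m ^ 2 - 1)) with hT
    have hpoly : ∀ g : E, T + c * (devArg σ l r (u + r • g) x - σ * l * (m ^ 2 - 1))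
          - (devArg σ l r (u + r • g) x - σ * l * (m ^ 2 - 1)) ^ 2 / 4
        = (T - c * σ * l * s - (σ * l) ^ 2 * s ^ 2 / 4)
          + (c * σ * l * 2 * m * r + (σ * l) ^ 2 * s * m * r) * inner ℝ g x
          + (c * σ * l * r ^ 2 - (σ * l) ^ 2 * (4 * m ^ 2 * r ^ 2 - 2 * s * r ^ 2) / 4)
            * inner ℝ g x ^ 2
          + (-(σ * l) ^ 2 * m * r ^ 3) * inner ℝ g x ^ 3
          + (-(σ * l) ^ 2 * r ^ 4 / 4) * inner ℝ g x ^ 4 := fun g => by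
      simp only [devArg, inner_add_smul_left]
      ring
    have hmono := integral_mono (integrable_quartic_inner_stdGaussian x _ _ _ _ _) htrunc
      fun g => (hpoly g).ge.trans (hc _)
    rw [integral_quartic_inner_stdGaussian, mul_pow, hσ] at hmono
    have hi := influence_le_truncLog (σ * l * (m ^ 2 - 1))
    have hv : varArg l r u x = l ^ 2 * (m ^ 2 * s + s ^ 2 / 2) := rfl
    have hx : ‖x‖ ^ 4 * r ^ 4 = s ^ 2 := by rw [hs]; ring
    have hx2 : ‖x‖ ^ 2 * r ^ 2 = s := by rw [hs]; ring
    rw [hv]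
    refine le_trans ?_ hmono
    have : T - c * σ * l * s - 1 * l ^ 2 * s ^ 2 / 4
          + (c * σ * l * r ^ 2 - 1 * l ^ 2 * (4 * m ^ 2 * r ^ 2 - 2 * s * r ^ 2) / 4) * ‖x‖ ^ 2
          + 3 * (-(1 * l ^ 2) * r ^ 4 / 4) * ‖x‖ ^ 4
        = T - l ^ 2 * (m ^ 2 * s + s ^ 2 / 2) := by
      rw [hs]; ring
    linarith
  rcases min_choice (Real.log 4) (varArg l r u x) with h | h <;> rw [h] at hmv <;> linarith

end

end RobustLS

/-! ### PAC-Bayesian deviation bounds under fourth moments -/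

namespace RobustLS

noncomputable section

open ProbabilityTheory

lemma ofReal_exp_integral_le {α : Type*} [MeasurableSpace α] {μ : Measure α}
    [IsProbabilityMeasure μ] {f : α → ℝ} (hf : Integrable f μ) :
    ENNReal.ofReal (Real.exp (∫ x, f x ∂μ)) ≤ ∫⁻ x, ENNReal.ofReal (Real.exp (f x)) ∂μ := by
  by_cases h : ∫⁻ x, ENNReal.ofReal (Real.exp (f x)) ∂μ = ∞
  · rw [h]; exact le_top
  have hint : Integrable (fun x => Real.exp (f x)) μ := by
    refine ⟨Real.continuous_exp.comp_aestronglyMeasurable hf.1, ?_⟩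
    rw [hasFiniteIntegral_iff_ofReal (Filter.Eventually.of_forall fun x => (Real.exp_pos _).le)]
    exact lt_top_iff_ne_top.2 h
  rw [← ofReal_integral_eq_lintegral_ofReal hint
    (Filter.Eventually.of_forall fun x => (Real.exp_pos _).le)]
  refine ENNReal.ofReal_le_ofReal ?_
  exact convexOn_exp.map_integral_le Real.continuous_exp.continuousOn isClosed_univ
    (Filter.Eventually.of_forall fun _ => Set.mem_univ _) hf hint

variable {E : Type*} [NormedAddCommGroup E] [InnerProductSpace ℝ E]

lemma inner_sq_mul_norm_sq_le (u x : E) : inner ℝ u x ^ 2 * ‖x‖ ^ 2 ≤ ‖u‖ ^ 2 * ‖x‖ ^ 4 := by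
  have := sq_le_sq.2 (abs_real_inner_le_norm u x |>.trans (le_abs_self _))
  nlinarith [mul_le_mul_of_nonneg_right this (sq_nonneg ‖x‖)]

variable [FiniteDimensional ℝ E]

lemma norm_pow_four_le (x : E) : ‖x‖ ^ 4
    ≤ Module.finrank ℝ E * ∑ i, inner ℝ (stdOrthonormalBasis ℝ E i) x ^ 4 := by
  have h := (stdOrthonormalBasis ℝ E).sum_sq_inner_right x
  have h2 := sq_sum_le_card_mul_sum_sq (s := Finset.univ)
    (f := fun i => inner ℝ (stdOrthonormalBasis ℝ E i) x ^ 2)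
  rw [h, Finset.card_univ, Fintype.card_fin] at h2
  calc ‖x‖ ^ 4 = (‖x‖ ^ 2) ^ 2 := by ring
    _ ≤ _ := h2
    _ = _ := by simp only [← pow_mul]

variable [MeasurableSpace E] [BorelSpace E]

/-- The variational inequality for a translate of the standard Gaussian measure, whose relative
entropy is `‖w‖² / 2`. -/
lemma ofReal_exp_integral_add_le_lintegral (w : E) {f : E → ℝ} (hf : Measurable f)
    (hint : Integrable (fun g => f (g + w)) (stdGaussian E)) :
    ENNReal.ofReal (Real.exp (∫ g, f (g + w) ∂stdGaussian E - ‖w‖ ^ 2 / 2))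
      ≤ ∫⁻ g, ENNReal.ofReal (Real.exp (f g)) ∂stdGaussian E := by
  have hw : Integrable (fun g => inner ℝ g w) (stdGaussian E) := by
    simpa using integrable_inner_pow_stdGaussian w 1
  -- The change of measure is applied to f minus the logarithm of the density of the translated
  -- Gaussian, and Jensen's inequality then makes the mean of this logarithm, the relative entropy,
  -- appear.
  have h1 := lintegral_stdGaussian_add w
    (f := fun g => ENNReal.ofReal (Real.exp (f g - (inner ℝ g w - ‖w‖ ^ 2 / 2))))
    (by fun_prop)
  have h2 : ∀ g : E, ENNReal.ofReal (Real.exp (inner ℝ g w - ‖w‖ ^ 2 / 2))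
      * ENNReal.ofReal (Real.exp (f g - (inner ℝ g w - ‖w‖ ^ 2 / 2)))
      = ENNReal.ofReal (Real.exp (f g)) := fun g => by
    rw [← ENNReal.ofReal_mul (Real.exp_pos _).le, ← Real.exp_add]
    congr 2; ring
  simp only [h2] at h1
  rw [← h1]
  have h3 : ∫ g, (f (g + w) - (inner ℝ (g + w) w - ‖w‖ ^ 2 / 2)) ∂stdGaussian E
      = ∫ g, f (g + w) ∂stdGaussian E - ‖w‖ ^ 2 / 2 := by
    have : ∀ g : E, f (g + w) - (inner ℝ (g + w) w - ‖w‖ ^ 2 / 2)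
        = f (g + w) - (inner ℝ g w + ‖w‖ ^ 2 / 2) := fun g => by
      rw [inner_add_left, real_inner_self_eq_norm_sq]; ring
    have hs : Integrable (fun g => inner ℝ g w + ‖w‖ ^ 2 / 2) (stdGaussian E) :=
      hw.add (integrable_const _)
    simp only [this]
    rw [integral_sub hint hs, integral_add hw (integrable_const _),
      integral_inner_stdGaussian_id]
    simp
  rw [← h3]
  refine ofReal_exp_integral_le (hint.sub ?_)
  refine Integrable.sub ?_ (integrable_const _)
  simp only [inner_add_left]
  exact hw.add (integrable_const _)

variable {Ω : Type*} [MeasurableSpace Ω]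

lemma measurable_pertLog (σ l r : ℝ) {α : Type*} [MeasurableSpace α] {f g : α → E}
    (hf : Measurable f) (hg : Measurable g) : Measurable fun a => pertLog σ l r (f a) (g a) := by
  have := hf.inner hg (𝕜 := ℝ)
  have := continuous_truncLog.measurable
  unfold pertLog devArg varArg
  fun_prop

lemma measurable_pertBound (σ l r : ℝ) {α : Type*} [MeasurableSpace α] {f g : α → E}
    (hf : Measurable f) (hg : Measurable g) : Measurable fun a => pertBound σ l r (f a) (g a) := by
  have := hf.inner hg (𝕜 := ℝ)
  unfold pertBound quadExp devArg varArg
  fun_prop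

/-- A PAC-Bayesian inequality for Gaussian posteriors: the bound holds for all translations of the
prior on the same event. -/
theorem exists_measurableSet_forall_sum_integral_le (P : Measure Ω) [IsProbabilityMeasure P]
    (n : ℕ) {F : E → Ω → ℝ} (hF : Measurable fun q : E × Ω => F q.1 q.2) {Θ : E → ℝ}
    (hΘ : Measurable Θ)
    (hFΘ : ∀ g, ∫⁻ ω, ENNReal.ofReal (Real.exp (F g ω)) ∂P ≤ ENNReal.ofReal (Real.exp (Θ g)))
    {ε : ℝ} (hε : 0 < ε) :
    ∃ B : Set (Fin n → Ω), MeasurableSet B ∧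
      Measure.pi (fun _ : Fin n => P) Bᶜ ≤ ENNReal.ofReal ε ∧
      ∀ z ∈ B, ∀ w : E, (∀ i, Integrable (fun g => F (g + w) (z i)) (stdGaussian E)) →
        Integrable (fun g => Θ (g + w)) (stdGaussian E) →
        ∑ i, ∫ g, F (g + w) (z i) ∂stdGaussian E
          ≤ n * ∫ g, Θ (g + w) ∂stdGaussian E + ‖w‖ ^ 2 / 2 + Real.log ε⁻¹ := by
  -- W integrates over the prior only, so the event W < 1/ε does not depend on w. By independence
  -- its expectation is at most 1, and Markov's inequality bounds the complement by ε.
  set W : (Fin n → Ω) → ℝ≥0∞ := fun z =>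
    ∫⁻ g, ENNReal.ofReal (Real.exp (∑ i, F g (z i) - n * Θ g)) ∂stdGaussian E with hW
  have hmeas : Measurable fun q : (Fin n → Ω) × E =>
      ENNReal.ofReal (Real.exp (∑ i, F q.2 (q.1 i) - n * Θ q.2)) := by
    have : ∀ i : Fin n, Measurable fun q : (Fin n → Ω) × E => F q.2 (q.1 i) := fun i =>
      hF.comp (by fun_prop : Measurable fun q : (Fin n → Ω) × E => (q.2, q.1 i))
    fun_prop
  have hWm : Measurable W := hmeas.lintegral_prod_right'
  have hWle : ∫⁻ z, W z ∂Measure.pi (fun _ : Fin n => P) ≤ 1 := by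
    rw [hW, lintegral_lintegral_swap hmeas.aemeasurable]
    have hin : ∀ g : E, ∫⁻ z, ENNReal.ofReal (Real.exp (∑ i, F g (z i) - n * Θ g))
        ∂Measure.pi (fun _ : Fin n => P) ≤ 1 := fun g => by
      have hFg : Measurable (F g) := hF.comp measurable_prodMk_left
      have e : ∀ z : Fin n → Ω, ENNReal.ofReal (Real.exp (∑ i, F g (z i) - n * Θ g))
          = ∏ i, ENNReal.ofReal (Real.exp (F g (z i) - Θ g)) := fun z => by
        rw [← ENNReal.ofReal_prod_of_nonneg fun i _ => (Real.exp_pos _).le, ← Real.exp_sum,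
          Finset.sum_sub_distrib]
        simp
      simp only [e]
      rw [lintegral_pi_prod (fun _ : Fin n => P)
        (f := fun _ ω => ENNReal.ofReal (Real.exp (F g ω - Θ g))) fun _ => by fun_prop]
      refine Finset.prod_le_one' fun i _ => ?_
      have e2 : ∀ ω, ENNReal.ofReal (Real.exp (F g ω - Θ g))
          = ENNReal.ofReal (Real.exp (F g ω)) * ENNReal.ofReal (Real.exp (-Θ g)) := fun ω => by
        rw [← ENNReal.ofReal_mul (Real.exp_pos _).le, ← Real.exp_add, sub_eq_add_neg]
      simp only [e2]
      rw [lintegral_mul_const _ (by fun_prop)]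
      calc _ ≤ ENNReal.ofReal (Real.exp (Θ g)) * ENNReal.ofReal (Real.exp (-Θ g)) := by
            gcongr; exact hFΘ g
        _ = 1 := by
            rw [← ENNReal.ofReal_mul (Real.exp_pos _).le, ← Real.exp_add]; simp
    calc _ ≤ ∫⁻ _ : E, 1 ∂stdGaussian E := lintegral_mono hin
      _ = 1 := by simp
  refine ⟨{z | W z < ENNReal.ofReal ε⁻¹}, measurableSet_lt hWm measurable_const, ?_, ?_⟩
  · have hc : {z | W z < ENNReal.ofReal ε⁻¹}ᶜ = {z | ENNReal.ofReal ε⁻¹ ≤ W z} := by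
      ext z; simp
    rw [hc]
    have h1 := (mul_meas_ge_le_lintegral (μ := Measure.pi (fun _ : Fin n => P)) hWm
      (ENNReal.ofReal ε⁻¹)).trans hWle
    have h2 : ENNReal.ofReal ε * ENNReal.ofReal ε⁻¹ = 1 := by
      rw [← ENNReal.ofReal_mul hε.le, mul_inv_cancel₀ hε.ne', ENNReal.ofReal_one]
    calc _ = ENNReal.ofReal ε * (ENNReal.ofReal ε⁻¹
          * Measure.pi (fun _ : Fin n => P) {z | ENNReal.ofReal ε⁻¹ ≤ W z}) := by
          rw [← mul_assoc, h2, one_mul]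
      _ ≤ ENNReal.ofReal ε * 1 := by gcongr
      _ = _ := mul_one _
  · intro z hz w hFi hΘi
    have hsum : Integrable (fun g => ∑ i, F (g + w) (z i)) (stdGaussian E) :=
      integrable_finsetSum _ fun i _ => hFi i
    have hm : Measurable fun g => ∑ i, F g (z i) - n * Θ g := by
      have : ∀ i : Fin n, Measurable fun g => F g (z i) := fun i =>
        hF.comp measurable_prodMk_right
      fun_prop
    have h1 := ofReal_exp_integral_add_le_lintegral w hm (hsum.sub (hΘi.const_mul _))
    have h2 := h1.trans_lt hz
    rw [ENNReal.ofReal_lt_ofReal_iff (by positivity)] at h2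
    have h3 := Real.log_lt_log (Real.exp_pos _) h2
    rw [Real.log_exp, integral_sub hsum (hΘi.const_mul _), integral_const_mul,
      integral_finsetSum _ fun i _ => hFi i] at h3
    linarith

/-- A random vector whose linear functionals have a kurtosis bounded by `κ` relatively to the
ambient norm. -/
structure FourthMomentBound (P : Measure Ω) (X : Ω → E) (κ : ℝ) : Prop where
  measurable : Measurable X
  integrable : ∀ u : E, Integrable (fun ω => inner ℝ u (X ω) ^ 4) P
  bound : ∀ u : E, ∫ ω, inner ℝ u (X ω) ^ 4 ∂P ≤ κ * ‖u‖ ^ 4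

namespace FourthMomentBound

variable {P : Measure Ω} {X : Ω → E} {κ : ℝ}

lemma integrable_norm_pow_four (h : FourthMomentBound P X κ) :
    Integrable (fun ω => ‖X ω‖ ^ 4) P := by
  have hm := h.measurable
  refine Integrable.mono' ((integrable_finsetSum Finset.univ fun i _ =>
    h.integrable (stdOrthonormalBasis ℝ E i)).const_mul (Module.finrank ℝ E : ℝ))
    (by fun_prop) (Filter.Eventually.of_forall fun ω => ?_)
  rw [Real.norm_of_nonneg (by positivity)]
  exact norm_pow_four_le _

lemma integral_norm_pow_four_le (h : FourthMomentBound P X κ) :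
    ∫ ω, ‖X ω‖ ^ 4 ∂P ≤ κ * (Module.finrank ℝ E : ℝ) ^ 2 := by
  have hi := integrable_finsetSum Finset.univ fun i (_ : i ∈ Finset.univ) =>
    h.integrable (stdOrthonormalBasis ℝ E i)
  calc ∫ ω, ‖X ω‖ ^ 4 ∂P
      ≤ ∫ ω, Module.finrank ℝ E * ∑ i, inner ℝ (stdOrthonormalBasis ℝ E i) (X ω) ^ 4 ∂P :=
        integral_mono h.integrable_norm_pow_four (hi.const_mul _) fun ω => norm_pow_four_le _
    _ = Module.finrank ℝ E * ∑ i, ∫ ω, inner ℝ (stdOrthonormalBasis ℝ E i) (X ω) ^ 4 ∂P := by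
        rw [integral_const_mul, integral_finsetSum _ fun i _ => h.integrable _]
    _ ≤ Module.finrank ℝ E * ∑ i : Fin (Module.finrank ℝ E), κ := by
        gcongr with i _
        have := h.bound (stdOrthonormalBasis ℝ E i)
        simpa using this
    _ = _ := by simp; ring

lemma integrable_inner_sq_mul_norm_sq (h : FourthMomentBound P X κ) (u : E) :
    Integrable (fun ω => inner ℝ u (X ω) ^ 2 * ‖X ω‖ ^ 2) P := by
  have hm := h.measurable
  refine Integrable.mono' (h.integrable_norm_pow_four.const_mul (‖u‖ ^ 2)) (by fun_prop)
    (Filter.Eventually.of_forall fun ω => ?_)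
  rw [Real.norm_of_nonneg (by positivity)]
  exact inner_sq_mul_norm_sq_le _ _

lemma integral_inner_sq_mul_norm_sq_le (h : FourthMomentBound P X κ) (u : E) :
    ∫ ω, inner ℝ u (X ω) ^ 2 * ‖X ω‖ ^ 2 ∂P ≤ κ * Module.finrank ℝ E * ‖u‖ ^ 2 := by
  rcases eq_or_ne u 0 with rfl | hu
  · simp
  have hc : 0 < ‖u‖ ^ 2 := by positivity
  set b := stdOrthonormalBasis ℝ E
  -- Expand ‖x‖² over an orthonormal basis and bound each product of squares by an AM–GM inequality
  -- with weight ‖u‖², which makes the two fourth moments contribute equally.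
  have hpt : ∀ x : E, inner ℝ u x ^ 2 * ‖x‖ ^ 2
      ≤ ∑ i, (1 / (2 * ‖u‖ ^ 2) * inner ℝ u x ^ 4 + ‖u‖ ^ 2 / 2 * inner ℝ (b i) x ^ 4) := fun x => by
    rw [← b.sum_sq_inner_right x, Finset.mul_sum]
    refine Finset.sum_le_sum fun i _ => ?_
    set p := inner ℝ u x ^ 2 with hp
    set q := inner ℝ (b i) x ^ 2 with hq
    have e1 : inner ℝ u x ^ 4 = p ^ 2 := by rw [hp]; ring
    have e2 : inner ℝ (b i) x ^ 4 = q ^ 2 := by rw [hq]; ring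
    have key : 1 / (2 * ‖u‖ ^ 2) * p ^ 2 + ‖u‖ ^ 2 / 2 * q ^ 2 - p * q
        = (p - ‖u‖ ^ 2 * q) ^ 2 / (2 * ‖u‖ ^ 2) := by
      field_simp; ring
    have : 0 ≤ (p - ‖u‖ ^ 2 * q) ^ 2 / (2 * ‖u‖ ^ 2) := by positivity
    rw [e1, e2]
    linarith
  have hi : ∀ i, Integrable (fun ω => 1 / (2 * ‖u‖ ^ 2) * inner ℝ u (X ω) ^ 4
      + ‖u‖ ^ 2 / 2 * inner ℝ (b i) (X ω) ^ 4) P := fun i =>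
    ((h.integrable u).const_mul _).add ((h.integrable (b i)).const_mul _)
  calc ∫ ω, inner ℝ u (X ω) ^ 2 * ‖X ω‖ ^ 2 ∂P
      ≤ ∫ ω, ∑ i, (1 / (2 * ‖u‖ ^ 2) * inner ℝ u (X ω) ^ 4
          + ‖u‖ ^ 2 / 2 * inner ℝ (b i) (X ω) ^ 4) ∂P :=
        integral_mono (h.integrable_inner_sq_mul_norm_sq u)
          (integrable_finsetSum _ fun i _ => hi i) fun ω => hpt _
    _ = ∑ i, (1 / (2 * ‖u‖ ^ 2) * ∫ ω, inner ℝ u (X ω) ^ 4 ∂P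
          + ‖u‖ ^ 2 / 2 * ∫ ω, inner ℝ (b i) (X ω) ^ 4 ∂P) := by
        rw [integral_finsetSum _ fun i _ => hi i]
        refine Finset.sum_congr rfl fun i _ => ?_
        rw [integral_add ((h.integrable u).const_mul _) ((h.integrable (b i)).const_mul _),
          integral_const_mul, integral_const_mul]
    _ ≤ ∑ i : Fin (Module.finrank ℝ E), κ * ‖u‖ ^ 2 := by
        refine Finset.sum_le_sum fun i _ => ?_
        have h1 := h.bound u
        have h2 := h.bound (b i)
        rw [b.norm_eq_one, one_pow, mul_one] at h2
        calc _ ≤ 1 / (2 * ‖u‖ ^ 2) * (κ * ‖u‖ ^ 4) + ‖u‖ ^ 2 / 2 * κ := by gcongr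
          _ = _ := by field_simp; ring
    _ = _ := by simp; ring

variable [IsProbabilityMeasure P]

lemma integrable_norm_sq (h : FourthMomentBound P X κ) : Integrable (fun ω => ‖X ω‖ ^ 2) P := by
  have hm := h.measurable
  refine Integrable.mono' (h.integrable_norm_pow_four.add (integrable_const 1)) (by fun_prop)
    (Filter.Eventually.of_forall fun ω => ?_)
  rw [Real.norm_of_nonneg (by positivity)]
  change _ ≤ ‖X ω‖ ^ 4 + 1
  nlinarith [sq_nonneg (‖X ω‖ ^ 2 - 1)]

lemma integrable_inner_sq (h : FourthMomentBound P X κ) (u : E) :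
    Integrable (fun ω => inner ℝ u (X ω) ^ 2) P := by
  have hm := h.measurable
  refine Integrable.mono' ((h.integrable u).add (integrable_const 1)) (by fun_prop)
    (Filter.Eventually.of_forall fun ω => ?_)
  rw [Real.norm_of_nonneg (by positivity)]
  change _ ≤ inner ℝ u (X ω) ^ 4 + 1
  nlinarith [sq_nonneg (inner ℝ u (X ω) ^ 2 - 1)]

lemma integrable_quadratic (h : FourthMomentBound P X κ) (u : E) (a b c d e f : ℝ) :
    Integrable (fun ω => a + b * inner ℝ u (X ω) ^ 2 + c * ‖X ω‖ ^ 2 + d * inner ℝ u (X ω) ^ 4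
      + e * (inner ℝ u (X ω) ^ 2 * ‖X ω‖ ^ 2) + f * ‖X ω‖ ^ 4) P :=
  (((((integrable_const a).add ((h.integrable_inner_sq u).const_mul b)).add
    (h.integrable_norm_sq.const_mul c)).add ((h.integrable u).const_mul d)).add
    ((h.integrable_inner_sq_mul_norm_sq u).const_mul e)).add
    (h.integrable_norm_pow_four.const_mul f)

lemma integrable_pertBound (h : FourthMomentBound P X κ) (σ l r : ℝ) (u : E) :
    Integrable (fun ω => pertBound σ l r u (X ω)) P := by
  have e : ∀ x : E, pertBound σ l r u x
      = (1 - σ * l + (σ * l) ^ 2 / 2) + (σ * l - (σ * l) ^ 2) * inner ℝ u x ^ 2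
        + (-(σ * l * r ^ 2) + (σ * l) ^ 2 * r ^ 2) * ‖x‖ ^ 2
        + ((σ * l) ^ 2 / 2) * inner ℝ u x ^ 4
        + (-((σ * l) ^ 2 * r ^ 2) + 44 * l ^ 2 * r ^ 2) * (inner ℝ u x ^ 2 * ‖x‖ ^ 2)
        + ((σ * l) ^ 2 * r ^ 4 / 2 + 22 * l ^ 2 * r ^ 4) * ‖x‖ ^ 4 := fun x => by
    unfold pertBound quadExp devArg varArg
    ring
  simp only [e]
  exact h.integrable_quadratic u _ _ _ _ _ _

/-- The coefficient σl − l² of the second moment of ⟨u, X⟩ has no fixed sign, so this moment must be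
known exactly; this is the role of `hu`. -/
lemma integral_smoothed_le (h : FourthMomentBound P X κ) (σ l r : ℝ) {u : E}
    (hu : ∫ ω, inner ℝ u (X ω) ^ 2 ∂P = ‖u‖ ^ 2) :
    Integrable (fun ω => 1 + σ * l * (inner ℝ u (X ω) ^ 2 - 1)
        + l ^ 2 / 2 * (inner ℝ u (X ω) ^ 2 - 1) ^ 2
        + 46 * l ^ 2 * (inner ℝ u (X ω) ^ 2 * (r ^ 2 * ‖X ω‖ ^ 2))
        + 67 * l ^ 2 * (r ^ 2 * ‖X ω‖ ^ 2) ^ 2) P ∧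
    ∫ ω, (1 + σ * l * (inner ℝ u (X ω) ^ 2 - 1)
        + l ^ 2 / 2 * (inner ℝ u (X ω) ^ 2 - 1) ^ 2
        + 46 * l ^ 2 * (inner ℝ u (X ω) ^ 2 * (r ^ 2 * ‖X ω‖ ^ 2))
        + 67 * l ^ 2 * (r ^ 2 * ‖X ω‖ ^ 2) ^ 2) ∂P
      ≤ 1 + (σ * l * (‖u‖ ^ 2 - 1) + l ^ 2 / 2 * (κ * ‖u‖ ^ 4 - 2 * ‖u‖ ^ 2 + 1)
        + 46 * l ^ 2 * r ^ 2 * (κ * Module.finrank ℝ E * ‖u‖ ^ 2)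
        + 67 * l ^ 2 * r ^ 4 * (κ * (Module.finrank ℝ E : ℝ) ^ 2)) := by
  have e : ∀ x : E, 1 + σ * l * (inner ℝ u x ^ 2 - 1)
        + l ^ 2 / 2 * (inner ℝ u x ^ 2 - 1) ^ 2
        + 46 * l ^ 2 * (inner ℝ u x ^ 2 * (r ^ 2 * ‖x‖ ^ 2))
        + 67 * l ^ 2 * (r ^ 2 * ‖x‖ ^ 2) ^ 2
      = (1 - σ * l + l ^ 2 / 2) + (σ * l - l ^ 2) * inner ℝ u x ^ 2
        + 0 * ‖x‖ ^ 2 + (l ^ 2 / 2) * inner ℝ u x ^ 4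
        + (46 * l ^ 2 * r ^ 2) * (inner ℝ u x ^ 2 * ‖x‖ ^ 2)
        + (67 * l ^ 2 * r ^ 4) * ‖x‖ ^ 4 := fun x => by ring
  simp only [e]
  refine ⟨h.integrable_quadratic u _ _ _ _ _ _, ?_⟩
  have i1 := (integrable_const (μ := P) (1 - σ * l + l ^ 2 / 2)).add
    ((h.integrable_inner_sq u).const_mul (σ * l - l ^ 2))
  have i2 := i1.add (h.integrable_norm_sq.const_mul 0)
  have i3 := i2.add ((h.integrable u).const_mul (l ^ 2 / 2))
  have i4 := i3.add ((h.integrable_inner_sq_mul_norm_sq u).const_mul (46 * l ^ 2 * r ^ 2))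
  have e4 := integral_add i4 (h.integrable_norm_pow_four.const_mul (67 * l ^ 2 * r ^ 4))
  have e3 := integral_add i3 ((h.integrable_inner_sq_mul_norm_sq u).const_mul (46 * l ^ 2 * r ^ 2))
  have e2 := integral_add i2 ((h.integrable u).const_mul (l ^ 2 / 2))
  have e1 := integral_add i1 (h.integrable_norm_sq.const_mul 0)
  have e0 := integral_add (integrable_const (μ := P) (1 - σ * l + l ^ 2 / 2))
    ((h.integrable_inner_sq u).const_mul (σ * l - l ^ 2))
  simp only [Pi.add_apply, integral_const_mul, integral_const, probReal_univ, one_smul]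
    at e0 e1 e2 e3 e4
  rw [e4, e3, e2, e1, e0, hu]
  have b1 := mul_le_mul_of_nonneg_left (h.bound u) (by positivity : 0 ≤ l ^ 2 / 2)
  have b2 := mul_le_mul_of_nonneg_left (h.integral_inner_sq_mul_norm_sq_le u)
    (by positivity : 0 ≤ 46 * l ^ 2 * r ^ 2)
  have b3 := mul_le_mul_of_nonneg_left h.integral_norm_pow_four_le
    (by positivity : 0 ≤ 67 * l ^ 2 * r ^ 4)
  nlinarith

/-- The inequality x ≤ exp(x − 1) leaves an exponent that is linear in `pertBound`, so that it can
be averaged over the Gaussian posterior by Fubini's theorem. -/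
lemma lintegral_exp_pertLog_le (h : FourthMomentBound P X κ) (σ l r : ℝ) (u : E) :
    ∫⁻ ω, ENNReal.ofReal (Real.exp (pertLog σ l r u (X ω))) ∂P
      ≤ ENNReal.ofReal (Real.exp (∫ ω, pertBound σ l r u (X ω) ∂P - 1)) := by
  calc ∫⁻ ω, ENNReal.ofReal (Real.exp (pertLog σ l r u (X ω))) ∂P
      ≤ ∫⁻ ω, ENNReal.ofReal (pertBound σ l r u (X ω)) ∂P :=
        lintegral_mono fun ω => ENNReal.ofReal_le_ofReal (exp_pertLog_le _ _ _ _ _)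
    _ = ENNReal.ofReal (∫ ω, pertBound σ l r u (X ω) ∂P) :=
        (ofReal_integral_eq_lintegral_ofReal (h.integrable_pertBound σ l r _)
          (Filter.Eventually.of_forall fun ω => pertBound_nonneg _ _ _ _ _)).symm
    _ ≤ _ := by
        refine ENNReal.ofReal_le_ofReal ?_
        have := Real.add_one_le_exp (∫ ω, pertBound σ l r u (X ω) ∂P - 1)
        linarith

lemma integral_integral_pertBound_le (h : FourthMomentBound P X κ) {σ : ℝ} (hσ : σ ^ 2 = 1)
    (l r : ℝ) {u : E} (hu : ∫ ω, inner ℝ u (X ω) ^ 2 ∂P = ‖u‖ ^ 2) :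
    Integrable (fun g => ∫ ω, pertBound σ l r (u + r • g) (X ω) ∂P) (stdGaussian E) ∧
    ∫ g, ∫ ω, pertBound σ l r (u + r • g) (X ω) ∂P ∂stdGaussian E
      ≤ 1 + (σ * l * (‖u‖ ^ 2 - 1) + l ^ 2 / 2 * (κ * ‖u‖ ^ 4 - 2 * ‖u‖ ^ 2 + 1)
        + 46 * l ^ 2 * r ^ 2 * (κ * Module.finrank ℝ E * ‖u‖ ^ 2)
        + 67 * l ^ 2 * r ^ 4 * (κ * (Module.finrank ℝ E : ℝ) ^ 2)) := by
  have hXm := h.measurable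
  obtain ⟨hi, hle⟩ := h.integral_smoothed_le σ l r hu
  have hprod : Integrable (fun q : E × Ω => pertBound σ l r (u + r • q.1) (X q.2))
      ((stdGaussian E).prod P) := by
    have hmeas : Measurable fun q : E × Ω => pertBound σ l r (u + r • q.1) (X q.2) :=
      measurable_pertBound σ l r (by fun_prop) (by fun_prop)
    rw [integrable_prod_iff' hmeas.aestronglyMeasurable]
    have e1 : ∀ ω, ∫ g, ‖pertBound σ l r (u + r • g) (X ω)‖ ∂stdGaussian E
        = 1 + σ * l * (inner ℝ u (X ω) ^ 2 - 1) + l ^ 2 / 2 * (inner ℝ u (X ω) ^ 2 - 1) ^ 2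
          + 46 * l ^ 2 * (inner ℝ u (X ω) ^ 2 * (r ^ 2 * ‖X ω‖ ^ 2))
          + 67 * l ^ 2 * (r ^ 2 * ‖X ω‖ ^ 2) ^ 2 := fun ω => by
      rw [← integral_pertBound_stdGaussian hσ l r u (X ω)]
      exact integral_congr_ae (Filter.Eventually.of_forall fun g =>
        Real.norm_of_nonneg (pertBound_nonneg σ l r (u + r • g) (X ω)))
    dsimp only
    simp only [e1]
    exact ⟨Filter.Eventually.of_forall fun ω => integrable_pertBound_stdGaussian σ l r u (X ω), hi⟩
  refine ⟨hprod.integral_prod_left, ?_⟩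
  rw [integral_integral_swap hprod]
  simp only [integral_pertBound_stdGaussian hσ]
  exact hle

/-- Uniform deviation bound for the empirical mean of the influence function. -/
theorem exists_measurableSet_sum_influence_le (h : FourthMomentBound P X κ) (n : ℕ) {σ : ℝ}
    (hσ : σ ^ 2 = 1) (l : ℝ) {r : ℝ} (hr : 0 < r) {ε : ℝ} (hε : 0 < ε) :
    ∃ B : Set (Fin n → Ω), MeasurableSet B ∧
      Measure.pi (fun _ : Fin n => P) Bᶜ ≤ ENNReal.ofReal ε ∧
      ∀ z ∈ B, ∀ u : E, ∫ ω, inner ℝ u (X ω) ^ 2 ∂P = ‖u‖ ^ 2 →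
        ∑ i, influence (σ * l * (inner ℝ u (X (z i)) ^ 2 - 1))
          ≤ n * (σ * l * (‖u‖ ^ 2 - 1) + l ^ 2 / 2 * (κ * ‖u‖ ^ 4 - 2 * ‖u‖ ^ 2 + 1)
            + 46 * l ^ 2 * r ^ 2 * (κ * Module.finrank ℝ E * ‖u‖ ^ 2)
            + 67 * l ^ 2 * r ^ 4 * (κ * (Module.finrank ℝ E : ℝ) ^ 2))
            + ‖u‖ ^ 2 / (2 * r ^ 2) + Real.log ε⁻¹ := by
  have hXm := h.measurable
  have hFm : Measurable fun q : E × Ω => pertLog σ l r (r • q.1) (X q.2) :=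
    measurable_pertLog σ l r (by fun_prop) (by fun_prop)
  have hQm : Measurable fun q : E × Ω => pertBound σ l r (r • q.1) (X q.2) :=
    measurable_pertBound σ l r (by fun_prop) (by fun_prop)
  have hΘm : Measurable fun g : E => ∫ ω, pertBound σ l r (r • g) (X ω) ∂P - 1 :=
    (hQm.stronglyMeasurable.integral_prod_right' (ν := P)).measurable.sub_const 1
  obtain ⟨B, hBm, hBP, hB⟩ := exists_measurableSet_forall_sum_integral_le P n
    (F := fun g ω => pertLog σ l r (r • g) (X ω)) hFm hΘm
    (fun g => h.lintegral_exp_pertLog_le σ l r (r • g)) hε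
  refine ⟨B, hBm, hBP, fun z hz u hu => ?_⟩
  -- The prior on parameters is the law of r g; translating g by u/r gives the posterior centred at
  -- u and the entropy ‖u‖²/(2r²).
  have hshift : ∀ g : E, r • (g + r⁻¹ • u) = u + r • g := fun g => by
    rw [smul_add, smul_smul, mul_inv_cancel₀ hr.ne', one_smul, add_comm]
  have hmain := hB z hz (r⁻¹ • u)
  simp only [hshift] at hmain
  obtain ⟨hi, hle⟩ := h.integral_integral_pertBound_le hσ l r hu
  have h1 := hmain (fun i => integrable_pertLog_stdGaussian σ l r u _)
    (hi.sub (integrable_const 1))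
  rw [integral_sub hi (integrable_const 1)] at h1
  have h2 : ∑ i, influence (σ * l * (inner ℝ u (X (z i)) ^ 2 - 1))
      ≤ ∑ i, ∫ g, pertLog σ l r (u + r • g) (X (z i)) ∂stdGaussian E :=
    Finset.sum_le_sum fun i _ => influence_le_integral_pertLog hσ l r u _
  have h3 : ‖r⁻¹ • u‖ ^ 2 / 2 = ‖u‖ ^ 2 / (2 * r ^ 2) := by
    rw [norm_smul, Real.norm_of_nonneg (by positivity)]; field_simp
  rw [h3] at h1
  have h4 : ∫ _ : E, (1 : ℝ) ∂stdGaussian E = 1 := by simp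
  rw [h4] at h1
  have h5 := mul_le_mul_of_nonneg_left (sub_le_sub_right hle 1) (Nat.cast_nonneg (α := ℝ) n)
  rw [add_sub_cancel_left] at h5
  exact h2.trans (h1.trans (by gcongr))

end FourthMomentBound

end

end RobustLS

/-! ### Random linear forms: covariance, whitening and the good event -/

namespace RobustLS

noncomputable section

open ProbabilityTheory

variable {V : Type*} [AddCommGroup V] [Module ℝ V] {Ω : Type*} [MeasurableSpace Ω]

/-- The second moment of a random linear form `ev`, evaluated at `v`. -/
def secondMoment (P : Measure Ω) (ev : Ω → V →ₗ[ℝ] ℝ) (v : V) : ℝ := ∫ ω, ev ω v ^ 2 ∂P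

/-- A random linear form whose evaluations have a kurtosis bounded by `κ`. -/
structure KurtosisBound (P : Measure Ω) (ev : Ω → V →ₗ[ℝ] ℝ) (κ : ℝ) : Prop where
  measurable : ∀ v, Measurable fun ω => ev ω v
  integrable : ∀ v, Integrable (fun ω => ev ω v ^ 4) P
  bound : ∀ v, ∫ ω, ev ω v ^ 4 ∂P ≤ κ * secondMoment P ev v ^ 2

namespace KurtosisBound

variable {P : Measure Ω} {ev : Ω → V →ₗ[ℝ] ℝ} {κ : ℝ}

lemma secondMoment_nonneg (v : V) : 0 ≤ secondMoment P ev v :=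
  integral_nonneg fun _ => sq_nonneg _

lemma secondMoment_smul (c : ℝ) (v : V) :
    secondMoment P ev (c • v) = c ^ 2 * secondMoment P ev v := by
  unfold secondMoment
  rw [← integral_const_mul]
  congr 1; ext ω
  rw [map_smul, smul_eq_mul]; ring

variable [IsProbabilityMeasure P]

lemma integrable_mul (h : KurtosisBound P ev κ) (v w : V) :
    Integrable (fun ω => ev ω v * ev ω w) P := by
  refine Integrable.mono' (((h.integrable v).add (h.integrable w)).add (integrable_const 1))
    ((h.measurable v).mul (h.measurable w)).aestronglyMeasurable
    (Filter.Eventually.of_forall fun ω => ?_)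
  change ‖ev ω v * ev ω w‖ ≤ ev ω v ^ 4 + ev ω w ^ 4 + 1
  rw [Real.norm_eq_abs, abs_le]
  constructor <;> nlinarith [sq_nonneg (ev ω v ^ 2 - 1 / 2), sq_nonneg (ev ω w ^ 2 - 1 / 2),
    sq_nonneg (ev ω v - ev ω w), sq_nonneg (ev ω v + ev ω w)]

lemma integrable_sq (h : KurtosisBound P ev κ) (v : V) : Integrable (fun ω => ev ω v ^ 2) P := by
  simpa only [sq] using h.integrable_mul v v

/-- The covariance form of a random linear form. -/
def cov (h : KurtosisBound P ev κ) : LinearMap.BilinForm ℝ V :=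
  LinearMap.mk₂ ℝ (fun v w => ∫ ω, ev ω v * ev ω w ∂P)
    (fun v v' w => by
      rw [← integral_add (h.integrable_mul v w) (h.integrable_mul v' w)]
      simp only [map_add, add_mul])
    (fun c v w => by
      rw [smul_eq_mul, ← integral_const_mul]
      simp only [map_smul, smul_eq_mul, mul_assoc])
    (fun v w w' => by
      rw [← integral_add (h.integrable_mul v w) (h.integrable_mul v w')]
      simp only [map_add, mul_add])
    (fun c v w => by
      rw [smul_eq_mul, ← integral_const_mul]
      simp only [map_smul, smul_eq_mul, mul_left_comm])

lemma cov_apply (h : KurtosisBound P ev κ) (v w : V) : h.cov v w = ∫ ω, ev ω v * ev ω w ∂P := rfl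

lemma cov_self (h : KurtosisBound P ev κ) (v : V) : h.cov v v = secondMoment P ev v := by
  rw [cov_apply, secondMoment]
  simp only [sq]

lemma cov_isSymm (h : KurtosisBound P ev κ) : LinearMap.IsSymm h.cov := by
  refine ⟨fun v w => ?_⟩
  simp only [cov_apply, mul_comm, RingHom.id_apply]

lemma ae_eq_zero_of_secondMoment_eq_zero (h : KurtosisBound P ev κ) {v : V}
    (hv : secondMoment P ev v = 0) : ∀ᵐ ω ∂P, ev ω v = 0 := by
  have := (integral_eq_zero_iff_of_nonneg (fun ω => sq_nonneg (ev ω v)) (h.integrable_sq v)).1 hv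
  filter_upwards [this] with ω hω
  simpa using hω

lemma secondMoment_congr (h : KurtosisBound P ev κ) {v w : V}
    (hvw : secondMoment P ev (v - w) = 0) : secondMoment P ev v = secondMoment P ev w := by
  refine integral_congr_ae ?_
  filter_upwards [h.ae_eq_zero_of_secondMoment_eq_zero hvw] with ω hω
  rw [map_sub, sub_eq_zero] at hω
  simp only [hω]

variable [FiniteDimensional ℝ V]

/-- Whitening of a random linear form. -/
theorem exists_whitening (h : KurtosisBound P ev κ) (hκ : 0 ≤ κ) :
    ∃ X : Ω → EuclideanSpace ℝ (Fin (Module.finrank ℝ V)), FourthMomentBound P X κ ∧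
      ∃ S : Set Ω, MeasurableSet S ∧ P Sᶜ = 0 ∧ ∀ v : V,
        ∃ u : EuclideanSpace ℝ (Fin (Module.finrank ℝ V)),
          ‖u‖ ^ 2 = secondMoment P ev v ∧ ∀ ω ∈ S, ev ω v = inner ℝ u (X ω) := by
  have : Invertible (2 : ℝ) := invertibleOfNonzero two_ne_zero
  obtain ⟨b, hb⟩ := LinearMap.BilinForm.exists_orthogonal_basis h.cov_isSymm
  set m : Fin (Module.finrank ℝ V) → ℝ := fun i => secondMoment P ev (b i) with hm
  have hm0 : ∀ i, 0 ≤ m i := fun i => secondMoment_nonneg _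
  have horth : ∀ i j, i ≠ j → h.cov (b i) (b j) = 0 := fun i j hij => hb hij
  have hcov : ∀ c : Fin (Module.finrank ℝ V) → ℝ,
      secondMoment P ev (∑ i, c i • b i) = ∑ i, c i ^ 2 * m i := fun c => by
    rw [← h.cov_self]
    simp only [map_sum, LinearMap.sum_apply, map_smul, LinearMap.smul_apply, smul_eq_mul]
    refine Finset.sum_congr rfl fun i _ => ?_
    rw [Finset.sum_eq_single i]
    · rw [h.cov_self]; ring
    · intro j _ hj
      rw [horth j i hj]; ring
    · simp
  -- The covariance may be degenerate: where m i = 0 the convention 0⁻¹ = 0 makes the coordinate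
  -- vanish. This is why `hle` is only an inequality and why the representation of `ev ω v` is
  -- restricted to the almost sure event where `ev` vanishes at these basis vectors. That event
  -- serves all v at once.
  set X : Ω → EuclideanSpace ℝ (Fin (Module.finrank ℝ V)) := fun ω =>
    WithLp.toLp 2 fun i => (√(m i))⁻¹ * ev ω (b i) with hX
  have hinner : ∀ (u : EuclideanSpace ℝ (Fin (Module.finrank ℝ V))) (ω : Ω),
      inner ℝ u (X ω) = ev ω (∑ i, (u i * (√(m i))⁻¹) • b i) := fun u ω => by
    simp only [PiLp.inner_apply, hX, map_sum, map_smul, smul_eq_mul]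
    refine Finset.sum_congr rfl fun i _ => ?_
    simp only [RCLike.inner_apply, conj_trivial]
    ring
  have hle : ∀ u : EuclideanSpace ℝ (Fin (Module.finrank ℝ V)),
      secondMoment P ev (∑ i, (u i * (√(m i))⁻¹) • b i) ≤ ‖u‖ ^ 2 := fun u => by
    rw [hcov, EuclideanSpace.real_norm_sq_eq]
    refine Finset.sum_le_sum fun i _ => ?_
    rcases (hm0 i).eq_or_lt with h0 | h0
    · rw [← h0]; nlinarith [sq_nonneg (u i)]
    · rw [mul_pow, inv_pow, Real.sq_sqrt h0.le, mul_assoc, inv_mul_cancel₀ h0.ne', mul_one]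
  refine ⟨X, ⟨?_, fun u => ?_, fun u => ?_⟩, ⋂ i ∈ {i | m i = 0}, {ω | ev ω (b i) = 0}, ?_, ?_, ?_⟩
  · rw [hX]
    refine (WithLp.measurable_toLp 2 _).comp (measurable_pi_lambda _ fun i => ?_)
    exact (h.measurable (b i)).const_mul _
  · simp only [hinner]; exact h.integrable _
  · simp only [hinner]
    refine (h.bound _).trans ?_
    have e : ‖u‖ ^ 4 = (‖u‖ ^ 2) ^ 2 := by ring
    rw [e]
    exact mul_le_mul_of_nonneg_left (pow_le_pow_left₀ (secondMoment_nonneg _) (hle u) 2) hκ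
  · exact MeasurableSet.biInter (Set.to_countable _) fun i _ =>
      h.measurable (b i) (measurableSet_singleton 0)
  · have : ∀ᵐ ω ∂P, ∀ i, m i = 0 → ev ω (b i) = 0 := by
      rw [ae_all_iff]
      intro i
      by_cases hi : m i = 0
      · filter_upwards [h.ae_eq_zero_of_secondMoment_eq_zero hi] with ω hω _ using hω
      · exact Filter.Eventually.of_forall fun ω h' => absurd h' hi
    have h2 : ∀ᵐ ω ∂P, ω ∈ ⋂ i ∈ {i | m i = 0}, {ω | ev ω (b i) = 0} := by
      filter_upwards [this] with ω hω
      simpa using hω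
    exact h2
  · intro v
    refine ⟨WithLp.toLp 2 fun i => √(m i) * b.repr v i, ?_, fun ω hω => ?_⟩
    · rw [EuclideanSpace.real_norm_sq_eq]
      conv_rhs => rw [← b.sum_repr v, hcov]
      refine Finset.sum_congr rfl fun i _ => ?_
      change (√(m i) * b.repr v i) ^ 2 = _
      rw [mul_pow, Real.sq_sqrt (hm0 i), mul_comm]
    · rw [hinner]
      conv_lhs => rw [← b.sum_repr v]
      simp only [map_sum, map_smul, smul_eq_mul]
      refine Finset.sum_congr rfl fun i _ => ?_
      rcases (hm0 i).eq_or_lt with h0 | h0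
      · have : ev ω (b i) = 0 := by
          simp only [Set.mem_iInter] at hω
          exact hω i h0.symm
        rw [this]; ring
      · have := (Real.sqrt_pos.2 h0).ne'
        field_simp

/-- The event on which the empirical influence functions locate the second moments. -/
theorem exists_good_event (h : KurtosisBound P ev κ) (hκ : 0 ≤ κ) (n : ℕ) {l r ρ L : ℝ} (hr : 0 < r)
    (hbound : ∀ σ v : ℝ, (σ = 1 ∧ v = 1 - ρ ∨ σ = -1 ∧ v = 1 + ρ) →
      n * (σ * l * (v - 1) + l ^ 2 / 2 * (κ * v ^ 2 - 2 * v + 1)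
        + 46 * l ^ 2 * r ^ 2 * (κ * Module.finrank ℝ V * v)
        + 67 * l ^ 2 * r ^ 4 * (κ * (Module.finrank ℝ V : ℝ) ^ 2)) + v / (2 * r ^ 2) + L < 0)
    {ε : ℝ} (hε : 0 < ε) (hL : Real.log ε⁻¹ ≤ L) :
    ∃ B : Set (Fin n → Ω), MeasurableSet B ∧
      Measure.pi (fun _ : Fin n => P) Bᶜ ≤ ENNReal.ofReal (2 * ε) ∧ ∀ z ∈ B,
        (∀ v, secondMoment P ev v = 1 - ρ → ∑ i, influence (l * (ev (z i) v ^ 2 - 1)) < 0) ∧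
        (∀ v, secondMoment P ev v = 1 + ρ → ∑ i, influence (-(l * (ev (z i) v ^ 2 - 1))) < 0) ∧
        ∃ C : ℝ, 0 ≤ C ∧ ∀ v, ∑ i, ev (z i) v ^ 2 ≤ C * secondMoment P ev v := by
  obtain ⟨X, hX, S, hSm, hS, hrep⟩ := h.exists_whitening hκ
  obtain ⟨B₁, hm₁, hP₁, hB₁⟩ :=
    hX.exists_measurableSet_sum_influence_le n (σ := 1) (by norm_num) l hr hε
  obtain ⟨B₂, hm₂, hP₂, hB₂⟩ :=
    hX.exists_measurableSet_sum_influence_le n (σ := -1) (by norm_num) l hr hε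
  set T : Set (Fin n → Ω) := Set.univ.pi fun _ => S with hT
  have hTm : MeasurableSet T := MeasurableSet.univ_pi fun _ => hSm
  have hTP : Measure.pi (fun _ : Fin n => P) Tᶜ = 0 := by
    have hS1 : P S = 1 := by
      have := prob_compl_eq_zero_iff (μ := P) hSm
      exact this.1 hS
    rw [prob_compl_eq_zero_iff hTm, hT, Measure.pi_pi]
    simp [hS1]
  refine ⟨B₁ ∩ B₂ ∩ T, (hm₁.inter hm₂).inter hTm, ?_, fun z hz => ?_⟩
  · rw [Set.compl_inter, Set.compl_inter]
    calc _ ≤ Measure.pi (fun _ : Fin n => P) (B₁ᶜ ∪ B₂ᶜ) + Measure.pi (fun _ : Fin n => P) Tᶜ :=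
          measure_union_le _ _
      _ ≤ (ENNReal.ofReal ε + ENNReal.ofReal ε) + 0 := by
          gcongr
          · exact (measure_union_le _ _).trans (add_le_add hP₁ hP₂)
          · exact hTP.le
      _ = ENNReal.ofReal (2 * ε) := by
          rw [add_zero, ← ENNReal.ofReal_add hε.le hε.le, two_mul]
  · obtain ⟨⟨hz₁, hz₂⟩, hzT⟩ := hz
    have hzS : ∀ i, z i ∈ S := fun i => hzT i trivial
    have hmom : ∀ (v : V) (u : EuclideanSpace ℝ (Fin (Module.finrank ℝ V))),
        ‖u‖ ^ 2 = secondMoment P ev v → (∀ ω ∈ S, ev ω v = inner ℝ u (X ω)) →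
        ∫ ω, inner ℝ u (X ω) ^ 2 ∂P = ‖u‖ ^ 2 := fun v u hu hv => by
      rw [hu]
      refine integral_congr_ae ?_
      have : ∀ᵐ ω ∂P, ω ∈ S := hS
      filter_upwards [this] with ω hω
      rw [hv ω hω]
    simp only [finrank_euclideanSpace_fin] at hB₁ hB₂
    refine ⟨fun v hv => ?_, fun v hv => ?_, ?_⟩
    · obtain ⟨u, hu, huv⟩ := hrep v
      have h1 := hB₁ z hz₁ u (hmom v u hu huv)
      have h2 := hbound 1 (1 - ρ) (Or.inl ⟨rfl, rfl⟩)
      have e : ‖u‖ ^ 4 = (1 - ρ) ^ 2 := by rw [← hv, ← hu]; ring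
      rw [e, hu, hv] at h1
      simp only [← huv _ (hzS _), one_mul] at h1 h2
      linarith
    · obtain ⟨u, hu, huv⟩ := hrep v
      have h1 := hB₂ z hz₂ u (hmom v u hu huv)
      have h2 := hbound (-1) (1 + ρ) (Or.inr ⟨rfl, rfl⟩)
      have e : ‖u‖ ^ 4 = (1 + ρ) ^ 2 := by rw [← hv, ← hu]; ring
      rw [e, hu, hv] at h1
      simp only [← huv _ (hzS _), neg_mul, one_mul] at h1 h2
      linarith
    -- Cauchy–Schwarz in the whitened space. This domination makes the sample vanish in every
    -- direction of zero second moment.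
    · refine ⟨∑ i, ‖X (z i)‖ ^ 2, Finset.sum_nonneg fun i _ => sq_nonneg _, fun v => ?_⟩
      obtain ⟨u, hu, huv⟩ := hrep v
      rw [Finset.sum_mul]
      refine Finset.sum_le_sum fun i _ => ?_
      rw [huv _ (hzS i), ← hu]
      have := sq_le_sq.2 (abs_real_inner_le_norm u (X (z i)) |>.trans (le_abs_self _))
      linarith [mul_pow ‖u‖ ‖X (z i)‖ 2]

end KurtosisBound

end

end RobustLS

/-! ### The estimator: a quadratic form compatible with the signs of the sums -/

namespace RobustLS

noncomputable section

open ProbabilityTheory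

variable {V : Type*} [NormedAddCommGroup V] [NormedSpace ℝ V] {Ω : Type*}

/-- The quadratic form with matrix `A` in terms of the values of the linear forms of the sample. -/
def sampleForm (ev : Ω → V →ₗ[ℝ] ℝ) {n : ℕ} (A : Fin n → Fin n → ℚ) (z : Fin n → Ω) :
    QuadraticForm ℝ V :=
  ∑ i, ∑ j, (A i j : ℝ) • QuadraticMap.linMulLin (ev (z i)) (ev (z j))

lemma sampleForm_apply (ev : Ω → V →ₗ[ℝ] ℝ) {n : ℕ} (A : Fin n → Fin n → ℚ) (z : Fin n → Ω)
    (v : V) : sampleForm ev A z v = ∑ i, ∑ j, (A i j : ℝ) * (ev (z i) v * ev (z j) v) := by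
  simp [sampleForm]

/-- A sample is compatible with the quadratic form of matrix `A` at the points of a sequence. -/
def Feasible (ev : Ω → V →ₗ[ℝ] ℝ) (D : ℕ → V) (l a b : ℝ) {n : ℕ} (A : Fin n → Fin n → ℚ)
    (z : Fin n → Ω) : Prop :=
  ∀ k, (sampleForm ev A z (D k) < a → ∑ i, influence (l * (ev (z i) (D k) ^ 2 - 1)) ≤ 0) ∧
    (b < sampleForm ev A z (D k) → ∑ i, influence (-(l * (ev (z i) (D k) ^ 2 - 1))) ≤ 0)

section Estimator

variable (ev : Ω → V →ₗ[ℝ] ℝ) (D : ℕ → V) (l a b : ℝ) {n : ℕ} (e : ℕ → Fin n → Fin n → ℚ)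

/-- The second alternative makes the search total: it stops at index 0 when no candidate is
compatible, and the condition tested remains measurable in the sample. -/
lemma exists_feasible_or (z : Fin n → Ω) :
    ∃ k, Feasible ev D l a b (e k) z ∨ ¬ ∃ j, Feasible ev D l a b (e j) z := by
  by_cases h : ∃ j, Feasible ev D l a b (e j) z
  · exact ⟨h.choose, Or.inl h.choose_spec⟩
  · exact ⟨0, Or.inr h⟩

open Classical in
/-- The first compatible quadratic form in an enumeration of rational matrices. -/
def quadEstimator (z : Fin n → Ω) : QuadraticForm ℝ V :=
  sampleForm ev (e (Nat.find (exists_feasible_or ev D l a b e z))) z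

variable {ev D l a b e}

lemma exists_feasible_eq_quadEstimator {z : Fin n → Ω}
    (h : ∃ k, Feasible ev D l a b (e k) z) :
    ∃ k, Feasible ev D l a b (e k) z ∧ quadEstimator ev D l a b e z = sampleForm ev (e k) z := by
  classical
  refine ⟨_, ?_, rfl⟩
  exact (Nat.find_spec (exists_feasible_or ev D l a b e z)).resolve_right (not_not.2 h)

variable [MeasurableSpace Ω]

lemma measurable_sampleForm (hev : ∀ v, Measurable fun ω => ev ω v) (A : Fin n → Fin n → ℚ)
    (v : V) : Measurable fun z : Fin n → Ω => sampleForm ev A z v := by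
  simp only [sampleForm_apply]
  have : ∀ i : Fin n, Measurable fun z : Fin n → Ω => ev (z i) v := fun i =>
    (hev v).comp (measurable_pi_apply i)
  fun_prop

lemma measurableSet_feasible (hev : ∀ v, Measurable fun ω => ev ω v) (A : Fin n → Fin n → ℚ) :
    MeasurableSet {z : Fin n → Ω | Feasible ev D l a b A z} := by
  simp only [Feasible, Set.ofPred_forall]
  refine MeasurableSet.iInter fun k => ?_
  have h1 : ∀ i : Fin n, Measurable fun z : Fin n → Ω => ev (z i) (D k) := fun i =>
    (hev _).comp (measurable_pi_apply i)
  have h2 := continuous_influence.measurable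
  have h3 := measurable_sampleForm hev A (D k)
  refine MeasurableSet.inter (MeasurableSet.imp ?_ ?_) (MeasurableSet.imp ?_ ?_)
  · exact measurableSet_lt h3 measurable_const
  · exact measurableSet_le (by fun_prop) measurable_const
  · exact measurableSet_lt measurable_const h3
  · exact measurableSet_le (by fun_prop) measurable_const

lemma measurable_quadEstimator (hev : ∀ v, Measurable fun ω => ev ω v) (v : V) :
    Measurable fun z : Fin n → Ω => quadEstimator ev D l a b e z v := by
  classical
  have hf := fun k => measurableSet_feasible (D := D) (l := l) (a := a) (b := b) hev (e k)
  refine Measurable.find (f := fun k z => sampleForm ev (e k) z v)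
    (fun k => measurable_sampleForm hev (e k) v) (fun k => ?_) (exists_feasible_or ev D l a b e)
  refine (hf k).union (MeasurableSet.compl ?_)
  have : {z : Fin n → Ω | ∃ j, Feasible ev D l a b (e j) z}
      = ⋃ j, {z | Feasible ev D l a b (e j) z} := by
    ext z; simp
  have h2 : MeasurableSet {z : Fin n → Ω | ∃ j, Feasible ev D l a b (e j) z} := by
    rw [this]; exact MeasurableSet.iUnion hf
  exact h2

end Estimator

variable {ev : Ω → V →ₗ[ℝ] ℝ} {n : ℕ}

lemma sum_influence_add_nonneg (l : ℝ) (z : Fin n → Ω) (v : V) :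
    0 ≤ ∑ i, influence (l * (ev (z i) v ^ 2 - 1))
      + ∑ i, influence (-(l * (ev (z i) v ^ 2 - 1))) := by
  rw [← Finset.sum_add_distrib]
  exact Finset.sum_nonneg fun i _ => influence_add_neg_nonneg _

lemma exists_pos_smul_secondMoment_eq [MeasurableSpace Ω] {P : Measure Ω} {v : V} (hv : 0 < secondMoment P ev v) {c : ℝ} (hc : 0 < c) :
    ∃ s : ℝ, 0 < s ∧ s ^ 2 = c / secondMoment P ev v ∧ secondMoment P ev (s • v) = c := by
  have h : 0 < c / secondMoment P ev v := div_pos hc hv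
  refine ⟨√(c / secondMoment P ev v), Real.sqrt_pos.2 h, Real.sq_sqrt h.le, ?_⟩
  rw [KurtosisBound.secondMoment_smul, Real.sq_sqrt h.le, div_mul_cancel₀ _ hv.ne']

variable [FiniteDimensional ℝ V] {D : ℕ → V} {l a b : ℝ}

/-- The premises are strict, hence define open sets, and the conclusions are closed conditions, so
they pass from the dense sequence to all v. -/
lemma Feasible.forall (hD : DenseRange D) {A : Fin n → Fin n → ℚ} {z : Fin n → Ω}
    (h : Feasible ev D l a b A z) (v : V) :
    (sampleForm ev A z v < a → ∑ i, influence (l * (ev (z i) v ^ 2 - 1)) ≤ 0) ∧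
    (b < sampleForm ev A z v → ∑ i, influence (-(l * (ev (z i) v ^ 2 - 1))) ≤ 0) := by
  have hc : ∀ i, Continuous fun v => ev (z i) v := fun i =>
    (ev (z i)).continuous_of_finiteDimensional
  have hQ : Continuous fun v => sampleForm ev A z v := by
    simp only [sampleForm_apply]; fun_prop
  have key : ∀ (U : Set V) (f : V → ℝ), IsOpen U → Continuous f → (∀ k, D k ∈ U → f (D k) ≤ 0) →
      ∀ v ∈ U, f v ≤ 0 := by
    intro U f hU hf hk v hv
    have h1 := hD.open_subset_closure_inter hU hv
    have h2 : IsClosed {v | f v ≤ 0} := isClosed_le hf continuous_const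
    refine h2.closure_subset_iff.2 ?_ h1
    rintro _ ⟨hx, k, rfl⟩
    exact hk k hx
  exact ⟨fun hv => key {v | sampleForm ev A z v < a}
      (fun v => ∑ i, influence (l * (ev (z i) v ^ 2 - 1))) (isOpen_lt hQ continuous_const)
      (by fun_prop) (fun k hk => (h k).1 hk) v hv,
    fun hv => key {v | b < sampleForm ev A z v}
      (fun v => ∑ i, influence (-(l * (ev (z i) v ^ 2 - 1)))) (isOpen_lt continuous_const hQ)
      (by fun_prop) (fun k hk => (h k).2 hk) v hv⟩

namespace KurtosisBound

variable [MeasurableSpace Ω] {P : Measure Ω} [IsProbabilityMeasure P] {κ : ℝ}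

/-- If the sample separates the directions of positive second moment, the second moment is a
quadratic form in the values of the linear forms of the sample. -/
lemma exists_matrix (h : KurtosisBound P ev κ) (z : Fin n → Ω)
    (hker : ∀ v, (∀ i, ev (z i) v = 0) → secondMoment P ev v = 0) :
    ∃ A : Fin n → Fin n → ℝ, ∀ v,
      secondMoment P ev v = ∑ i, ∑ j, A i j * (ev (z i) v * ev (z j) v) := by
  set T : V →ₗ[ℝ] (Fin n → ℝ) := LinearMap.pi fun i => ev (z i) with hT
  obtain ⟨g, hg⟩ := T.rangeRestrict.exists_rightInverse_of_surjective T.range_rangeRestrict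
  obtain ⟨S, hS⟩ := LinearMap.exists_extend g
  -- S extends a section of T over its range, so v and S(T v) have the same sample values; by `hker`
  -- their difference has zero second moment, and the matrix is the covariance pulled back by S.
  have hTS : ∀ v, T (S (T v)) = T v := fun v => by
    have h1 : S (T v) = g (T.rangeRestrict v) := by
      rw [← hS]; rfl
    have h2 := congrArg Subtype.val (LinearMap.congr_fun hg (T.rangeRestrict v))
    rw [h1]
    exact h2
  refine ⟨fun i j => h.cov (S (Pi.single i 1)) (S (Pi.single j 1)), fun v => ?_⟩
  have h1 : secondMoment P ev v = secondMoment P ev (S (T v)) := by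
    refine h.secondMoment_congr (hker _ fun i => ?_)
    have := congrFun (hTS v) i
    rw [map_sub, sub_eq_zero]
    exact this.symm
  have h2 : T v = ∑ i, ev (z i) v • (Pi.single i 1 : Fin n → ℝ) := by
    ext k
    simp [hT, Finset.sum_apply, Pi.single_apply]
  rw [h1, ← h.cov_self, h2]
  simp only [map_sum, LinearMap.sum_apply, map_smul, LinearMap.smul_apply, smul_eq_mul]
  simp only [Finset.mul_sum]
  rw [Finset.sum_comm]
  refine Finset.sum_congr rfl fun i _ => Finset.sum_congr rfl fun j _ => ?_
  ring

/-- Rounding the matrix in the sample values, rather than the form on V, gives a relative error even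
if the second moment is degenerate: by `hdom` the rounding error vanishes wherever the second moment
does. -/
lemma exists_rat_matrix (h : KurtosisBound P ev κ) (z : Fin n → Ω)
    (hker : ∀ v, (∀ i, ev (z i) v = 0) → secondMoment P ev v = 0) {C : ℝ} (hC : 0 ≤ C)
    (hdom : ∀ v, ∑ i, ev (z i) v ^ 2 ≤ C * secondMoment P ev v) {η : ℝ} (hη : 0 < η) :
    ∃ A : Fin n → Fin n → ℚ, ∀ v,
      |sampleForm ev A z v - secondMoment P ev v| ≤ η * secondMoment P ev v := by
  obtain ⟨A, hA⟩ := h.exists_matrix z hker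
  set η' := η / (n * C + 1) with hη'
  have hη0 : 0 < η' := by positivity
  have hex : ∀ i j, ∃ q : ℚ, |(q : ℝ) - A i j| ≤ η' := fun i j => by
    obtain ⟨q, hq⟩ := exists_rat_near (A i j) hη0
    exact ⟨q, by rw [abs_sub_comm]; exact hq.le⟩
  choose Q hQ using hex
  refine ⟨Q, fun v => ?_⟩
  set y : Fin n → ℝ := fun i => ev (z i) v with hy
  have hN : 0 ≤ secondMoment P ev v := secondMoment_nonneg v
  calc |sampleForm ev Q z v - secondMoment P ev v|
      = |∑ i, ∑ j, ((Q i j : ℝ) - A i j) * (y i * y j)| := by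
        rw [hA, sampleForm_apply, ← Finset.sum_sub_distrib]
        congr 1
        refine Finset.sum_congr rfl fun i _ => ?_
        rw [← Finset.sum_sub_distrib]
        exact Finset.sum_congr rfl fun j _ => (sub_mul _ _ _).symm
    _ ≤ ∑ i, ∑ j, η' * ((y i ^ 2 + y j ^ 2) / 2) := by
        refine (Finset.abs_sum_le_sum_abs _ _).trans (Finset.sum_le_sum fun i _ => ?_)
        refine (Finset.abs_sum_le_sum_abs _ _).trans (Finset.sum_le_sum fun j _ => ?_)
        rw [abs_mul]
        refine mul_le_mul (hQ i j) ?_ (abs_nonneg _) hη0.le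
        rw [abs_le]
        constructor <;> nlinarith [sq_nonneg (y i - y j), sq_nonneg (y i + y j)]
    _ = η' * (n * ∑ i, y i ^ 2) := by
        simp only [← Finset.mul_sum, ← Finset.sum_div, Finset.sum_add_distrib, Finset.sum_const,
          Finset.card_univ, Fintype.card_fin, nsmul_eq_mul]
        ring
    _ ≤ η' * (n * (C * secondMoment P ev v)) := by
        gcongr; exact hdom v
    _ ≤ η' * ((n * C + 1) * secondMoment P ev v) := by
        refine mul_le_mul_of_nonneg_left ?_ hη0.le
        nlinarith
    _ = η * secondMoment P ev v := by
        rw [hη', ← mul_assoc, div_mul_cancel₀ _ (by positivity)]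

/-- On the good event, the estimator is equivalent to the second moment. -/
theorem quadEstimator_bounds (h : KurtosisBound P ev κ) (hD : DenseRange D)
    {e : ℕ → Fin n → Fin n → ℚ} (he : Function.Surjective e) {ρ η : ℝ} (hl : 0 < l) (hρ : 0 < ρ)
    (hρ1 : ρ < 1) (hη : 0 < η) (hη1 : η < 1) {z : Fin n → Ω}
    (h₁ : ∀ v, secondMoment P ev v = 1 - ρ → ∑ i, influence (l * (ev (z i) v ^ 2 - 1)) < 0)
    (h₂ : ∀ v, secondMoment P ev v = 1 + ρ → ∑ i, influence (-(l * (ev (z i) v ^ 2 - 1))) < 0)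
    (h₃ : ∃ C : ℝ, 0 ≤ C ∧ ∀ v, ∑ i, ev (z i) v ^ 2 ≤ C * secondMoment P ev v) (v : V) :
    (1 - ρ) * (1 - η) / (1 + ρ) * secondMoment P ev v
        ≤ quadEstimator ev D l ((1 - ρ) * (1 - η)) ((1 + ρ) * (1 + η)) e z v ∧
      quadEstimator ev D l ((1 - ρ) * (1 - η)) ((1 + ρ) * (1 + η)) e z v
        ≤ (1 + ρ) * (1 + η) / (1 - ρ) * secondMoment P ev v := by
  obtain ⟨C, hC, hdom⟩ := h₃
  have hzero : ∀ v, secondMoment P ev v = 0 → ∀ i, ev (z i) v = 0 := fun v hv i => by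
    have h1 := hdom v
    rw [hv, mul_zero] at h1
    have h2 := (Finset.sum_eq_zero_iff_of_nonneg fun i _ => sq_nonneg (ev (z i) v)).1
      (le_antisymm h1 (Finset.sum_nonneg fun i _ => sq_nonneg _)) i (Finset.mem_univ i)
    exact pow_eq_zero_iff two_ne_zero |>.1 h2
  -- A direction invisible to the sample, rescaled to second moment 1 + ρ, would make the sum in
  -- `h₂` equal to n times the influence at l > 0, which is not negative.
  have hker : ∀ v, (∀ i, ev (z i) v = 0) → secondMoment P ev v = 0 := fun v hv => by
    by_contra hne
    obtain ⟨s, -, -, hs⟩ := exists_pos_smul_secondMoment_eq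
      ((secondMoment_nonneg v).lt_of_ne' hne) (by linarith : 0 < 1 + ρ)
    have h1 := h₂ _ hs
    refine absurd h1 (not_lt.2 (Finset.sum_nonneg fun i _ => influence_nonneg ?_))
    rw [map_smul, hv i]
    simp [hl.le]
  -- Scaling v up to the level 1 − ρ increases every summand, by monotonicity of the influence
  -- function. Null directions cannot be scaled, but there the sample vanishes.
  have hup : ∀ v, secondMoment P ev v < 1 - ρ →
      ∑ i, influence (l * (ev (z i) v ^ 2 - 1)) ≤ 0 := fun v hv => by
    rcases (secondMoment_nonneg (P := P) (ev := ev) v).eq_or_lt with h0 | h0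
    · refine Finset.sum_nonpos fun i _ => ?_
      rw [hzero v h0.symm i]
      refine (influence_le_truncLog _).trans ((truncLog_monotone
        (by nlinarith : l * (0 ^ 2 - 1) ≤ 0)).trans ?_)
      rw [truncLog_of_mem (by norm_num) (by norm_num)]
      simp [quadExp]
    · obtain ⟨s, hs0, hs2, hs⟩ := exists_pos_smul_secondMoment_eq h0 (by linarith : 0 < 1 - ρ)
      refine le_trans (Finset.sum_le_sum fun i _ => influence_monotone ?_) (h₁ _ hs).le
      rw [map_smul, smul_eq_mul, mul_pow, hs2]
      have h1 : 1 ≤ (1 - ρ) / secondMoment P ev v := (one_le_div h0).2 hv.le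
      have h2 := sq_nonneg (ev (z i) v)
      gcongr
      nlinarith
  have hdown : ∀ v, 1 + ρ < secondMoment P ev v →
      ∑ i, influence (-(l * (ev (z i) v ^ 2 - 1))) ≤ 0 := fun v hv => by
    have h0 : 0 < secondMoment P ev v := by linarith
    obtain ⟨s, hs0, hs2, hs⟩ := exists_pos_smul_secondMoment_eq h0 (by linarith : 0 < 1 + ρ)
    refine le_trans (Finset.sum_le_sum fun i _ => influence_monotone ?_) (h₂ _ hs).le
    rw [map_smul, smul_eq_mul, mul_pow, hs2]
    have h1 : (1 + ρ) / secondMoment P ev v ≤ 1 := (div_le_one h0).2 hv.le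
    have h2 := sq_nonneg (ev (z i) v)
    gcongr
    nlinarith
  -- A rational form within relative error η of the second moment is compatible; the factors 1 ± η
  -- in the thresholds absorb the rounding.
  have hfeas : ∃ k, Feasible ev D l ((1 - ρ) * (1 - η)) ((1 + ρ) * (1 + η)) (e k) z := by
    obtain ⟨A, hA⟩ := h.exists_rat_matrix z hker hC hdom hη
    obtain ⟨k, rfl⟩ := he A
    refine ⟨k, fun j => ⟨fun hj => hup _ ?_, fun hj => hdown _ ?_⟩⟩
    · have := (abs_le.1 (hA (D j))).1
      nlinarith
    · have := (abs_le.1 (hA (D j))).2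
      nlinarith
  obtain ⟨k, hk, hkeq⟩ := exists_feasible_eq_quadEstimator hfeas
  rw [hkeq]
  rcases (secondMoment_nonneg (P := P) (ev := ev) v).eq_or_lt with h0 | h0
  · have : sampleForm ev (e k) z v = 0 := by
      rw [sampleForm_apply]
      simp [hzero v h0.symm]
    rw [this, ← h0]
    simp
  constructor
  · obtain ⟨s, hs0, hs2, hs⟩ := exists_pos_smul_secondMoment_eq h0 (by linarith : 0 < 1 + ρ)
    -- At level 1 + ρ the reflected sum is negative; a value of the form below the lower threshold
    -- would make the direct sum nonpositive as well, against `sum_influence_add_nonneg`.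
    have h1 : (1 - ρ) * (1 - η) ≤ sampleForm ev (e k) z (s • v) := by
      by_contra hlt
      have h3 := (hk.forall hD (s • v)).1 (not_le.1 hlt)
      have h4 := sum_influence_add_nonneg (ev := ev) l z (s • v)
      linarith [h₂ _ hs]
    rw [QuadraticMap.map_smul, ← sq, hs2, smul_eq_mul, div_mul_eq_mul_div, le_div_iff₀ h0] at h1
    rw [div_mul_eq_mul_div, div_le_iff₀ (by linarith)]
    linarith
  · obtain ⟨s, hs0, hs2, hs⟩ := exists_pos_smul_secondMoment_eq h0 (by linarith : 0 < 1 - ρ)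
    have h1 : sampleForm ev (e k) z (s • v) ≤ (1 + ρ) * (1 + η) := by
      by_contra hlt
      have h3 := (hk.forall hD (s • v)).2 (not_le.1 hlt)
      have h4 := sum_influence_add_nonneg (ev := ev) l z (s • v)
      linarith [h₁ _ hs]
    rw [QuadraticMap.map_smul, ← sq, hs2, smul_eq_mul, div_mul_eq_mul_div, div_le_iff₀ h0] at h1
    rw [div_mul_eq_mul_div, le_div_iff₀ (by linarith)]
    linarith

end KurtosisBound

end

end RobustLS

/-! ### Tuning of the scale l and of the perturbation r -/

namespace RobustLS

noncomputable section

/-- The choice of r makes the entropy and the term with 46 both equal to n l q v; the term with 67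
becomes 67D/92, and 67/92 ≤ 0.73 is the origin of that constant. -/
lemma deviation_le {n l q r k D L a v t : ℝ} (hn : 0 < n) (hl : 0 < l) (hq : 0 < q) (hD : 0 ≤ D)
    (hv : 0 ≤ v) (hqn : q ^ 2 * n = 23 * k ^ 2 * D) (hr : r ^ 2 = 1 / (2 * n * l * q))
    (hA : L + 0.73 * D = n * l * (a / 2)) (hqt : 2 * q ≤ t) (σ : ℝ) :
    n * (σ * l * (v - 1) + l ^ 2 / 2 * (k ^ 2 * v ^ 2 - 2 * v + 1)
        + 46 * l ^ 2 * r ^ 2 * (k ^ 2 * D * v)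
        + 67 * l ^ 2 * r ^ 4 * (k ^ 2 * D ^ 2)) + v / (2 * r ^ 2) + L
      ≤ n * l * (σ * (v - 1) + l / 2 * (k ^ 2 * v ^ 2 - 2 * v + 1) + t * v + a / 2) := by
  have hr4 : r ^ 4 = (1 / (2 * n * l * q)) ^ 2 := by rw [← hr]; ring
  have e1 : n * (46 * l ^ 2 * r ^ 2 * (k ^ 2 * D * v)) = n * l * (q * v) := by
    rw [hr]
    field_simp
    linear_combination (-2 * v) * hqn
  have e2 : v / (2 * r ^ 2) = n * l * (q * v) := by
    rw [hr]; field_simp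
  have e3 : n * (67 * l ^ 2 * r ^ 4 * (k ^ 2 * D ^ 2)) = 67 / 92 * D := by
    rw [hr4]
    field_simp
    linear_combination (-4 * D) * hqn
  have e4 : 67 / 92 * D + L ≤ n * l * (a / 2) := by
    rw [← hA]
    have : (67 / 92 : ℝ) ≤ 0.73 := by norm_num
    nlinarith
  have e5 : n * l * (2 * q * v) ≤ n * l * (t * v) := by gcongr
  calc _ = n * l * (σ * (v - 1) + l / 2 * (k ^ 2 * v ^ 2 - 2 * v + 1))
        + n * (46 * l ^ 2 * r ^ 2 * (k ^ 2 * D * v))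
        + n * (67 * l ^ 2 * r ^ 4 * (k ^ 2 * D ^ 2)) + v / (2 * r ^ 2) + L := by ring
    _ ≤ _ := by
        rw [e1, e2, e3]
        linarith

/-- Choice of the tuning parameters: the deviation bounds are negative at `1 - ρ` and `1 + ρ`. -/
theorem exists_tuning {k D L : ℝ} {n : ℕ} (hk : 1 < k ^ 2) (hk0 : 0 ≤ k) (hD : 1 ≤ D) (hL : 0 ≤ L)
    (hn : (20 * k * √D + (5 / 2 + 1 / (2 * (k ^ 2 - 1))) * √(2 * (k ^ 2 - 1) * (L + 0.73 * D))) ^ 2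
      < n)
    {m : ℝ} (hm : m = √(2 * (k ^ 2 - 1) * (L + 0.73 * D) / n) + 6.81 * k * √(2 * D / n))
    (hm6 : m < 1 / 6) :
    ∃ l r : ℝ, 0 < l ∧ 0 < r ∧ ∀ σ v : ℝ,
      (σ = 1 ∧ v = 1 - m / (1 - 2 * m) ∨ σ = -1 ∧ v = 1 + m / (1 - 2 * m)) →
      n * (σ * l * (v - 1) + l ^ 2 / 2 * (k ^ 2 * v ^ 2 - 2 * v + 1)
        + 46 * l ^ 2 * r ^ 2 * (k ^ 2 * D * v)
        + 67 * l ^ 2 * r ^ 4 * (k ^ 2 * D ^ 2)) + v / (2 * r ^ 2) + L < 0 := by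
  set A := L + 0.73 * D with hA
  have hApos : 0 < A := by positivity
  have hkm : 0 < k ^ 2 - 1 := by linarith
  have hkpos : 0 < k := hk0.lt_of_ne (by rintro rfl; norm_num at hk)
  have hnpos : (0 : ℝ) < n := lt_of_le_of_lt (sq_nonneg _) hn
  set s := √(n : ℝ) with hs
  have hspos : 0 < s := Real.sqrt_pos.2 hnpos
  have hs2 : s ^ 2 = n := Real.sq_sqrt hnpos.le
  set a := √(2 * (k ^ 2 - 1) * A / n) with ha
  set b := √(2 * D / n) with hb
  have ha2 : a ^ 2 = 2 * (k ^ 2 - 1) * A / n := Real.sq_sqrt (by positivity)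
  have hb2 : b ^ 2 = 2 * D / n := Real.sq_sqrt (by positivity)
  have hapos : 0 < a := Real.sqrt_pos.2 (by positivity)
  have hbpos : 0 < b := Real.sqrt_pos.2 (by positivity)
  have hmpos : 0 < m := by rw [hm]; positivity
  have has : √(2 * (k ^ 2 - 1) * A) = a * s := by
    rw [ha, hs, ← Real.sqrt_mul (by positivity), div_mul_cancel₀ _ hnpos.ne']
  have hDs : √D = b * s / √2 := by
    rw [hb, hs, ← Real.sqrt_mul (by positivity), div_mul_cancel₀ _ hnpos.ne',
      Real.sqrt_mul (by norm_num), mul_div_cancel_left₀ _ (by positivity)]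
  -- At v = 1 this l minimizes l(k² − 1)/2 + A/(n l), making both terms equal to a/2.
  set l := a / (k ^ 2 - 1) with hl
  have hlpos : 0 < l := div_pos hapos hkm
  have hla : l * (k ^ 2 - 1) = a := div_mul_cancel₀ _ hkm.ne'
  -- The sample size condition, after taking square roots and dividing by √n.
  have hthr : 20 * k * (b / √2) + 5 / 2 * a + l / 2 < 1 := by
    have h1 := lt_of_pow_lt_pow_left₀ 2 hspos.le (hs2.symm ▸ hn)
    rw [has, hDs] at h1
    have e : 20 * k * (b * s / √2) + (5 / 2 + 1 / (2 * (k ^ 2 - 1))) * (a * s)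
        = (20 * k * (b / √2) + 5 / 2 * a + l / 2) * s := by
      rw [hl]; field_simp; ring
    rw [e] at h1
    by_contra hge
    nlinarith [mul_le_mul_of_nonneg_right (not_lt.1 hge) hspos.le]
  have hsqrt2 : 20 * (1 / √2) ≥ 13.62 := by
    have h2 : √2 ≤ 1.4143 := Real.sqrt_le_iff.2 ⟨by norm_num, by norm_num⟩
    have h3 : 0 < √2 := by positivity
    rw [ge_iff_le, mul_one_div, le_div_iff₀ h3]
    nlinarith
  -- Here 2m = 2a + 13.62 k b and 20/√2 ≥ 13.62, so this follows from `hthr`.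
  have hθ : (a + l) / 2 < 1 - 2 * m := by
    have h1 : 13.62 * (k * b) ≤ 20 * k * (b / √2) := by
      have := mul_le_mul_of_nonneg_right hsqrt2 (by positivity : 0 ≤ k * b)
      calc _ ≤ _ := this
        _ = _ := by ring
    have h2 : m = a + 6.81 * (k * b) := by rw [hm]; ring
    rw [h2]
    linarith
  set q := √(23 * k ^ 2 * D / n) with hq
  have hq2 : q ^ 2 = 23 * k ^ 2 * D / n := Real.sq_sqrt (by positivity)
  have hqpos : 0 < q := Real.sqrt_pos.2 (by positivity)
  -- The constant 6.81 is chosen so that 4 · 23 = 92 is at most 2 · 6.81².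
  have hq_le : 2 * q ≤ 6.81 * k * b := by
    refine le_of_sq_le_sq ?_ (by positivity)
    rw [mul_pow, mul_pow, mul_pow, hq2, hb2]
    have e : 6.81 ^ 2 * k ^ 2 * (2 * D / n) = 92.7522 * (k ^ 2 * D / n) := by ring
    have e2 : (2 : ℝ) ^ 2 * (23 * k ^ 2 * D / n) = 92 * (k ^ 2 * D / n) := by ring
    rw [e, e2]
    have : 0 ≤ k ^ 2 * D / n := by positivity
    linarith
  set r := √(1 / (2 * n * l * q)) with hr
  have hr2 : r ^ 2 = 1 / (2 * n * l * q) := Real.sq_sqrt (by positivity)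
  have hr4 : r ^ 4 = (1 / (2 * n * l * q)) ^ 2 := by rw [← hr2]; ring
  refine ⟨l, r, hlpos, Real.sqrt_pos.2 (by positivity), ?_⟩
  set ρ := m / (1 - 2 * m) with hρ
  have h12 : 0 < 1 - 2 * m := by linarith
  have hρpos : 0 < ρ := div_pos hmpos h12
  have hρm : ρ * (1 - 2 * m) = m := div_mul_cancel₀ _ h12.ne'
  have hρ1 : ρ < 1 := by rw [hρ, div_lt_one h12]; linarith
  have hmab : m = a + 6.81 * k * b := hm
  have hAeq : A = n * l * (a / 2) := by
    have : A = a ^ 2 * n / (2 * (k ^ 2 - 1)) := by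
      rw [ha2]; field_simp
    rw [this, hl]; field_simp
  have hbound : ∀ σ v : ℝ, 0 ≤ v →
      n * (σ * l * (v - 1) + l ^ 2 / 2 * (k ^ 2 * v ^ 2 - 2 * v + 1)
        + 46 * l ^ 2 * r ^ 2 * (k ^ 2 * D * v)
        + 67 * l ^ 2 * r ^ 4 * (k ^ 2 * D ^ 2)) + v / (2 * r ^ 2) + L
      ≤ n * l * (σ * (v - 1) + l / 2 * (k ^ 2 * v ^ 2 - 2 * v + 1) + 6.81 * k * b * v + a / 2) := by
    intro σ v hv
    exact deviation_le hnpos hlpos hqpos (by linarith) hv (by rw [hq2]; field_simp) hr2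
      (hA ▸ hAeq) hq_le σ
  -- With 1 − 2m in place of (a + l)/2 this is the equality m(1 + 2ρ) = ρ, which defines ρ.
  have key : m * (1 + ρ) + (a + l) / 2 * ρ ^ 2 < ρ := by
    have h1 : (a + l) / 2 * ρ ^ 2 < (1 - 2 * m) * ρ ^ 2 :=
      mul_lt_mul_of_pos_right hθ (by positivity)
    have h2 : (1 - 2 * m) * ρ ^ 2 = m * ρ := by
      calc _ = ρ * (1 - 2 * m) * ρ := by ring
        _ = _ := by rw [hρm]
    linarith
  have hexp : ∀ v, l / 2 * (k ^ 2 * v ^ 2 - 2 * v + 1)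
      = a / 2 * v ^ 2 + l / 2 * (v - 1) ^ 2 := fun v => by rw [← hla]; ring
  have hτ : 0 < 6.81 * k * b := by positivity
  rw [hmab] at key
  have hcross : 0 < (a + 6.81 * k * b) * ρ := by positivity
  have hside : ∀ σ v : ℝ, (σ = 1 ∧ v = 1 - ρ ∨ σ = -1 ∧ v = 1 + ρ) → 0 ≤ v ∧
      σ * (v - 1) + l / 2 * (k ^ 2 * v ^ 2 - 2 * v + 1) + 6.81 * k * b * v + a / 2 < 0 := by
    rintro σ v (⟨rfl, rfl⟩ | ⟨rfl, rfl⟩)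
    · refine ⟨by linarith, ?_⟩
      rw [hexp]
      calc _ = (a + 6.81 * k * b) * (1 + ρ) + (a + l) / 2 * ρ ^ 2 - ρ
            - 2 * ((a + 6.81 * k * b) * ρ) := by ring
        _ < 0 := by linarith
    · refine ⟨by linarith, ?_⟩
      rw [hexp]
      calc _ = (a + 6.81 * k * b) * (1 + ρ) + (a + l) / 2 * ρ ^ 2 - ρ := by ring
        _ < 0 := by linarith
  intro σ v hσ
  obtain ⟨h1, h2⟩ := hside σ v hσ
  exact (hbound σ v h1).trans_lt (mul_neg_of_pos_of_neg (by positivity) h2)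

/-! ### Residuals as linear forms, and fourth moments of sums -/

/-- The residual `ξ Y - ⟨θ, X⟩` as a linear form in `(θ, ξ)`. -/
def resid {d : ℕ} (z : Couple d) : Couple d →ₗ[ℝ] ℝ where
  toFun v := v.2 * z.2 - inner ℝ v.1 z.1
  map_add' v w := by
    simp only [Prod.snd_add, Prod.fst_add, inner_add_left]; ring
  map_smul' c v := by
    simp only [Prod.smul_snd, Prod.smul_fst, real_inner_smul_left, smul_eq_mul, RingHom.id_apply]
    ring

lemma resid_apply {d : ℕ} (z v : Couple d) : resid z v = v.2 * z.2 - inner ℝ v.1 z.1 := rfl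

lemma secondMoment_resid {d : ℕ} (P : Measure (Couple d)) (θ : EuclideanSpace ℝ (Fin d)) (ξ : ℝ) :
    secondMoment P resid (θ, ξ) = energy P θ ξ := rfl

lemma energy_one {d : ℕ} (P : Measure (Couple d)) (θ : EuclideanSpace ℝ (Fin d)) :
    energy P θ 1 = risk P θ := by
  simp [energy, risk]

lemma measurable_resid {d : ℕ} (v : Couple d) : Measurable fun z : Couple d => resid z v := by
  simp only [resid_apply]
  fun_prop

lemma integrable_and_integral_le_of_lintegral_le {α : Type*} [MeasurableSpace α] {P : Measure α}
    {f : α → ℝ} (hf : Measurable f) (h0 : ∀ x, 0 ≤ f x) {c : ℝ} (hc : 0 ≤ c)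
    (h : ∫⁻ x, ENNReal.ofReal (f x) ∂P ≤ ENNReal.ofReal c) :
    Integrable f P ∧ ∫ x, f x ∂P ≤ c := by
  have hi : Integrable f P := by
    refine ⟨hf.aestronglyMeasurable, ?_⟩
    rw [hasFiniteIntegral_iff_ofReal (Filter.Eventually.of_forall h0)]
    exact h.trans_lt ENNReal.ofReal_lt_top
  refine ⟨hi, ?_⟩
  rw [← ofReal_integral_eq_lintegral_ofReal hi (Filter.Eventually.of_forall h0)] at h
  exact (ENNReal.ofReal_le_ofReal_iff hc).1 h

lemma add_sq_le_mul_add_div {x y p q : ℝ} (hp : 0 < p) (hq : 0 < q) :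
    (x + y) ^ 2 ≤ (p + q) * (x ^ 2 / p + y ^ 2 / q) := by
  have h : (p + q) * (x ^ 2 / p + y ^ 2 / q) - (x + y) ^ 2 = (q * x - p * y) ^ 2 / (p * q) := by
    field_simp; ring
  have : 0 ≤ (q * x - p * y) ^ 2 / (p * q) := by positivity
  linarith

lemma ae_eq_zero_of_integral_pow_four_nonpos {α : Type*} [MeasurableSpace α] {P : Measure α}
    {f : α → ℝ} (hf : Integrable (fun x => f x ^ 4) P) (h : ∫ x, f x ^ 4 ∂P ≤ 0) :
    ∀ᵐ x ∂P, f x = 0 := by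
  have h0 : ∀ x, 0 ≤ f x ^ 4 := fun x => by positivity
  have := (integral_eq_zero_iff_of_nonneg h0 hf).1 (le_antisymm h (integral_nonneg h0))
  filter_upwards [this] with x hx
  exact pow_eq_zero_iff four_ne_zero |>.1 hx

/-- A sum of two functions of kurtosis at most `c₁` and `c₂` has kurtosis at most
`(√c₁ + √c₂)²` if they are orthogonal. -/
lemma integral_add_pow_four_le {α : Type*} [MeasurableSpace α] {P : Measure α}
    {f g : α → ℝ} (hfm : Measurable f) (hgm : Measurable g)
    (hf : Integrable (fun x => f x ^ 4) P) (hg : Integrable (fun x => g x ^ 4) P)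
    {c₁ c₂ p q : ℝ} (hc₁ : 0 ≤ c₁) (hc₂ : 0 ≤ c₂) (hp : 0 ≤ p) (hq : 0 ≤ q)
    (hfp : ∫ x, f x ^ 4 ∂P ≤ c₂ * p ^ 2) (hgq : ∫ x, g x ^ 4 ∂P ≤ c₁ * q ^ 2) :
    Integrable (fun x => (f x + g x) ^ 4) P ∧
      ∫ x, (f x + g x) ^ 4 ∂P ≤ (√c₁ + √c₂) ^ 2 * (p + q) ^ 2 := by
  have hi : Integrable (fun x => (f x + g x) ^ 4) P := by
    refine Integrable.mono' ((hf.const_mul 8).add (hg.const_mul 8)) (by fun_prop)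
      (Filter.Eventually.of_forall fun x => ?_)
    change ‖(f x + g x) ^ 4‖ ≤ 8 * f x ^ 4 + 8 * g x ^ 4
    rw [Real.norm_of_nonneg (by positivity)]
    have h1 : (f x + g x) ^ 2 ≤ 2 * (f x ^ 2 + g x ^ 2) := by nlinarith [sq_nonneg (f x - g x)]
    have h2 := pow_le_pow_left₀ (sq_nonneg _) h1 2
    nlinarith [sq_nonneg (f x ^ 2 - g x ^ 2)]
  refine ⟨hi, ?_⟩
  have hk₁ := Real.sq_sqrt hc₁
  have hk₂ := Real.sq_sqrt hc₂
  have n₁ := Real.sqrt_nonneg c₁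
  have n₂ := Real.sqrt_nonneg c₂
  -- The weights used below must be positive; otherwise one of the two functions vanishes almost
  -- everywhere and the other one carries the bound.
  by_cases h2 : c₂ * p ^ 2 ≤ 0
  · have h0 := ae_eq_zero_of_integral_pow_four_nonpos hf (hfp.trans h2)
    have e : ∫ x, (f x + g x) ^ 4 ∂P = ∫ x, g x ^ 4 ∂P := by
      refine integral_congr_ae ?_
      filter_upwards [h0] with x hx
      rw [hx, zero_add]
    rw [e]
    refine hgq.trans (mul_le_mul ?_ ?_ (by positivity) (by positivity))
    · nlinarith [mul_nonneg n₁ n₂]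
    · nlinarith [mul_nonneg hp hq]
  by_cases h1 : c₁ * q ^ 2 ≤ 0
  · have h0 := ae_eq_zero_of_integral_pow_four_nonpos hg (hgq.trans h1)
    have e : ∫ x, (f x + g x) ^ 4 ∂P = ∫ x, f x ^ 4 ∂P := by
      refine integral_congr_ae ?_
      filter_upwards [h0] with x hx
      rw [hx, add_zero]
    rw [e]
    refine hfp.trans (mul_le_mul ?_ ?_ (by positivity) (by positivity))
    · nlinarith [mul_nonneg n₁ n₂]
    · nlinarith [mul_nonneg hp hq]
  have hc₂p : 0 < c₂ := hc₂.lt_of_ne (by rintro rfl; simp at h2)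
  have hpp : 0 < p := hp.lt_of_ne (by rintro rfl; simp at h2)
  have hc₁p : 0 < c₁ := hc₁.lt_of_ne (by rintro rfl; simp at h1)
  have hqp : 0 < q := hq.lt_of_ne (by rintro rfl; simp at h1)
  have m₁ := Real.sqrt_pos.2 hc₁p
  have m₂ := Real.sqrt_pos.2 hc₂p
  set K := (√c₁ + √c₂) ^ 2 * (p + q) with hK
  -- Cauchy–Schwarz twice, with weights √c₂, √c₁ on the functions and then p, q on their squares.
  have hpt : ∀ x, (f x + g x) ^ 4 ≤ K * (1 / (c₂ * p) * f x ^ 4 + 1 / (c₁ * q) * g x ^ 4) := by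
    intro x
    have s1 := add_sq_le_mul_add_div (x := f x) (y := g x) m₂ m₁
    have s2 := add_sq_le_mul_add_div (x := f x ^ 2 / √c₂) (y := g x ^ 2 / √c₁) hpp hqp
    calc (f x + g x) ^ 4 = ((f x + g x) ^ 2) ^ 2 := by ring
      _ ≤ ((√c₂ + √c₁) * (f x ^ 2 / √c₂ + g x ^ 2 / √c₁)) ^ 2 :=
          pow_le_pow_left₀ (sq_nonneg _) s1 2
      _ = (√c₁ + √c₂) ^ 2 * (f x ^ 2 / √c₂ + g x ^ 2 / √c₁) ^ 2 := by ring
      _ ≤ (√c₁ + √c₂) ^ 2 * ((p + q) * ((f x ^ 2 / √c₂) ^ 2 / p + (g x ^ 2 / √c₁) ^ 2 / q)) := by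
          gcongr
      _ = _ := by
          rw [div_pow, div_pow, hk₁, hk₂, hK]
          field_simp
  have hint := ((hf.const_mul (1 / (c₂ * p))).add (hg.const_mul (1 / (c₁ * q)))).const_mul K
  calc ∫ x, (f x + g x) ^ 4 ∂P
      ≤ ∫ x, K * (1 / (c₂ * p) * f x ^ 4 + 1 / (c₁ * q) * g x ^ 4) ∂P :=
        integral_mono hi hint hpt
    _ = K * (1 / (c₂ * p) * ∫ x, f x ^ 4 ∂P + 1 / (c₁ * q) * ∫ x, g x ^ 4 ∂P) := by
        rw [integral_const_mul, integral_add (hf.const_mul _) (hg.const_mul _),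
          integral_const_mul, integral_const_mul]
    _ ≤ K * (1 / (c₂ * p) * (c₂ * p ^ 2) + 1 / (c₁ * q) * (c₁ * q ^ 2)) := by
        gcongr
    _ = _ := by
        rw [hK]; field_simp

end

end RobustLS

/-! ### Least squares: kurtosis of the residuals and excess risk -/

namespace RobustLS

noncomputable section

section Kurtosis

variable {d : ℕ} {P : Measure (Couple d)}

lemma integrable_inner_fst_sq (hX : MemLp (fun z : Couple d => z.1) 2 P)
    (w : EuclideanSpace ℝ (Fin d)) : Integrable (fun z : Couple d => inner ℝ w z.1 ^ 2) P :=
  (hX.const_inner w).integrable_sq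

lemma memLp_residual (hX : MemLp (fun z : Couple d => z.1) 2 P)
    (hY : MemLp (fun z : Couple d => z.2) 2 P) (θ : EuclideanSpace ℝ (Fin d)) :
    MemLp (fun z : Couple d => z.2 - inner ℝ θ z.1) 2 P :=
  hY.sub (hX.const_inner θ)

/-- The fourth moments of the linear functionals of the design. -/
lemma integral_inner_pow_four_le (hX : MemLp (fun z : Couple d => z.1) 2 P) {κ₁ : ℝ}
    (hκ : 0 ≤ κ₁) (h : kurtosisDesign P ≤ ENNReal.ofReal κ₁) (w : EuclideanSpace ℝ (Fin d)) :
    Integrable (fun z : Couple d => inner ℝ w z.1 ^ 4) P ∧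
      ∫ z, inner ℝ w z.1 ^ 4 ∂P ≤ κ₁ * (∫ z, inner ℝ w z.1 ^ 2 ∂P) ^ 2 := by
  have hi := integrable_inner_fst_sq hX w
  have h0 : ∀ z : Couple d, 0 ≤ inner ℝ w z.1 ^ 2 := fun z => sq_nonneg _
  set M := ∫ z, inner ℝ w z.1 ^ 2 ∂P with hM
  have hM0 : 0 ≤ M := integral_nonneg h0
  rcases hM0.eq_or_lt with hz | hpos
  · have hae := (integral_eq_zero_iff_of_nonneg h0 hi).1 hz.symm
    have hae4 : (fun z : Couple d => inner ℝ w z.1 ^ 4) =ᵐ[P] fun _ => 0 := by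
      filter_upwards [hae] with z hz'
      have : inner ℝ w z.1 = 0 := pow_eq_zero_iff two_ne_zero |>.1 hz'
      rw [this]; norm_num
    refine ⟨(integrable_congr hae4).2 (integrable_zero _ _ _), ?_⟩
    rw [integral_congr_ae hae4, ← hz]
    simp
  · set c := (√M)⁻¹ with hc
    have hc2 : c ^ 2 = M⁻¹ := by rw [hc, inv_pow, Real.sq_sqrt hM0]
    have hc4 : c ^ 4 = (M⁻¹) ^ 2 := by rw [← hc2]; ring
    have h1 : ∫⁻ z, ENNReal.ofReal (inner ℝ (c • w) z.1 ^ 2) ∂P ≤ 1 := by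
      have e : ∀ z : Couple d, inner ℝ (c • w) z.1 ^ 2 = M⁻¹ * inner ℝ w z.1 ^ 2 := fun z => by
        rw [real_inner_smul_left, mul_pow, hc2]
      simp only [e]
      rw [← ofReal_integral_eq_lintegral_ofReal (hi.const_mul _)
        (Filter.Eventually.of_forall fun z => mul_nonneg (inv_nonneg.2 hM0) (h0 z)),
        integral_const_mul, ← hM, inv_mul_cancel₀ hpos.ne', ENNReal.ofReal_one]
    have h2 : ∫⁻ z, ENNReal.ofReal (inner ℝ (c • w) z.1 ^ 4) ∂P ≤ ENNReal.ofReal κ₁ :=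
      (le_iSup₂ (f := fun (θ : EuclideanSpace ℝ (Fin d))
        (_ : ∫⁻ z, ENNReal.ofReal (inner ℝ θ z.1 ^ 2) ∂P ≤ 1) =>
        ∫⁻ z, ENNReal.ofReal (inner ℝ θ z.1 ^ 4) ∂P) (c • w) h1).trans h
    obtain ⟨h3, h4⟩ := integrable_and_integral_le_of_lintegral_le
      (f := fun z : Couple d => inner ℝ (c • w) z.1 ^ 4) (by fun_prop)
      (fun z => by positivity) hκ h2
    have e : ∀ z : Couple d, inner ℝ (c • w) z.1 ^ 4 = (M⁻¹) ^ 2 * inner ℝ w z.1 ^ 4 := fun z => by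
      rw [real_inner_smul_left, mul_pow, hc4]
    simp only [e] at h3 h4
    have hne : (M⁻¹) ^ 2 ≠ 0 := by positivity
    refine ⟨(integrable_const_mul_iff (isUnit_iff_ne_zero.2 hne) _).1 h3, ?_⟩
    rw [integral_const_mul, inv_pow, inv_mul_le_iff₀ (by positivity)] at h4
    linarith

lemma integral_residual_pow_four_le (hX : MemLp (fun z : Couple d => z.1) 2 P)
    (hY : MemLp (fun z : Couple d => z.2) 2 P) {κ₂ : ℝ} (hκ : 0 ≤ κ₂)
    {θ : EuclideanSpace ℝ (Fin d)} (h : kurtosisNoise P θ ≤ ENNReal.ofReal κ₂) :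
    Integrable (fun z : Couple d => (z.2 - inner ℝ θ z.1) ^ 4) P ∧
      ∫ z, (z.2 - inner ℝ θ z.1) ^ 4 ∂P ≤ κ₂ * risk P θ ^ 2 := by
  have hi : Integrable (fun z : Couple d => (z.2 - inner ℝ θ z.1) ^ 2) P :=
    (memLp_residual hX hY θ).integrable_sq
  have h0 : ∀ z : Couple d, 0 ≤ (z.2 - inner ℝ θ z.1) ^ 2 := fun z => sq_nonneg _
  have hR0 : 0 ≤ risk P θ := integral_nonneg h0
  by_cases hpos : 0 < risk P θ
  · rw [kurtosisNoise, if_pos hpos, ENNReal.div_le_iff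
      (by rw [ne_eq, ENNReal.ofReal_eq_zero, not_le]; positivity) ENNReal.ofReal_ne_top,
      ← ENNReal.ofReal_mul hκ] at h
    exact integrable_and_integral_le_of_lintegral_le (by fun_prop) (fun z => by positivity)
      (by positivity) h
  · have hz : risk P θ = 0 := le_antisymm (not_lt.1 hpos) hR0
    have hae := (integral_eq_zero_iff_of_nonneg h0 hi).1 hz
    have hae4 : (fun z : Couple d => (z.2 - inner ℝ θ z.1) ^ 4) =ᵐ[P] fun _ => 0 := by
      filter_upwards [hae] with z hz'
      have : z.2 - inner ℝ θ z.1 = 0 := pow_eq_zero_iff two_ne_zero |>.1 hz'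
      rw [this]; norm_num
    refine ⟨(integrable_congr hae4).2 (integrable_zero _ _ _), ?_⟩
    rw [integral_congr_ae hae4, hz]
    simp

variable {θstar : EuclideanSpace ℝ (Fin d)}

lemma integral_residual_mul_inner_eq_zero (hX : MemLp (fun z : Couple d => z.1) 2 P)
    (hY : MemLp (fun z : Couple d => z.2) 2 P) (hmin : ∀ θ, risk P θstar ≤ risk P θ)
    (w : EuclideanSpace ℝ (Fin d)) :
    ∫ z, (z.2 - inner ℝ θstar z.1) * inner ℝ w z.1 ∂P = 0 := by
  have hr := memLp_residual hX hY θstar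
  have hw := hX.const_inner (𝕜 := ℝ) w
  have i1 := hr.integrable_sq
  have i2 : Integrable (fun z : Couple d => (z.2 - inner ℝ θstar z.1) * inner ℝ w z.1) P :=
    hr.integrable_mul hw
  have i3 := hw.integrable_sq
  set c := ∫ z, (z.2 - inner ℝ θstar z.1) * inner ℝ w z.1 ∂P with hc
  set M := ∫ z, inner ℝ w z.1 ^ 2 ∂P with hM
  have hM0 : 0 ≤ M := integral_nonneg fun z => sq_nonneg _
  have hexp : ∀ t : ℝ, risk P (θstar + t • w) = risk P θstar - 2 * t * c + t ^ 2 * M := fun t => by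
    have e : ∀ z : Couple d, (z.2 - inner ℝ (θstar + t • w) z.1) ^ 2
        = (z.2 - inner ℝ θstar z.1) ^ 2
          - 2 * t * ((z.2 - inner ℝ θstar z.1) * inner ℝ w z.1)
          + t ^ 2 * inner ℝ w z.1 ^ 2 := fun z => by
      rw [inner_add_left, real_inner_smul_left]; ring
    have h1 := integral_add (i1.sub (i2.const_mul (2 * t))) (i3.const_mul (t ^ 2))
    have h2 := integral_sub i1 (i2.const_mul (2 * t))
    simp only [Pi.sub_apply, integral_const_mul] at h1 h2
    unfold risk
    simp only [e]
    rw [h1, h2]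
  -- The optimal step would be c/M; the added 1 covers M = 0 and still decreases the risk unless c =
  -- 0.
  have h1 := hmin (θstar + (c / (M + 1)) • w)
  rw [hexp] at h1
  have hM1 : 0 < M + 1 := by linarith
  have h2 : 2 * (c / (M + 1)) * c - (c / (M + 1)) ^ 2 * M
      = c ^ 2 * (M + 2) / (M + 1) ^ 2 := by
    field_simp; ring
  have h3 : c ^ 2 * (M + 2) / (M + 1) ^ 2 ≤ 0 := by linarith
  have h4 : c ^ 2 * (M + 2) ≤ 0 := by
    rw [div_le_iff₀ (by positivity)] at h3; linarith
  have h5 : c ^ 2 = 0 := by nlinarith [sq_nonneg c]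
  exact pow_eq_zero_iff two_ne_zero |>.1 h5

/-- Pythagoras' identity for the energy around a minimizer of the risk. -/
lemma energy_eq (hX : MemLp (fun z : Couple d => z.1) 2 P)
    (hY : MemLp (fun z : Couple d => z.2) 2 P) (hmin : ∀ θ, risk P θstar ≤ risk P θ)
    (w : EuclideanSpace ℝ (Fin d)) (ξ : ℝ) :
    energy P (ξ • θstar + w) ξ = ξ ^ 2 * risk P θstar + ∫ z, inner ℝ w z.1 ^ 2 ∂P := by
  have hr := memLp_residual hX hY θstar
  have hw := hX.const_inner (𝕜 := ℝ) w
  have i1 := hr.integrable_sq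
  have i2 : Integrable (fun z : Couple d => (z.2 - inner ℝ θstar z.1) * inner ℝ w z.1) P :=
    hr.integrable_mul hw
  have i3 := hw.integrable_sq
  have e : ∀ z : Couple d, (ξ * z.2 - inner ℝ (ξ • θstar + w) z.1) ^ 2
      = ξ ^ 2 * (z.2 - inner ℝ θstar z.1) ^ 2
        - 2 * ξ * ((z.2 - inner ℝ θstar z.1) * inner ℝ w z.1) + inner ℝ w z.1 ^ 2 := fun z => by
    rw [inner_add_left, real_inner_smul_left]; ring
  have h1 := integral_add ((i1.const_mul (ξ ^ 2)).sub (i2.const_mul (2 * ξ))) i3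
  have h2 := integral_sub (i1.const_mul (ξ ^ 2)) (i2.const_mul (2 * ξ))
  simp only [Pi.sub_apply, integral_const_mul] at h1 h2
  unfold energy risk
  simp only [e]
  rw [h1, h2, integral_residual_mul_inner_eq_zero hX hY hmin]
  ring

/-- The kurtosis of the residuals in all directions `(θ, ξ)` is at most `(√κ₁ + √κ₂)²`. -/
theorem kurtosisBound_resid (hX : MemLp (fun z : Couple d => z.1) 2 P)
    (hY : MemLp (fun z : Couple d => z.2) 2 P) (hmin : ∀ θ, risk P θstar ≤ risk P θ) {κ₁ κ₂ : ℝ}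
    (hκ₁ : 0 ≤ κ₁) (hκ₂ : 0 ≤ κ₂) (h₁ : kurtosisDesign P ≤ ENNReal.ofReal κ₁)
    (h₂ : kurtosisNoise P θstar ≤ ENNReal.ofReal κ₂) :
    KurtosisBound P resid (kurt κ₁ κ₂) := by
  have key : ∀ v : Couple d, Integrable (fun z => resid z v ^ 4) P ∧
      ∫ z, resid z v ^ 4 ∂P ≤ kurt κ₁ κ₂ * secondMoment P resid v ^ 2 := by
    rintro ⟨θ, ξ⟩
    set w := θ - ξ • θstar with hw
    have hθ : θ = ξ • θstar + w := by rw [hw]; abel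
    obtain ⟨a1, a2⟩ := integral_residual_pow_four_le hX hY hκ₂ h₂
    obtain ⟨b1, b2⟩ := integral_inner_pow_four_le hX hκ₁ h₁ (-w)
    have e : ∀ z : Couple d, resid z (θ, ξ)
        = ξ * (z.2 - inner ℝ θstar z.1) + inner ℝ (-w) z.1 := fun z => by
      rw [resid_apply, hθ, inner_add_left, real_inner_smul_left, inner_neg_left]; ring
    have hM : ∫ z, inner ℝ (-w) z.1 ^ 2 ∂P = ∫ z, inner ℝ w z.1 ^ 2 ∂P := by
      simp only [inner_neg_left, neg_sq]
    have c1 : ∀ z : Couple d, (ξ * (z.2 - inner ℝ θstar z.1)) ^ 4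
        = ξ ^ 4 * (z.2 - inner ℝ θstar z.1) ^ 4 := fun z => mul_pow _ _ _
    have hsec : secondMoment P resid (θ, ξ)
        = ξ ^ 2 * risk P θstar + ∫ z, inner ℝ (-w) z.1 ^ 2 ∂P := by
      rw [secondMoment_resid, hM, ← energy_eq hX hY hmin w ξ, ← hθ]
    have := integral_add_pow_four_le (f := fun z : Couple d => ξ * (z.2 - inner ℝ θstar z.1))
      (g := fun z : Couple d => inner ℝ (-w) z.1) (by fun_prop) (by fun_prop)
      (by simp only [c1]; exact a1.const_mul _) b1 (p := ξ ^ 2 * risk P θstar)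
      (q := ∫ z, inner ℝ (-w) z.1 ^ 2 ∂P) hκ₁ hκ₂
      (mul_nonneg (sq_nonneg _) (integral_nonneg fun z => sq_nonneg _))
      (integral_nonneg fun z => sq_nonneg _)
      (by
        simp only [c1]
        rw [integral_const_mul]
        calc _ ≤ ξ ^ 4 * (κ₂ * risk P θstar ^ 2) := by gcongr
          _ = _ := by ring) b2
    rw [hsec]
    simp only [e]
    exact this
  exact ⟨measurable_resid, fun v => (key v).1, fun v => (key v).2⟩

/-- The excess risk of a minimizer of a quadratic form close to the energy. -/
theorem risk_sub_le (hX : MemLp (fun z : Couple d => z.1) 2 P)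
    (hY : MemLp (fun z : Couple d => z.2) 2 P) (hmin : ∀ θ, risk P θstar ≤ risk P θ)
    {Q : QuadraticForm ℝ (Couple d)} {δ : ℝ} (hδ0 : 0 < δ) (hδ1 : δ < 1)
    (hQ : ∀ (θ : EuclideanSpace ℝ (Fin d)) (ξ : ℝ),
      |Q (θ, ξ) - energy P θ ξ| ≤ δ * energy P θ ξ)
    {θhat : EuclideanSpace ℝ (Fin d)} (hhat : ∀ θ, Q (θhat, 1) ≤ Q (θ, 1)) :
    risk P θhat - risk P θstar ≤ δ ^ 2 / (1 - δ) ^ 2 * risk P θstar := by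
  set w := θhat - θstar with hw
  set M := ∫ z, inner ℝ w z.1 ^ 2 ∂P with hM
  have hM0 : 0 ≤ M := integral_nonneg fun z => sq_nonneg _
  have hMt : ∀ t : ℝ, ∫ z, inner ℝ (t • w) z.1 ^ 2 ∂P = t ^ 2 * M := fun t => by
    rw [hM, ← integral_const_mul]
    simp only [real_inner_smul_left, mul_pow]
  have hN : ∀ t : ℝ, energy P (θstar + t • w) 1 = risk P θstar + t ^ 2 * M := fun t => by
    have := energy_eq hX hY hmin (t • w) 1
    rw [one_smul, hMt] at this
    rw [this]; ring
  have hN0 : energy P w 0 = M := by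
    have := energy_eq hX hY hmin w 0
    rw [zero_smul, zero_add] at this
    rw [this]; ring
  have hrisk : risk P θhat - risk P θstar = M := by
    have := hN 1
    rw [one_smul, hw, add_sub_cancel, energy_one] at this
    rw [this]; ring
  set q := Q (w, 0) with hq
  set β := QuadraticMap.polar Q (θstar, 1) (w, 0) with hβ
  have hQt : ∀ t : ℝ, Q (θstar + t • w, 1) = Q (θstar, 1) + t * β + t ^ 2 * q := fun t => by
    have e : ((θstar + t • w, 1) : Couple d) = (θstar, 1) + t • (w, 0) := by
      ext <;> simp
    rw [e, QuadraticMap.map_add Q, QuadraticMap.map_smul, QuadraticMap.polar_smul_right,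
      smul_eq_mul, smul_eq_mul]
    ring
  -- Along the line, the estimated form is a quadratic polynomial in t minimized at t = 1, so its
  -- derivative there vanishes. The test step −g/(|q| + 1) is short enough for the linear term to
  -- dominate.
  have hβq : β = -2 * q := by
    have h1 : ∀ s : ℝ, 0 ≤ s * (2 * q + β + q * s) := fun s => by
      have h2 := hhat (θstar + (1 + s) • w)
      have h3 := hQt 1
      rw [one_smul, hw, add_sub_cancel] at h3
      rw [hQt, h3] at h2
      nlinarith
    have h2 : 2 * q + β = 0 := by
      set g := 2 * q + β with hg
      have h3 := h1 (-g / (|q| + 1))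
      have hpos : 0 < |q| + 1 := by positivity
      have e : -g / (|q| + 1) * (g + q * (-g / (|q| + 1)))
          = -(g ^ 2 * (|q| + 1 - q)) / (|q| + 1) ^ 2 := by
        field_simp; ring
      rw [e, le_div_iff₀ (by positivity)] at h3
      have h4 : 1 ≤ |q| + 1 - q := by linarith [le_abs_self q]
      have h5 : g ^ 2 = 0 := by nlinarith [sq_nonneg g]
      exact pow_eq_zero_iff two_ne_zero |>.1 h5
    linarith
  have hqM : (1 - δ) * M ≤ q := by
    have := (abs_le.1 (hQ w 0)).1
    rw [hN0] at this
    linarith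
  -- This value maximizes 2t(1 − δ)M − δt²M. Subtracting the bounds at t and −t cancels all even
  -- terms of Q, leaving 2tq ≤ δ(R(θ_*) + t²M).
  set t := (1 - δ) / δ with ht
  have h1δ : 0 < 1 - δ := by linarith
  have ht0 : 0 < t := div_pos h1δ hδ0
  have hup := (abs_le.1 (hQ (θstar + t • w) 1)).1
  have hdown := (abs_le.1 (hQ (θstar + (-t) • w) 1)).2
  rw [hQt, hN, hβq] at hup hdown
  have hmain : 2 * t * q ≤ δ * (risk P θstar + t ^ 2 * M) := by nlinarith
  have h3 : 2 * t * ((1 - δ) * M) ≤ δ * (risk P θstar + t ^ 2 * M) :=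
    (mul_le_mul_of_nonneg_left hqM (by positivity)).trans hmain
  have htδ : t * δ = 1 - δ := div_mul_cancel₀ _ hδ0.ne'
  have h4 : (1 - δ) ^ 2 * M ≤ δ ^ 2 * risk P θstar := by
    have h5 := mul_le_mul_of_nonneg_left h3 hδ0.le
    have e1 : δ * (2 * t * ((1 - δ) * M)) = 2 * ((1 - δ) ^ 2 * M) := by
      calc _ = 2 * (t * δ) * ((1 - δ) * M) := by ring
        _ = _ := by rw [htδ]; ring
    have e2 : δ * (δ * (risk P θstar + t ^ 2 * M)) = δ ^ 2 * risk P θstar + (1 - δ) ^ 2 * M := by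
      calc _ = δ ^ 2 * risk P θstar + (t * δ) ^ 2 * M := by ring
        _ = _ := by rw [htδ]
    rw [e1, e2] at h5
    linarith
  rw [hrisk, div_mul_eq_mul_div, le_div_iff₀ (by positivity)]
  linarith

end Kurtosis

/-! ### Orders of magnitude of δ and of the threshold -/

section Bounds

variable {d n : ℕ} {ε κ₁ κ₂ : ℝ}

lemma mu_nonneg : 0 ≤ mu d n ε κ₁ κ₂ := by
  have h1 := Real.sqrt_nonneg κ₁
  have h2 := Real.sqrt_nonneg κ₂
  unfold mu
  positivity

/-- Positivity of δ excludes the degenerate values of the quotient: it vanishes if μ = 0 and is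
nonpositive if 1 − 4μ ≤ 0. -/
lemma mu_pos_and_lt (h0 : 0 < delta d n ε κ₁ κ₂) (h1 : delta d n ε κ₁ κ₂ < 1) :
    0 < mu d n ε κ₁ κ₂ ∧ mu d n ε κ₁ κ₂ < 1 / 6 := by
  have hm := mu_nonneg (d := d) (n := n) (ε := ε) (κ₁ := κ₁) (κ₂ := κ₂)
  unfold delta at h0 h1
  set m := mu d n ε κ₁ κ₂
  have hmpos : 0 < m := hm.lt_of_ne (by rintro h; rw [← h] at h0; simp at h0)
  have h4 : 0 < 1 - 4 * m := by
    by_contra hneg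
    exact absurd h0 (not_lt.2 (div_nonpos_of_nonneg_of_nonpos (by linarith) (not_lt.1 hneg)))
  rw [div_lt_one h4] at h1
  exact ⟨hmpos, by linarith⟩

lemma kurt_le (hκ₁ : 0 ≤ κ₁) (hκ₂ : 0 ≤ κ₂) : kurt κ₁ κ₂ ≤ 2 * (κ₁ + κ₂) := by
  unfold kurt
  nlinarith [Real.sq_sqrt hκ₁, Real.sq_sqrt hκ₂, sq_nonneg (√κ₁ - √κ₂)]

theorem delta_sq_le (hd : 1 ≤ d) (hε : 0 < ε) (hε1 : ε ≤ 1) (hκ₁ : 0 ≤ κ₁) (hκ₂ : 0 ≤ κ₂)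
    (hk : 1 < kurt κ₁ κ₂) (h0 : 0 < delta d n ε κ₁ κ₂) (h1 : delta d n ε κ₁ κ₂ < 1) :
    delta d n ε κ₁ κ₂ ^ 2 ≤ 60000 * ((κ₁ + κ₂) * (d + Real.log ε⁻¹) / n) := by
  obtain ⟨hm, hm6⟩ := mu_pos_and_lt h0 h1
  have hL : 0 ≤ Real.log ε⁻¹ := Real.log_nonneg ((one_le_inv₀ hε).2 hε1)
  have hd1 : (1 : ℝ) ≤ d := by exact_mod_cast hd
  have hκ := kurt_le hκ₁ hκ₂
  set L := Real.log ε⁻¹ with hLdef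
  set K := kurt κ₁ κ₂ with hK
  -- Since μ < 1/6, the denominator 1 − 4μ exceeds 1/3.
  have hδ : delta d n ε κ₁ κ₂ ≤ 6 * mu d n ε κ₁ κ₂ := by
    unfold delta
    rw [div_le_iff₀ (by linarith)]
    nlinarith
  have ha : √(2 * (K - 1) * (L + 0.73 * ((d : ℝ) + 1)) / n) ^ 2
      = 2 * (K - 1) * (L + 0.73 * ((d : ℝ) + 1)) / n := Real.sq_sqrt (by
    have : 0 < K - 1 := by linarith
    positivity)
  have hb : (6.81 * (√κ₁ + √κ₂) * √(2 * ((d : ℝ) + 1) / n)) ^ 2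
      = 6.81 ^ 2 * K * (2 * ((d : ℝ) + 1) / n) := by
    rw [mul_pow, mul_pow, Real.sq_sqrt (by positivity), hK, kurt]
  have hmu : mu d n ε κ₁ κ₂ ^ 2 ≤ 2 * (2 * (K - 1) * (L + 0.73 * ((d : ℝ) + 1)) / n)
      + 2 * (6.81 ^ 2 * K * (2 * ((d : ℝ) + 1) / n)) := by
    rw [← ha, ← hb, mu]
    nlinarith [sq_nonneg (√(2 * (K - 1) * (L + 0.73 * ((d : ℝ) + 1)) / n)
      - 6.81 * (√κ₁ + √κ₂) * √(2 * ((d : ℝ) + 1) / n))]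
  have hnum : 36 * (2 * (2 * (K - 1) * (L + 0.73 * ((d : ℝ) + 1)))
      + 2 * (6.81 ^ 2 * K * (2 * ((d : ℝ) + 1))))
      ≤ 60000 * ((κ₁ + κ₂) * (d + L)) := by
    have hS : 0 ≤ κ₁ + κ₂ := by positivity
    have e1 : (K - 1) * (L + 0.73 * ((d : ℝ) + 1)) ≤ 2 * (κ₁ + κ₂) * (1.46 * (d + L)) :=
      mul_le_mul (by linarith) (by linarith) (by positivity) (by positivity)
    have e2 : K * ((d : ℝ) + 1) ≤ 2 * (κ₁ + κ₂) * (2 * (d + L)) :=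
      mul_le_mul hκ (by linarith) (by positivity) (by positivity)
    have e3 : 0 ≤ (κ₁ + κ₂) * (d + L) := by positivity
    nlinarith
  calc delta d n ε κ₁ κ₂ ^ 2 ≤ (6 * mu d n ε κ₁ κ₂) ^ 2 := pow_le_pow_left₀ h0.le hδ 2
    _ = 36 * mu d n ε κ₁ κ₂ ^ 2 := by ring
    _ ≤ 36 * (2 * (2 * (K - 1) * (L + 0.73 * ((d : ℝ) + 1)) / n)
      + 2 * (6.81 ^ 2 * K * (2 * ((d : ℝ) + 1) / n))) := by gcongr
    _ = (36 * (2 * (2 * (K - 1) * (L + 0.73 * ((d : ℝ) + 1)))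
      + 2 * (6.81 ^ 2 * K * (2 * ((d : ℝ) + 1))))) / n := by ring
    _ ≤ 60000 * ((κ₁ + κ₂) * (d + L)) / n := by gcongr
    _ = _ := by ring

theorem threshold_le {κ₀ : ℝ} (hκ₀ : 1 < κ₀) (hd : 1 ≤ d) (hε : 0 < ε) (hε1 : ε ≤ 1)
    (hκ₁ : 0 ≤ κ₁) (hκ₂ : 0 ≤ κ₂) (hk : κ₀ ≤ kurt κ₁ κ₂) :
    threshold d ε κ₁ κ₂
      ≤ (3200 + 12 * (5 / 2 + 1 / (2 * (κ₀ - 1))) ^ 2) * ((κ₁ + κ₂) * (d + Real.log ε⁻¹)) := by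
  have hL : 0 ≤ Real.log ε⁻¹ := Real.log_nonneg ((one_le_inv₀ hε).2 hε1)
  have hd1 : (1 : ℝ) ≤ d := by exact_mod_cast hd
  have hκ := kurt_le hκ₁ hκ₂
  unfold threshold
  set L := Real.log ε⁻¹ with hLdef
  have hK2 : (√κ₁ + √κ₂) ^ 2 = kurt κ₁ κ₂ := rfl
  set K := kurt κ₁ κ₂ with hK
  have hK1 : 0 < K - 1 := by linarith
  have hc : 5 / 2 + 1 / (2 * (K - 1)) ≤ 5 / 2 + 1 / (2 * (κ₀ - 1)) := by
    have : 0 < κ₀ - 1 := by linarith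
    gcongr
  set c := 5 / 2 + 1 / (2 * (K - 1)) with hcdef
  set c₀ := 5 / 2 + 1 / (2 * (κ₀ - 1)) with hc₀
  have hc0 : 0 ≤ c := by rw [hcdef]; positivity
  have ha : (20 * (√κ₁ + √κ₂) * √((d : ℝ) + 1)) ^ 2 = 400 * (K * ((d : ℝ) + 1)) := by
    rw [mul_pow, mul_pow, Real.sq_sqrt (by positivity), hK2]; ring
  have hb : (c * √(2 * (K - 1) * (L + 0.73 * ((d : ℝ) + 1)))) ^ 2
      = c ^ 2 * (2 * ((K - 1) * (L + 0.73 * ((d : ℝ) + 1)))) := by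
    rw [mul_pow, Real.sq_sqrt (by positivity)]; ring
  have hS : 0 ≤ κ₁ + κ₂ := by positivity
  have e1 : (K - 1) * (L + 0.73 * ((d : ℝ) + 1)) ≤ 2 * (κ₁ + κ₂) * (1.46 * (d + L)) :=
    mul_le_mul (by linarith) (by linarith) (by positivity) (by positivity)
  have e2 : K * ((d : ℝ) + 1) ≤ 2 * (κ₁ + κ₂) * (2 * (d + L)) :=
    mul_le_mul hκ (by linarith) (by positivity) (by positivity)
  have hsum : ∀ x y : ℝ, (x + y) ^ 2 ≤ 2 * x ^ 2 + 2 * y ^ 2 := fun x y => by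
    nlinarith [sq_nonneg (x - y)]
  have e3 : 0 ≤ (κ₁ + κ₂) * (d + L) := by positivity
  have hcsq : c ^ 2 ≤ c₀ ^ 2 := pow_le_pow_left₀ hc0 hc 2
  calc _ ≤ 2 * (20 * (√κ₁ + √κ₂) * √((d : ℝ) + 1)) ^ 2
        + 2 * (c * √(2 * (K - 1) * (L + 0.73 * ((d : ℝ) + 1)))) ^ 2 := hsum _ _
    _ = 800 * (K * ((d : ℝ) + 1)) + 4 * c ^ 2 * ((K - 1) * (L + 0.73 * ((d : ℝ) + 1))) := by
        rw [ha, hb]; ring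
    _ ≤ 800 * (2 * (κ₁ + κ₂) * (2 * (d + L)))
        + 4 * c₀ ^ 2 * (2 * (κ₁ + κ₂) * (1.46 * (d + L))) := by gcongr
    _ = (3200 + 11.68 * c₀ ^ 2) * ((κ₁ + κ₂) * (d + L)) := by ring
    _ ≤ _ := by
        refine mul_le_mul_of_nonneg_right ?_ e3
        nlinarith [sq_nonneg c₀]

end Bounds

/-! ### Assembly of the estimator and of the theorem -/

/-- Existence of the estimator. -/
theorem exists_estimator {d n : ℕ} {ε κ₁ κ₂ : ℝ} (hε : 0 < ε)
    (hk : 1 < kurt κ₁ κ₂) (hn : threshold d ε κ₁ κ₂ < n) (hδ0 : 0 < delta d n ε κ₁ κ₂)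
    (hδ1 : delta d n ε κ₁ κ₂ < 1) :
    ∃ N : (Fin n → Couple d) → QuadraticForm ℝ (Couple d),
      (∀ v : Couple d, Measurable fun z => N z v) ∧
      ∀ (P : Measure (Couple d)) [IsProbabilityMeasure P],
        KurtosisBound P resid (kurt κ₁ κ₂) →
        ∃ B : Set (Fin n → Couple d), MeasurableSet B ∧
          ENNReal.ofReal (1 - 2 * ε) ≤ Measure.pi (fun _ : Fin n => P) B ∧
          ∀ z ∈ B, ∀ (θ : EuclideanSpace ℝ (Fin d)) (ξ : ℝ),
            |N z (θ, ξ) - energy P θ ξ| ≤ delta d n ε κ₁ κ₂ * energy P θ ξ := by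
  -- For ε ≥ 1 the required probability is nonpositive, and the empty event suffices; otherwise log
  -- ε⁻¹ ≥ 0, as the tuning requires.
  rcases le_total 1 ε with hε1 | hε1
  · refine ⟨fun _ => 0, fun v => by simp, fun P _ _ => ⟨∅, MeasurableSet.empty, ?_, by simp⟩⟩
    rw [ENNReal.ofReal_of_nonpos (by linarith)]
    exact zero_le
  obtain ⟨hm, hm6⟩ := mu_pos_and_lt hδ0 hδ1
  set m := mu d n ε κ₁ κ₂ with hmdef
  set δ := delta d n ε κ₁ κ₂ with hδ
  have hδm : δ * (1 - 4 * m) = 2 * m := by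
    rw [hδ, delta, ← hmdef]; exact div_mul_cancel₀ _ (by linarith)
  have hL : 0 ≤ Real.log ε⁻¹ := Real.log_nonneg ((one_le_inv₀ hε).2 hε1)
  have hsum0 : 0 ≤ √κ₁ + √κ₂ := by positivity
  obtain ⟨l, r, hl, hr, hdev⟩ := exists_tuning (k := √κ₁ + √κ₂) (D := (d : ℝ) + 1)
    (L := Real.log ε⁻¹) hk hsum0 (by linarith [Nat.cast_nonneg (α := ℝ) d]) hL hn hmdef hm6
  have hrank : (Module.finrank ℝ (Couple d) : ℝ) = (d : ℝ) + 1 := by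
    simp [Couple, Module.finrank_prod]
  have hrank0 : 0 ≤ (Module.finrank ℝ (Couple d) : ℝ) := Nat.cast_nonneg _
  set ρ := m / (1 - 2 * m) with hρ
  have hρpos : 0 < ρ := div_pos hm (by linarith)
  have hρ1 : ρ < 1 := by rw [hρ, div_lt_one (by linarith)]; linarith
  have hρm : ρ * (1 - 2 * m) = m := div_mul_cancel₀ _ (by linarith)
  -- The ratio (1 + ρ)/(1 − ρ) is (1 − m)/(1 − 3m), while 1 + δ is (1 − 2m)/(1 − 4m). After
  -- cross-multiplication they differ by 2m², and their lower analogues by 6m², which leaves room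
  -- for a rounding error m².
  set η := m ^ 2 with hη
  obtain ⟨e, he⟩ := exists_surjective_nat (Fin n → Fin n → ℚ)
  have hu : (1 + ρ) * (1 + η) / (1 - ρ) ≤ 1 + δ := by
    rw [div_le_iff₀ (by linarith)]
    have h1 : (1 + ρ) * (1 - 2 * m) = 1 - m := by linarith
    have h2 : (1 - ρ) * (1 - 2 * m) = 1 - 3 * m := by linarith
    have h3 : (1 - m) * (1 + η) * (1 - 4 * m) ≤ (1 - 2 * m) * (1 - 3 * m) := by
      have : 0 ≤ m ^ 2 * (1 + m * (5 - 4 * m)) :=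
        mul_nonneg (sq_nonneg m) (add_nonneg zero_le_one (mul_nonneg hm.le (by linarith)))
      rw [hη]; linarith
    have h4 : (1 + δ) * (1 - 4 * m) = 1 - 2 * m := by linarith
    have hp : 0 < (1 - 2 * m) * (1 - 4 * m) := mul_pos (by linarith) (by linarith)
    refine le_of_mul_le_mul_right ?_ hp
    calc _ = ((1 + ρ) * (1 - 2 * m)) * (1 + η) * (1 - 4 * m) := by ring
      _ ≤ (1 - 2 * m) * (1 - 3 * m) := by rw [h1]; exact h3
      _ = ((1 + δ) * (1 - 4 * m)) * ((1 - ρ) * (1 - 2 * m)) := by rw [h2, h4]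
      _ = _ := by ring
  have hlow : 1 - δ ≤ (1 - ρ) * (1 - η) / (1 + ρ) := by
    rw [le_div_iff₀ (by linarith)]
    have h1 : (1 + ρ) * (1 - 2 * m) = 1 - m := by linarith
    have h2 : (1 - ρ) * (1 - 2 * m) = 1 - 3 * m := by linarith
    have h3 : (1 - 6 * m) * (1 - m) ≤ (1 - 3 * m) * (1 - η) * (1 - 4 * m) := by
      have : 0 ≤ m ^ 2 * (5 + m * (7 - 12 * m)) :=
        mul_nonneg (sq_nonneg m) (add_nonneg (by norm_num) (mul_nonneg hm.le (by linarith)))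
      rw [hη]; linarith
    have h4 : (1 - δ) * (1 - 4 * m) = 1 - 6 * m := by linarith
    have hp : 0 < (1 - 2 * m) * (1 - 4 * m) := mul_pos (by linarith) (by linarith)
    refine le_of_mul_le_mul_right ?_ hp
    calc _ = ((1 - δ) * (1 - 4 * m)) * ((1 + ρ) * (1 - 2 * m)) := by ring
      _ ≤ (1 - 3 * m) * (1 - η) * (1 - 4 * m) := by rw [h1, h4]; exact h3
      _ = ((1 - ρ) * (1 - 2 * m)) * (1 - η) * (1 - 4 * m) := by rw [h2]
      _ = _ := by ring
  refine ⟨quadEstimator resid (TopologicalSpace.denseSeq (Couple d)) l ((1 - ρ) * (1 - η))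
    ((1 + ρ) * (1 + η)) e, measurable_quadEstimator measurable_resid, fun P _ hP => ?_⟩
  obtain ⟨B, hBm, hBP, hB⟩ := hP.exists_good_event (sq_nonneg _) n hr (l := l) (ρ := ρ)
    (L := Real.log ε⁻¹) (fun σ v hσ => by rw [hrank]; exact hdev σ v hσ) hε le_rfl
  refine ⟨B, hBm, ?_, fun z hz θ ξ => ?_⟩
  · have h1 := prob_compl_eq_one_sub (μ := Measure.pi fun _ : Fin n => P) hBm.compl
    rw [compl_compl] at h1
    rw [h1, ENNReal.ofReal_sub _ (by positivity), ENNReal.ofReal_one]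
    exact tsub_le_tsub_left hBP 1
  · obtain ⟨h₁, h₂, h₃⟩ := hB z hz
    obtain ⟨hlo, hup⟩ := hP.quadEstimator_bounds (TopologicalSpace.denseRange_denseSeq (Couple d))
      he hl hρpos hρ1 (by positivity : 0 < η) (by rw [hη]; nlinarith) h₁ h₂ h₃ (θ, ξ)
    have hN : 0 ≤ secondMoment P resid (θ, ξ) := KurtosisBound.secondMoment_nonneg _
    rw [← secondMoment_resid, abs_le]
    have h4 := mul_le_mul_of_nonneg_right hu hN
    have h5 := mul_le_mul_of_nonneg_right hlow hN
    constructor <;> linarith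

end

end RobustLS

theorem mainTheorem11 :
    -- the estimator: it depends only on `d`, `n`, `ε`, `κ₁`, `κ₂` and on the sample,
    -- and not on the law `P`
    (∀ (d n : ℕ) (ε κ₁ κ₂ : ℝ), 0 < ε → 0 ≤ κ₁ → 0 ≤ κ₂ → 1 < RobustLS.kurt κ₁ κ₂ →
      RobustLS.threshold d ε κ₁ κ₂ < (n : ℝ) →
      0 < RobustLS.delta d n ε κ₁ κ₂ → RobustLS.delta d n ε κ₁ κ₂ < 1 →
      ∃ N : (Fin n → RobustLS.Couple d) → QuadraticForm ℝ (RobustLS.Couple d),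
        (∀ v : RobustLS.Couple d, Measurable fun z => N z v) ∧
        ∀ (P : Measure (RobustLS.Couple d)) [IsProbabilityMeasure P],
          MemLp (fun z : RobustLS.Couple d => z.1) 2 P →
          MemLp (fun z : RobustLS.Couple d => z.2) 2 P →
          ∀ θstar : EuclideanSpace ℝ (Fin d), (∀ θ, RobustLS.risk P θstar ≤ RobustLS.risk P θ) →
          RobustLS.kurtosisDesign P ≤ ENNReal.ofReal κ₁ →
          RobustLS.kurtosisNoise P θstar ≤ ENNReal.ofReal κ₂ →
          ∃ B : Set (Fin n → RobustLS.Couple d), MeasurableSet B ∧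
            ENNReal.ofReal (1 - 2 * ε) ≤ Measure.pi (fun _ : Fin n => P) B ∧
            ∀ z ∈ B,
              (∀ (θ : EuclideanSpace ℝ (Fin d)) (ξ : ℝ),
                |N z (θ, ξ) - RobustLS.energy P θ ξ|
                  ≤ RobustLS.delta d n ε κ₁ κ₂ * RobustLS.energy P θ ξ) ∧
              ∀ θhat : EuclideanSpace ℝ (Fin d), (∀ θ, N z (θhat, 1) ≤ N z (θ, 1)) →
                RobustLS.risk P θhat - RobustLS.risk P θstar
                  ≤ RobustLS.delta d n ε κ₁ κ₂ ^ 2 / (1 - RobustLS.delta d n ε κ₁ κ₂) ^ 2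
                    * RobustLS.risk P θstar) ∧
    -- `δ² = O((κ₁ + κ₂)(d + log ε⁻¹) / n)`, with a numerical constant
    (∃ C : ℝ, 0 < C ∧ ∀ (d n : ℕ) (ε κ₁ κ₂ : ℝ), 1 ≤ d → 0 < ε → ε ≤ 1 → 0 ≤ κ₁ → 0 ≤ κ₂ →
      1 < RobustLS.kurt κ₁ κ₂ →
      0 < RobustLS.delta d n ε κ₁ κ₂ → RobustLS.delta d n ε κ₁ κ₂ < 1 →
      RobustLS.delta d n ε κ₁ κ₂ ^ 2 ≤ C * ((κ₁ + κ₂) * (d + Real.log ε⁻¹) / n)) ∧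
    -- the threshold is `O((κ₁ + κ₂)(d + log ε⁻¹))` as long as `(√κ₁ + √κ₂)²` stays away from `1`
    (∀ κ₀ : ℝ, 1 < κ₀ → ∃ C : ℝ, 0 < C ∧ ∀ (d : ℕ) (ε κ₁ κ₂ : ℝ), 1 ≤ d → 0 < ε → ε ≤ 1 →
      0 ≤ κ₁ → 0 ≤ κ₂ → κ₀ ≤ RobustLS.kurt κ₁ κ₂ →
      RobustLS.threshold d ε κ₁ κ₂ ≤ C * ((κ₁ + κ₂) * (d + Real.log ε⁻¹))) := by
  refine ⟨?_, ⟨60000, by norm_num, fun d n ε κ₁ κ₂ hd hε hε1 h1 h2 hk h0 hδ =>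
      RobustLS.delta_sq_le hd hε hε1 h1 h2 hk h0 hδ⟩,
    fun κ₀ hκ₀ => ⟨3200 + 12 * (5 / 2 + 1 / (2 * (κ₀ - 1))) ^ 2, by positivity,
      fun d ε κ₁ κ₂ hd hε hε1 h1 h2 hk => RobustLS.threshold_le hκ₀ hd hε hε1 h1 h2 hk⟩⟩
  intro d n ε κ₁ κ₂ hε hκ₁ hκ₂ hk hn hδ0 hδ1
  obtain ⟨N, hN, hP⟩ := RobustLS.exists_estimator hε hk hn hδ0 hδ1
  refine ⟨N, hN, fun P _ hX hY θstar hmin h₁ h₂ => ?_⟩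
  obtain ⟨B, hBm, hBP, hB⟩ := hP P (RobustLS.kurtosisBound_resid hX hY hmin hκ₁ hκ₂ h₁ h₂)
  exact ⟨B, hBm, hBP, fun z hz => ⟨hB z hz, fun θhat hhat =>
    RobustLS.risk_sub_le hX hY hmin hδ0 hδ1 (hB z hz) hhat⟩⟩
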